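/- Let $n \ge 3$ be an integer and let $\max\left(1, \frac{2n}{n+4}\right) \le p \le \frac{2n+2}{n+5}$ with $(n,p) \ne (4,1)$. There is a constant $C_{n,p}$, depending only on $n$ and $p$, such that the following holds. For a Schwartz function $\varphi$ on $\mathbb{R}^n$ write $\hat\varphi(\xi) = \int_{\mathbb{R}^n} e^{-i\xi\cdot x}\varphi(x)\,dx$. Let $f \in L^p(\mathbb{R}^n)$ be complex-valued, and suppose that $\hat f$ vanishes on the unit sphere in the $L^2$-trace sense, i.e. there are Schwartz functions $\varphi_k$ with $\varphi_k \to f$ in $L^p(\mathbb{R}^n)$ and $\hat\varphi_k|_{\mathbb{S}^{n-1}} \to 0$ in $L^2(\mathbb{S}^{n-1})$ (with respect to surface measure). Then there exists a unique $u \in L^2(\mathbb{R}^n)$ such that $(-\Delta - 1)u = f$ in the sense of tempered distributions. Furthermore, $\|u\|_{L^2(\mathbb{R}^n)} \le C_{n,p}\|f\|_{L^p(\mathbb{R}^n)}$. -/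

import Mathlib

open MeasureTheory Filter Topology
open scoped ENNReal SchwartzMap Laplacian

noncomputable section

namespace Helmholtz

/-- Euclidean space `ℝⁿ`. -/
abbrev Space (n : ℕ) : Type := EuclideanSpace ℝ (Fin n)

/-- The unit sphere `𝕊ⁿ⁻¹` of `ℝⁿ`. -/
abbrev UnitSphere (n : ℕ) : Type := Metric.sphere (0 : Space n) 1

/-- Surface measure on the unit sphere. -/
abbrev surfaceMeasure (n : ℕ) : Measure (UnitSphere n) :=
  (volume : Measure (Space n)).toSphere

/-- The Fourier transform `φ̂(ξ) = ∫ e^{-i ξ·x} φ(x) dx` of a Schwartz function. The frequency `ξ` is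
not rescaled by `2π`, so that `-Δ` has symbol `|ξ|²`. -/
def fourier {n : ℕ} (φ : 𝓢(Space n, ℂ)) (ξ : Space n) : ℂ :=
  ∫ x : Space n, Complex.exp (-Complex.I * (inner ℝ ξ x : ℝ)) * φ x

/-- `g` is an `L²`-trace of `f̂` on the unit sphere, for `f ∈ Lᵖ(ℝⁿ)`: some Schwartz functions `φ_k`
converge to `f` in `Lᵖ` while the restrictions of `φ̂_k` to the sphere converge to `g` in
`L²(𝕊ⁿ⁻¹)`. That is, `(f, g)` lies in the closure of the graph of the restriction map
`φ ↦ φ̂|_{𝕊ⁿ⁻¹}` defined on Schwartz functions. -/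
def HasSphereTrace {n : ℕ} {p : ℝ≥0∞} [Fact (1 ≤ p)]
    (f : Lp ℂ p (volume : Measure (Space n))) (g : UnitSphere n → ℂ) : Prop :=
  MemLp g 2 (surfaceMeasure n) ∧
    ∃ φ : ℕ → 𝓢(Space n, ℂ),
      Tendsto (fun k => (φ k).toLp p (volume : Measure (Space n))) atTop (𝓝 f) ∧
      Tendsto (fun k => eLpNorm (fun ω : UnitSphere n => fourier (φ k) (ω : Space n) - g ω) 2
        (surfaceMeasure n)) atTop (𝓝 0)

/-- `f̂` vanishes on the unit sphere in the `L²`-trace sense. -/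
def FourierVanishesOnSphere {n : ℕ} {p : ℝ≥0∞} [Fact (1 ≤ p)]
    (f : Lp ℂ p (volume : Measure (Space n))) : Prop :=
  HasSphereTrace f (fun _ => 0)

/-- `u ∈ L²(ℝⁿ)` solves `(-Δ - 1) u = f` in the sense of (tempered) distributions. -/
def IsSolution {n : ℕ} {p : ℝ≥0∞} [Fact (1 ≤ p)]
    (u : Lp ℂ 2 (volume : Measure (Space n))) (f : Lp ℂ p (volume : Measure (Space n))) : Prop :=
  -(Δ (Lp.toTemperedDistribution u)) - Lp.toTemperedDistribution u = Lp.toTemperedDistribution f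

end Helmholtz

end

/-!
By duality it is enough to show `|⟨f, ψ⟩| ≤ C ‖f‖_p ‖(-Δ - 1) ψ‖₂` for Schwartz functions `ψ`:
since `-Δ - 1` has dense range in `L²`, the functional `(-Δ - 1) ψ ↦ ⟨f, ψ⟩` is then represented by
exactly one `u ∈ L²`, and `‖u‖₂ ≤ C ‖f‖_p`.

Put `σ_ε(ξ) = ε + i (|ξ|² - 1)` and consider the complex powers `σ_ε⁻ˢ` as Fourier multipliers. On
`Re s = 0` they are bounded on `L²`. For `n / 2 ≤ Re s ≤ (n + 1) / 2`, write
`Γ(s) σ⁻ˢ = ∫ tˢ⁻¹ e^{-tσ} dt` and insert the kernel of the Schrödinger propagator. The kernel of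
`σ_ε⁻ˢ` becomes an oscillatory integral against `t^{s - n/2 - 1}`, which is bounded uniformly in `ε`
after multiplication by `s - n / 2`, the factor that cancels its pole on the diagonal. The three
lines theorem gives `|∫ σ_ε⁻² |φ̂|²| ≤ A ‖φ‖_p²` uniformly in `ε`. For `p = 1`, `n = 3` this is the
kernel bound at `s = 2`; for `p = 1`, `n = 4` the factor `s - n / 2` vanishes there.

The form `R(ε) = ∫ σ_ε⁻¹ |φ̂|²` has derivative `-∫ σ_ε⁻² |φ̂|²`, and its real part
`ε ∫ |φ̂|² / |σ_ε|²` tends to a multiple of `∫_{𝕊} |φ̂|²` as `ε → 0`. Integrating,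
`∫ |φ̂|² / |σ_ε|² ≤ c ε⁻¹ ∫_{𝕊} |φ̂|² + A ‖φ‖_p²`. Apply Cauchy-Schwarz to
`⟨φ_k, ψ⟩ = ∫ (φ̂_k / σ_ε) (σ_ε ψ̌)`, let `k → ∞`, which removes the sphere term, and then `ε → 0`.
-/

noncomputable section

namespace Helmholtz

open FourierTransform

/-! ### A uniform bound for an oscillatory integral -/

section OscillatoryIntegral

variable {E : Type*} [NormedAddCommGroup E] [NormedSpace ℝ E]

lemma norm_intervalIntegral_le_of_hasDerivAt_add [CompleteSpace E] {c d : ℝ} (hcd : c ≤ d)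
    {H X Y : ℝ → E} {G g : ℝ → ℝ}
    (hH : ∀ t ∈ Set.Icc c d, HasDerivAt H (X t + Y t) t)
    (hX : ContinuousOn X (Set.Icc c d)) (hY : ContinuousOn Y (Set.Icc c d))
    (hYg : ∀ t ∈ Set.Icc c d, ‖Y t‖ ≤ g t) (hg : ContinuousOn g (Set.Icc c d))
    (hG : ∀ t ∈ Set.Icc c d, HasDerivAt G (g t) t) :
    ‖∫ t in c..d, X t‖ ≤ ‖H c‖ + ‖H d‖ + (G d - G c) := by
  rw [← Set.uIcc_of_le hcd] at hX hY hg hH hG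
  have hXY := intervalIntegral.integral_eq_sub_of_hasDerivAt hH
    (hX.intervalIntegrable.add hY.intervalIntegrable)
  rw [intervalIntegral.integral_add hX.intervalIntegrable hY.intervalIntegrable] at hXY
  have hYG : ‖∫ t in c..d, Y t‖ ≤ G d - G c := by
    rw [← intervalIntegral.integral_eq_sub_of_hasDerivAt hG hg.intervalIntegrable]
    exact intervalIntegral.norm_integral_le_of_norm_le hcd
      (ae_of_all _ fun t ht => hYg t (Set.Ioc_subset_Icc_self ht)) hg.intervalIntegrable
  rw [eq_sub_of_add_eq hXY]
  calc ‖H d - H c - ∫ t in c..d, Y t‖ ≤ ‖H d‖ + ‖H c‖ + ‖∫ t in c..d, Y t‖ :=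
        (norm_sub_le _ _).trans (by gcongr; exact norm_sub_le _ _)
    _ ≤ ‖H c‖ + ‖H d‖ + (G d - G c) := by linarith

lemma norm_setIntegral_Ioi_le_of_eventually {f : ℝ → E} {a B : ℝ}
    (hf : IntegrableOn f (Set.Ioi a))
    (hB : ∀ᶠ c in 𝓝[>] a, ∀ᶠ d in atTop, ‖∫ t in c..d, f t‖ ≤ B) :
    ‖∫ t in Set.Ioi a, f t‖ ≤ B := by
  have hlim : Tendsto (fun c => ∫ t in Set.Ioi c, f t) (𝓝[>] a) (𝓝 (∫ t in Set.Ioi a, f t)) := by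
    refine ((aecover_Ioi_of_Ioi (tendsto_id'.2 nhdsWithin_le_nhds)
      ).integral_tendsto_of_countably_generated hf).congr' ?_
    filter_upwards [self_mem_nhdsWithin] with c hc
    rw [Measure.restrict_restrict measurableSet_Ioi, id,
      Set.inter_eq_left.2 (Set.Ioi_subset_Ioi (le_of_lt hc))]
  refine le_of_tendsto hlim.norm ?_
  filter_upwards [hB, self_mem_nhdsWithin] with c hc hac
  exact le_of_tendsto (intervalIntegral_tendsto_integral_Ioi c
    (hf.mono_set (Set.Ioi_subset_Ioi (le_of_lt hac))) tendsto_id).norm hc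

lemma hasDerivAt_ofReal_cpow (w : ℂ) {t : ℝ} (ht : 0 < t) :
    HasDerivAt (fun t : ℝ => (t : ℂ) ^ w) (w * (t : ℂ) ^ (w - 1)) t := by
  simpa using
    ((hasDerivAt_id (t : ℂ)).cpow_const (c := w) (Or.inl (by simpa using ht))).comp_ofReal

lemma ofReal_cpow_add_one (w : ℂ) {t : ℝ} (ht : 0 < t) :
    (t : ℂ) ^ (w + 1) = (t : ℂ) ^ w * t := by
  rw [Complex.cpow_add _ _ (Complex.ofReal_ne_zero.2 ht.ne'), Complex.cpow_one]

lemma norm_ofReal_cpow_le {w : ℂ} (hw0 : 0 ≤ w.re) (hw1 : w.re ≤ 1 / 2) {t : ℝ} (ht : 0 < t) :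
    ‖(t : ℂ) ^ w‖ ≤ 1 + √t := by
  rw [Complex.norm_cpow_eq_rpow_re_of_pos ht]
  rcases le_total t 1 with h | h
  · linarith [Real.rpow_le_one ht.le h hw0, Real.sqrt_nonneg t]
  · have := Real.rpow_le_rpow_of_exponent_le h hw1
    rw [← Real.sqrt_eq_rpow] at this
    linarith

/-- The oscillating factor of the kernel of a complex power of the resolvent of `-Δ`, written in
the proper time `t` of the Schrödinger propagator; `ρ` is half the distance to the diagonal. -/
def osc (ε ρ t : ℝ) : ℂ := Complex.exp ((Complex.I - ε) * t + Complex.I * ρ ^ 2 / t)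

/-- The logarithmic derivative of `osc ε ρ`, multiplied by `t ^ 2`. The phase of `osc ε ρ` is
stationary at `t = ρ`. -/
def oscSlope (ε ρ t : ℝ) : ℂ := (Complex.I - ε) * t ^ 2 - Complex.I * ρ ^ 2

variable {w : ℂ} {ε ρ c d t : ℝ}

lemma norm_osc (ε ρ t : ℝ) : ‖osc ε ρ t‖ = Real.exp (-ε * t) := by
  have hphase : Complex.I * (ρ : ℂ) ^ 2 / t = ((ρ ^ 2 / t : ℝ) : ℂ) * Complex.I := by
    push_cast; ring
  rw [osc, Complex.norm_exp, hphase, Complex.add_re, Complex.re_ofReal_mul]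
  simp

lemma norm_osc_le_one (hε : 0 ≤ ε) (ht : 0 < t) : ‖osc ε ρ t‖ ≤ 1 := by
  rw [norm_osc]
  exact Real.exp_le_one_iff.2 (by nlinarith)

lemma hasDerivAt_osc (ε ρ : ℝ) (ht : 0 < t) :
    HasDerivAt (osc ε ρ) (oscSlope ε ρ t / t ^ 2 * osc ε ρ t) t := by
  have hd : HasDerivAt (fun t : ℝ => (t : ℂ)) 1 t := Complex.ofRealCLM.hasDerivAt
  have ht' : (t : ℂ) ≠ 0 := Complex.ofReal_ne_zero.2 ht.ne'
  refine (((hd.const_mul (Complex.I - ε)).add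
    ((hasDerivAt_const t (Complex.I * (ρ : ℂ) ^ 2)).div hd ht')).cexp).congr_deriv ?_
  simp only [osc, oscSlope, Pi.add_apply, Pi.div_apply]
  field_simp
  ring

lemma hasDerivAt_oscSlope (ε ρ t : ℝ) :
    HasDerivAt (oscSlope ε ρ) (2 * (Complex.I - ε) * t) t := by
  have hd : HasDerivAt (fun t : ℝ => (t : ℂ)) 1 t := Complex.ofRealCLM.hasDerivAt
  refine (((hd.pow 2).const_mul (Complex.I - (ε : ℂ))).sub_const _).congr_deriv ?_
  simp only [Nat.cast_ofNat, Nat.add_one_sub_one, pow_one, mul_one]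
  ring

lemma continuous_oscSlope (ε ρ : ℝ) : Continuous (oscSlope ε ρ) :=
  continuous_iff_continuousAt.2 fun t => (hasDerivAt_oscSlope ε ρ t).continuousAt

lemma continuousOn_osc (ε ρ : ℝ) : ContinuousOn (osc ε ρ) (Set.Ioi 0) := fun _ ht =>
  (hasDerivAt_osc ε ρ ht).continuousAt.continuousWithinAt

lemma continuousOn_ofReal_cpow (w : ℂ) :
    ContinuousOn (fun t : ℝ => (t : ℂ) ^ w) (Set.Ioi 0) := fun _ ht =>
  (hasDerivAt_ofReal_cpow w ht).continuousAt.continuousWithinAt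

lemma continuousOn_cpow_mul_osc (w : ℂ) (ε ρ : ℝ) :
    ContinuousOn (fun t : ℝ => (t : ℂ) ^ w * osc ε ρ t) (Set.Ioi 0) :=
  (continuousOn_ofReal_cpow w).mul (continuousOn_osc ε ρ)

lemma Icc_subset_Ioi_zero (hc : 0 < c) : Set.Icc c d ⊆ Set.Ioi 0 := fun _ ht => hc.trans_le ht.1

lemma norm_I_sub_ofReal_le (hε : 0 ≤ ε) (hε1 : ε ≤ 1) : ‖Complex.I - (ε : ℂ)‖ ≤ 2 := by
  refine (norm_sub_le _ _).trans ?_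
  rw [Complex.norm_I, Complex.norm_real, Real.norm_of_nonneg hε]
  linarith

lemma norm_oscSlope_le (hε : 0 ≤ ε) (hε1 : ε ≤ 1) (ρ t : ℝ) :
    ‖oscSlope ε ρ t‖ ≤ 2 * t ^ 2 + ρ ^ 2 := by
  refine (norm_sub_le _ _).trans ?_
  simp only [norm_mul, norm_pow, Complex.norm_real, Real.norm_eq_abs, sq_abs, Complex.norm_I,
    one_mul]
  gcongr
  exact norm_I_sub_ofReal_le hε hε1

lemma abs_sub_mul_add_le_norm_oscSlope (ε : ℝ) (ht : 0 < t) (hρ : 0 ≤ ρ) :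
    |t - ρ| * (t + ρ) ≤ ‖oscSlope ε ρ t‖ := by
  have him : (oscSlope ε ρ t).im = (t - ρ) * (t + ρ) := by
    have : oscSlope ε ρ t =
        ((-(ε * t ^ 2) : ℝ) : ℂ) + (((t - ρ) * (t + ρ) : ℝ) : ℂ) * Complex.I := by
      simp only [oscSlope]; push_cast; ring
    rw [this, Complex.add_im, Complex.im_ofReal_mul, Complex.ofReal_im, Complex.I_im]
    ring
  calc |t - ρ| * (t + ρ) = |(oscSlope ε ρ t).im| := by
        rw [him, abs_mul, abs_of_pos (show 0 < t + ρ by linarith)]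
    _ ≤ ‖oscSlope ε ρ t‖ := Complex.abs_im_le_norm _

lemma oscSlope_ne_zero (ε : ℝ) (ht : 0 < t) (hρ : 0 ≤ ρ) (htρ : t ≠ ρ) : oscSlope ε ρ t ≠ 0 := by
  rw [← norm_pos_iff]
  refine lt_of_lt_of_le ?_ (abs_sub_mul_add_le_norm_oscSlope ε ht hρ)
  have := abs_pos.2 (sub_ne_zero.2 htρ)
  positivity

/-- The error left over when `t ^ (w - 1) * osc ε ρ t` is integrated by parts against the full
phase, with primitive `t ^ (w + 1) / oscSlope ε ρ t * osc ε ρ t`. -/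
def oscRemainder (w : ℂ) (ε ρ t : ℝ) : ℂ :=
  ((w + 1) * (t : ℂ) ^ w / oscSlope ε ρ t
    - (t : ℂ) ^ w * (2 * (Complex.I - ε)) * t ^ 2 / oscSlope ε ρ t ^ 2) * osc ε ρ t

lemma hasDerivAt_cpow_div_oscSlope_mul_osc (w : ℂ) (ht : 0 < t) (hQ : oscSlope ε ρ t ≠ 0) :
    HasDerivAt (fun t : ℝ => (t : ℂ) ^ (w + 1) / oscSlope ε ρ t * osc ε ρ t)
      ((t : ℂ) ^ (w - 1) * osc ε ρ t + oscRemainder w ε ρ t) t := by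
  have ht' : (t : ℂ) ≠ 0 := Complex.ofReal_ne_zero.2 ht.ne'
  refine (((hasDerivAt_ofReal_cpow (w + 1) ht).div (hasDerivAt_oscSlope ε ρ t) hQ).mul
    (hasDerivAt_osc ε ρ ht)).congr_deriv ?_
  have hpow : (t : ℂ) ^ w = (t : ℂ) ^ (w - 1) * t := by simpa using ofReal_cpow_add_one (w - 1) ht
  simp only [oscRemainder, Pi.div_apply, add_sub_cancel_right, ofReal_cpow_add_one w ht, hpow]
  field_simp
  ring

lemma norm_oscRemainder_le (w : ℂ) (hε : 0 ≤ ε) (hε1 : ε ≤ 1) (ht : 0 < t) (hρ : 0 ≤ ρ)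
    (htρ : t ≠ ρ) :
    ‖oscRemainder w ε ρ t‖ ≤ (‖w‖ + 5) * (‖(t : ℂ) ^ w‖ / |t - ρ| ^ 2) := by
  have hu : 0 < |t - ρ| := abs_pos.2 (sub_ne_zero.2 htρ)
  have hut : |t - ρ| ≤ t + ρ := abs_le.2 ⟨by linarith, by linarith⟩
  have hQ := abs_sub_mul_add_le_norm_oscSlope ε ht hρ
  have hQ1 : |t - ρ| ^ 2 ≤ ‖oscSlope ε ρ t‖ := le_trans (by nlinarith) hQ
  have hQ2 : |t - ρ| ^ 2 * t ^ 2 ≤ ‖oscSlope ε ρ t‖ ^ 2 := by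
    rw [← mul_pow]
    gcongr
    exact le_trans (by nlinarith) hQ
  have hQpos : 0 < ‖oscSlope ε ρ t‖ := lt_of_lt_of_le (by positivity) hQ1
  calc ‖oscRemainder w ε ρ t‖
      ≤ ‖(w + 1) * (t : ℂ) ^ w / oscSlope ε ρ t
          - (t : ℂ) ^ w * (2 * (Complex.I - ε)) * t ^ 2 / oscSlope ε ρ t ^ 2‖ := by
        rw [oscRemainder, norm_mul]
        exact mul_le_of_le_one_right (norm_nonneg _) (norm_osc_le_one hε ht)
    _ ≤ ‖w + 1‖ * ‖(t : ℂ) ^ w‖ / ‖oscSlope ε ρ t‖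
          + ‖(t : ℂ) ^ w‖ * (2 * ‖Complex.I - (ε : ℂ)‖) * t ^ 2 / ‖oscSlope ε ρ t‖ ^ 2 := by
        refine (norm_sub_le _ _).trans (le_of_eq ?_)
        simp [abs_of_pos ht]
    _ ≤ (‖w‖ + 1) * ‖(t : ℂ) ^ w‖ / |t - ρ| ^ 2
          + ‖(t : ℂ) ^ w‖ * (2 * 2) * (1 / |t - ρ| ^ 2) := by
        rw [mul_div_assoc (‖(t : ℂ) ^ w‖ * _)]
        gcongr ?_ * ?_ / ?_ + ?_ * (2 * ?_) * ?_
        · exact (norm_add_le _ _).trans (by simp)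
        · exact norm_I_sub_ofReal_le hε hε1
        · rw [div_le_div_iff₀ (by positivity) (by positivity)]
          linarith
    _ = (‖w‖ + 5) * (‖(t : ℂ) ^ w‖ / |t - ρ| ^ 2) := by ring

lemma norm_ofReal_cpow_le_sqrt_abs_sub (hw0 : 0 ≤ w.re) (hw1 : w.re ≤ 1 / 2) (ht : 0 < t)
    (hρ : 0 ≤ ρ) : ‖(t : ℂ) ^ w‖ ≤ 1 + √ρ + √|t - ρ| := by
  have hsqrt : √t ≤ √ρ + √|t - ρ| := by
    rw [Real.sqrt_le_left (by positivity), add_sq, Real.sq_sqrt hρ, Real.sq_sqrt (abs_nonneg _)]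
    have : 0 ≤ 2 * √ρ * √|t - ρ| := by positivity
    linarith [le_abs_self (t - ρ)]
  linarith [norm_ofReal_cpow_le hw0 hw1 ht]

lemma norm_cpow_div_oscSlope_mul_osc_le (hw0 : 0 ≤ w.re) (hw1 : w.re ≤ 1 / 2) (hε : 0 ≤ ε)
    (ht : 0 < t) (hρ : 0 ≤ ρ) (h1 : 1 ≤ |t - ρ|) (hsqrt : √ρ ≤ |t - ρ|) :
    ‖(t : ℂ) ^ (w + 1) / oscSlope ε ρ t * osc ε ρ t‖ ≤ 3 := by
  have hQ := abs_sub_mul_add_le_norm_oscSlope ε ht hρ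
  have hQpos : 0 < ‖oscSlope ε ρ t‖ := lt_of_lt_of_le (by positivity) hQ
  have hs : √|t - ρ| ≤ |t - ρ| := by
    rw [Real.sqrt_le_left (by linarith)]
    nlinarith
  rw [norm_mul, norm_div, ofReal_cpow_add_one w ht, norm_mul, Complex.norm_real,
    Real.norm_of_nonneg ht.le]
  refine (mul_le_of_le_one_right (by positivity) (norm_osc_le_one hε ht)).trans ?_
  rw [div_le_iff₀ hQpos]
  calc ‖(t : ℂ) ^ w‖ * t ≤ (1 + √ρ + √|t - ρ|) * (t + ρ) := by
        gcongr
        · exact norm_ofReal_cpow_le_sqrt_abs_sub hw0 hw1 ht hρ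
        · linarith
    _ ≤ 3 * |t - ρ| * (t + ρ) := by gcongr; linarith
    _ ≤ 3 * ‖oscSlope ε ρ t‖ := by rw [mul_assoc]; gcongr

lemma hasDerivAt_neg_div_add_two_div_sqrt {a σ : ℝ} (hσ : σ * σ = 1) (hu : 0 < σ * (t - ρ)) :
    HasDerivAt (fun t => -σ * (a / (σ * (t - ρ)) + 2 / √(σ * (t - ρ))))
      ((a + √(σ * (t - ρ))) / (σ * (t - ρ)) ^ 2) t := by
  have hd : HasDerivAt (fun t => σ * (t - ρ)) σ t := by
    simpa using ((hasDerivAt_id t).sub_const ρ).const_mul σ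
  have hs : 0 < √(σ * (t - ρ)) := Real.sqrt_pos.2 hu
  refine ((((hasDerivAt_const t a).div hd hu.ne').add
    ((hasDerivAt_const t (2 : ℝ)).div (hd.sqrt hu.ne') hs.ne')).const_mul (-σ)).congr_deriv ?_
  have hss : √(σ * (t - ρ)) ^ 2 = σ * (t - ρ) := Real.sq_sqrt hu.le
  generalize √(σ * (t - ρ)) = s at *
  rw [← hss]
  field_simp
  linear_combination (s + a) * hσ

lemma abs_sub_eq_mul_sub {σ : ℝ} (hσ : σ = 1 ∨ σ = -1) (hu : 0 < σ * (t - ρ)) :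
    |t - ρ| = σ * (t - ρ) := by
  rcases hσ with rfl | rfl
  · rw [abs_of_nonneg (by linarith), one_mul]
  · rw [abs_of_nonpos (by linarith), neg_one_mul]

lemma norm_integral_cpow_mul_osc_le_of_pos (hw0 : 0 ≤ w.re) (hw1 : w.re ≤ 1 / 2) (hε : 0 ≤ ε)
    (hε1 : ε ≤ 1) (hρ : 0 ≤ ρ) (hc : 0 < c) (hcd : c ≤ d) {σ : ℝ} (hσ : σ = 1 ∨ σ = -1)
    (hu : ∀ t ∈ Set.Icc c d, 0 < σ * (t - ρ)) :
    ‖∫ t in c..d, (t : ℂ) ^ (w - 1) * osc ε ρ t‖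
      ≤ ‖(c : ℂ) ^ (w + 1) / oscSlope ε ρ c * osc ε ρ c‖
        + ‖(d : ℂ) ^ (w + 1) / oscSlope ε ρ d * osc ε ρ d‖
        + ((‖w‖ + 5) * (-σ * ((1 + √ρ) / (σ * (d - ρ)) + 2 / √(σ * (d - ρ))))
          - (‖w‖ + 5) * (-σ * ((1 + √ρ) / (σ * (c - ρ)) + 2 / √(σ * (c - ρ))))) := by
  have hσ2 : σ * σ = 1 := by rcases hσ with rfl | rfl <;> norm_num
  have hsub := Icc_subset_Ioi_zero (d := d) hc
  have htρ : ∀ t ∈ Set.Icc c d, t ≠ ρ := fun t ht h => by simpa [h] using hu t ht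
  have hQ : ∀ t ∈ Set.Icc c d, oscSlope ε ρ t ≠ 0 := fun t ht =>
    oscSlope_ne_zero ε (hsub ht) hρ (htρ t ht)
  have hcpow := (continuousOn_ofReal_cpow w).mono hsub
  have hslope := (continuous_oscSlope ε ρ).continuousOn (s := Set.Icc c d)
  have hremainder : ContinuousOn (oscRemainder w ε ρ) (Set.Icc c d) :=
    (((continuousOn_const.mul hcpow).div hslope hQ).sub (((hcpow.mul continuousOn_const).mul
      (by fun_prop)).div (hslope.pow 2) fun t ht => pow_ne_zero 2 (hQ t ht))).mul
      ((continuousOn_osc ε ρ).mono hsub)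
  exact norm_intervalIntegral_le_of_hasDerivAt_add hcd
    (G := fun t => (‖w‖ + 5) * (-σ * ((1 + √ρ) / (σ * (t - ρ)) + 2 / √(σ * (t - ρ)))))
    (g := fun t => (‖w‖ + 5) * ((1 + √ρ + √(σ * (t - ρ))) / (σ * (t - ρ)) ^ 2))
    (fun t ht => hasDerivAt_cpow_div_oscSlope_mul_osc w (hsub ht) (hQ t ht))
    ((continuousOn_cpow_mul_osc _ ε ρ).mono hsub) hremainder
    (fun t ht => (norm_oscRemainder_le w hε hε1 (hsub ht) hρ (htρ t ht)).trans <| by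
      rw [← abs_sub_eq_mul_sub hσ (hu t ht)]
      gcongr
      exact norm_ofReal_cpow_le_sqrt_abs_sub hw0 hw1 (hsub ht) hρ)
    (continuousOn_const.mul (ContinuousOn.div (by fun_prop) (by fun_prop) fun t ht =>
      pow_ne_zero 2 (hu t ht).ne'))
    (fun t ht => (hasDerivAt_neg_div_add_two_div_sqrt hσ2 (hu t ht)).const_mul _)

lemma norm_integral_cpow_mul_osc_le_of_far (hw0 : 0 ≤ w.re) (hw1 : w.re ≤ 1 / 2) (hε : 0 ≤ ε)
    (hε1 : ε ≤ 1) (hρ : 0 ≤ ρ) (hc : 0 < c) (hcd : c ≤ d) {σ : ℝ} (hσ : σ = 1 ∨ σ = -1)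
    (h1 : ∀ t ∈ Set.Icc c d, 1 ≤ σ * (t - ρ)) (hsqrt : ∀ t ∈ Set.Icc c d, √ρ ≤ σ * (t - ρ)) :
    ‖∫ t in c..d, (t : ℂ) ^ (w - 1) * osc ε ρ t‖ ≤ 26 + 4 * ‖w‖ := by
  have hu : ∀ t ∈ Set.Icc c d, 0 < σ * (t - ρ) := fun t ht => one_pos.trans_le (h1 t ht)
  have key := norm_integral_cpow_mul_osc_le_of_pos hw0 hw1 hε hε1 hρ hc hcd hσ hu
  have hbdry : ∀ t ∈ Set.Icc c d, ‖(t : ℂ) ^ (w + 1) / oscSlope ε ρ t * osc ε ρ t‖ ≤ 3 :=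
    fun t ht => by
      have habs := abs_sub_eq_mul_sub hσ (hu t ht)
      exact norm_cpow_div_oscSlope_mul_osc_le hw0 hw1 hε (hc.trans_le ht.1) hρ
        (habs ▸ h1 t ht) (habs ▸ hsqrt t ht)
  have hmaj : ∀ t ∈ Set.Icc c d, 0 ≤ (1 + √ρ) / (σ * (t - ρ)) + 2 / √(σ * (t - ρ)) ∧
      (1 + √ρ) / (σ * (t - ρ)) + 2 / √(σ * (t - ρ)) ≤ 4 := fun t ht => by
    have hut := hu t ht
    have hs := Real.one_le_sqrt.2 (h1 t ht)
    have hle1 : (1 + √ρ) / (σ * (t - ρ)) ≤ 2 := by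
      rw [div_le_iff₀ hut]
      linarith [h1 t ht, hsqrt t ht]
    have hle2 : 2 / √(σ * (t - ρ)) ≤ 2 := by rw [div_le_iff₀ (by linarith)]; linarith
    exact ⟨by positivity, by linarith⟩
  obtain ⟨hc0, hc4⟩ := hmaj c (Set.left_mem_Icc.2 hcd)
  obtain ⟨hd0, hd4⟩ := hmaj d (Set.right_mem_Icc.2 hcd)
  have hbc := hbdry c (Set.left_mem_Icc.2 hcd)
  have hbd := hbdry d (Set.right_mem_Icc.2 hcd)
  generalize (1 + √ρ) / (σ * (c - ρ)) + 2 / √(σ * (c - ρ)) = x at *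
  generalize (1 + √ρ) / (σ * (d - ρ)) + 2 / √(σ * (d - ρ)) = y at *
  have hxy : (‖w‖ + 5) * (-σ * y - -σ * x) ≤ (‖w‖ + 5) * 4 := by
    gcongr
    rcases hσ with rfl | rfl <;> linarith
  linarith

lemma norm_ofReal_cpow_le_four (hw0 : 0 ≤ w.re) (hw1 : w.re ≤ 1 / 2) (ht : 0 < t) (ht6 : t ≤ 6) :
    ‖(t : ℂ) ^ w‖ ≤ 4 := by
  have hsqrt : √t ≤ 3 := by rw [Real.sqrt_le_left (by norm_num)]; linarith
  linarith [norm_ofReal_cpow_le hw0 hw1 ht]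

lemma norm_cpow_mul_osc_le_four (hw0 : 0 ≤ w.re) (hw1 : w.re ≤ 1 / 2) (hε : 0 ≤ ε) (ht : 0 < t)
    (ht6 : t ≤ 6) : ‖(t : ℂ) ^ w * osc ε ρ t‖ ≤ 4 := by
  rw [norm_mul]
  exact (mul_le_of_le_one_right (norm_nonneg _) (norm_osc_le_one hε ht)).trans
    (norm_ofReal_cpow_le_four hw0 hw1 ht ht6)

lemma hasDerivAt_cpow_mul_osc (w : ℂ) (ε ρ : ℝ) (ht : 0 < t) :
    HasDerivAt (fun t : ℝ => (t : ℂ) ^ w * osc ε ρ t)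
      (w * ((t : ℂ) ^ (w - 1) * osc ε ρ t)
        + oscSlope ε ρ t / t ^ 2 * ((t : ℂ) ^ w * osc ε ρ t)) t :=
  ((hasDerivAt_ofReal_cpow w ht).mul (hasDerivAt_osc ε ρ ht)).congr_deriv (by ring)

lemma norm_mul_integral_cpow_mul_osc_le_of_sq_le (hw0 : 0 ≤ w.re) (hw1 : w.re ≤ 1 / 2)
    (hε : 0 ≤ ε) (hε1 : ε ≤ 1) (hc : 0 < c) (hcd : c ≤ d) (hρc : ρ ^ 2 ≤ c) (hd : d ≤ 6) :
    ‖w * ∫ t in c..d, (t : ℂ) ^ (w - 1) * osc ε ρ t‖ ≤ 60 := by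
  have hsub := Icc_subset_Ioi_zero (d := d) hc
  have hsq : ∀ t ∈ Set.Icc c d, (t : ℂ) ^ 2 ≠ 0 := fun t ht =>
    pow_ne_zero 2 (Complex.ofReal_ne_zero.2 (hsub ht).ne')
  have hslope : ContinuousOn (fun t : ℝ => oscSlope ε ρ t / (t : ℂ) ^ 2) (Set.Icc c d) :=
    (continuous_oscSlope ε ρ).continuousOn.div (by fun_prop) hsq
  have hG : ∀ t ∈ Set.Icc c d,
      HasDerivAt (fun t => 4 * (2 * t - ρ ^ 2 / t)) (4 * (2 + ρ ^ 2 / t ^ 2)) t := fun t ht => by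
    have ht0 : t ≠ 0 := (hsub ht).ne'
    refine ((((hasDerivAt_id t).const_mul 2).sub
      ((hasDerivAt_const t (ρ ^ 2)).div (hasDerivAt_id t) ht0)).const_mul 4).congr_deriv ?_
    simp only [id]
    field_simp
    ring
  have key := norm_intervalIntegral_le_of_hasDerivAt_add hcd
    (fun t ht => hasDerivAt_cpow_mul_osc w ε ρ (hsub ht))
    (continuousOn_const.mul ((continuousOn_cpow_mul_osc (w - 1) ε ρ).mono hsub))
    (hslope.mul ((continuousOn_cpow_mul_osc w ε ρ).mono hsub))
    (g := fun t => 4 * (2 + ρ ^ 2 / t ^ 2)) (fun t ht => ?_)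
    (continuousOn_const.mul (continuousOn_const.add (ContinuousOn.div (by fun_prop) (by fun_prop)
      fun t ht => pow_ne_zero 2 (hsub ht).ne'))) hG
  · rw [← intervalIntegral.integral_const_mul]
    have hbdry : ∀ t ∈ Set.Icc c d, ‖(t : ℂ) ^ w * osc ε ρ t‖ ≤ 4 := fun t ht =>
      norm_cpow_mul_osc_le_four hw0 hw1 hε (hsub ht) (ht.2.trans hd)
    have hbc := hbdry c (Set.left_mem_Icc.2 hcd)
    have hbd := hbdry d (Set.right_mem_Icc.2 hcd)
    have hρc' : ρ ^ 2 / c ≤ 1 := (div_le_one hc).2 hρc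
    have hρd : 0 ≤ ρ ^ 2 / d := by have := hc.trans_le hcd; positivity
    refine key.trans ?_
    linarith
  · have ht0 : 0 < t := hsub ht
    rw [norm_mul, mul_comm, norm_div, norm_pow, Complex.norm_real, Real.norm_of_nonneg ht0.le]
    gcongr
    · exact norm_cpow_mul_osc_le_four hw0 hw1 hε ht0 (ht.2.trans hd)
    · rw [div_le_iff₀ (by positivity), add_mul, div_mul_cancel₀ _ (by positivity)]
      exact norm_oscSlope_le hε hε1 ρ t

lemma hasDerivAt_cpow_add_one_mul_osc (w : ℂ) (ε ρ : ℝ) (ht : 0 < t) :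
    HasDerivAt (fun t : ℝ => (t : ℂ) ^ (w + 1) * osc ε ρ t)
      (-(Complex.I * ρ ^ 2) * ((t : ℂ) ^ (w - 1) * osc ε ρ t)
        + ((w + 1) + (Complex.I - ε) * t) * ((t : ℂ) ^ w * osc ε ρ t)) t := by
  have ht' : (t : ℂ) ≠ 0 := Complex.ofReal_ne_zero.2 ht.ne'
  refine ((hasDerivAt_ofReal_cpow (w + 1) ht).mul (hasDerivAt_osc ε ρ ht)).congr_deriv ?_
  have hpow : (t : ℂ) ^ w = (t : ℂ) ^ (w - 1) * t := by simpa using ofReal_cpow_add_one (w - 1) ht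
  rw [add_sub_cancel_right, ofReal_cpow_add_one w ht, hpow, oscSlope]
  field_simp
  ring

lemma norm_integral_cpow_mul_osc_le_of_le_sq (hw0 : 0 ≤ w.re) (hw1 : w.re ≤ 1 / 2) (hε : 0 ≤ ε)
    (hε1 : ε ≤ 1) (hc : 0 < c) (hcd : c ≤ d) (hdρ : d ≤ ρ ^ 2) (hd : d ≤ 6) :
    ‖∫ t in c..d, (t : ℂ) ^ (w - 1) * osc ε ρ t‖ ≤ 60 + 4 * ‖w‖ := by
  have hsub := Icc_subset_Ioi_zero (d := d) hc
  have hρ2 : 0 < ρ ^ 2 := (hc.trans_le hcd).trans_le hdρ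
  have hosc : ∀ t ∈ Set.Icc c d, ‖(t : ℂ) ^ w * osc ε ρ t‖ ≤ 4 := fun t ht =>
    norm_cpow_mul_osc_le_four hw0 hw1 hε (hsub ht) (ht.2.trans hd)
  have key := norm_intervalIntegral_le_of_hasDerivAt_add hcd
    (fun t ht => hasDerivAt_cpow_add_one_mul_osc w ε ρ (hsub ht))
    (continuousOn_const.mul ((continuousOn_cpow_mul_osc (w - 1) ε ρ).mono hsub))
    (ContinuousOn.mul (by fun_prop) ((continuousOn_cpow_mul_osc w ε ρ).mono hsub))
    (g := fun _ => (‖w‖ + 13) * 4) (fun t ht => ?_) continuousOn_const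
    (fun t _ => by simpa using (hasDerivAt_id t).const_mul ((‖w‖ + 13) * 4))
  · have hbdry : ∀ t ∈ Set.Icc c d, ‖(t : ℂ) ^ (w + 1) * osc ε ρ t‖ ≤ ρ ^ 2 * 4 := fun t ht => by
      rw [ofReal_cpow_add_one w (hsub ht), mul_right_comm, mul_comm, norm_mul, Complex.norm_real,
        Real.norm_of_nonneg (le_of_lt (hsub ht))]
      exact mul_le_mul (ht.2.trans hdρ) (hosc t ht) (norm_nonneg _) hρ2.le
    have hbc := hbdry c (Set.left_mem_Icc.2 hcd)
    have hbd := hbdry d (Set.right_mem_Icc.2 hcd)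
    have hG : (‖w‖ + 13) * 4 * d - (‖w‖ + 13) * 4 * c ≤ (‖w‖ + 13) * 4 * ρ ^ 2 := by
      rw [← mul_sub]
      gcongr
      linarith
    rw [intervalIntegral.integral_const_mul, norm_mul] at key
    rw [norm_neg, norm_mul, Complex.norm_I, one_mul, norm_pow, Complex.norm_real, Real.norm_eq_abs,
      sq_abs] at key
    refine le_of_mul_le_mul_left (key.trans ?_) hρ2
    linarith
  · rw [norm_mul]
    gcongr
    · have ht6 := ht.2.trans hd
      calc ‖(w + 1) + (Complex.I - ε) * t‖ ≤ (‖w‖ + 1) + 2 * 6 := by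
            refine (norm_add_le _ _).trans (add_le_add ((norm_add_le _ _).trans (by simp)) ?_)
            rw [norm_mul, Complex.norm_real, Real.norm_of_nonneg (le_of_lt (hsub ht))]
            gcongr
            · exact le_of_lt (hsub ht)
            · exact norm_I_sub_ofReal_le hε hε1
        _ = ‖w‖ + 13 := by ring
    · exact hosc t ht

lemma integrableOn_cpow_mul_osc (hw : 0 < w.re) (hε : 0 < ε) (ρ : ℝ) :
    IntegrableOn (fun t : ℝ => (t : ℂ) ^ (w - 1) * osc ε ρ t) (Set.Ioi 0) := by
  refine Integrable.mono' (integrableOn_rpow_mul_exp_neg_mul_rpow (p := 1) (s := w.re - 1) (b := ε)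
    (by linarith) one_pos hε)
    ((continuousOn_cpow_mul_osc _ _ _).aestronglyMeasurable measurableSet_Ioi) ?_
  filter_upwards [ae_restrict_mem measurableSet_Ioi] with t ht
  rw [norm_mul, norm_osc, Complex.norm_cpow_eq_rpow_re_of_pos ht, Real.rpow_one]
  simp

lemma intervalIntegrable_cpow_mul_osc (w : ℂ) (ε ρ : ℝ) (hc : 0 < c) (hd : 0 < d) :
    IntervalIntegrable (fun t : ℝ => (t : ℂ) ^ (w - 1) * osc ε ρ t) volume c d :=
  ((continuousOn_cpow_mul_osc (w - 1) ε ρ).mono fun _ ht =>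
    (lt_min hc hd).trans_le ht.1).intervalIntegrable

lemma norm_mul_integral_cpow_mul_osc_le_of_le_six (hw0 : 0 ≤ w.re) (hw1 : w.re ≤ 1 / 2)
    (hε : 0 ≤ ε) (hε1 : ε ≤ 1) (hc : 0 < c) (hcd : c ≤ d) (hd : d ≤ 6) :
    ‖w * ∫ t in c..d, (t : ℂ) ^ (w - 1) * osc ε ρ t‖ ≤ ‖w‖ * (60 + 4 * ‖w‖) + 60 := by
  have hnear_nonneg : 0 ≤ ‖w‖ * (60 + 4 * ‖w‖) := by positivity
  have hnear : ∀ {b}, c ≤ b → b ≤ ρ ^ 2 → b ≤ 6 →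
      ‖w * ∫ t in c..b, (t : ℂ) ^ (w - 1) * osc ε ρ t‖ ≤ ‖w‖ * (60 + 4 * ‖w‖) := by
    intro b hcb hbρ hb6
    rw [norm_mul]
    gcongr
    exact norm_integral_cpow_mul_osc_le_of_le_sq hw0 hw1 hε hε1 hc hcb hbρ hb6
  rcases le_total (ρ ^ 2) c with hρc | hρc
  · linarith [norm_mul_integral_cpow_mul_osc_le_of_sq_le hw0 hw1 hε hε1 hc hcd hρc hd]
  rcases le_total d (ρ ^ 2) with hρd | hρd
  · linarith [hnear hcd hρd hd]
  have hρ0 : 0 < ρ ^ 2 := hc.trans_le hρc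
  rw [← intervalIntegral.integral_add_adjacent_intervals
    (intervalIntegrable_cpow_mul_osc w ε ρ hc hρ0)
    (intervalIntegrable_cpow_mul_osc w ε ρ hρ0 (hρ0.trans_le hρd)), mul_add]
  exact (norm_add_le _ _).trans (add_le_add (hnear hρc le_rfl (hρd.trans hd))
    (norm_mul_integral_cpow_mul_osc_le_of_sq_le hw0 hw1 hε hε1 hρ0 hρd le_rfl hd))

lemma norm_integral_cpow_mul_osc_stationary_le (hw1 : w.re ≤ 1 / 2) (hε : 0 ≤ ε) (hρ : 4 ≤ ρ) :
    ‖∫ t in (ρ - √ρ)..(ρ + √ρ), (t : ℂ) ^ (w - 1) * osc ε ρ t‖ ≤ 4 := by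
  have hs2 : 2 ≤ √ρ := by rw [Real.le_sqrt (by norm_num) (by linarith)]; linarith
  have hsq := Real.sq_sqrt (show 0 ≤ ρ by linarith)
  have hlow : 1 ≤ ρ - √ρ := by nlinarith
  have hhalf : ρ / 2 ≤ ρ - √ρ := by nlinarith
  refine (intervalIntegral.norm_integral_le_of_norm_le_const (C := 2 / √ρ) fun t ht => ?_).trans ?_
  · rw [Set.uIoc_of_le (by linarith)] at ht
    have ht1 : 1 ≤ t := hlow.trans ht.1.le
    have ht0 : 0 < t := by linarith
    rw [norm_mul]
    refine (mul_le_of_le_one_right (norm_nonneg _) (norm_osc_le_one hε ht0)).trans ?_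
    rw [Complex.norm_cpow_eq_rpow_re_of_pos ht0]
    calc t ^ (w - 1).re ≤ t ^ (-(1 / 2) : ℝ) :=
          Real.rpow_le_rpow_of_exponent_le ht1 (by simp; linarith)
      _ = 1 / √t := by rw [Real.rpow_neg ht0.le, Real.sqrt_eq_rpow, inv_eq_one_div]
      _ ≤ 2 / √ρ := by
          rw [div_le_div_iff₀ (Real.sqrt_pos.2 ht0) (by linarith), one_mul,
            Real.sqrt_le_left (by positivity), mul_pow, Real.sq_sqrt ht0.le]
          linarith [ht.1]
  · rw [show ρ + √ρ - (ρ - √ρ) = 2 * √ρ by ring, abs_of_nonneg (by linarith),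
      div_mul_eq_mul_div, div_le_iff₀ (by linarith)]
    linarith

lemma norm_integral_cpow_mul_osc_le_of_four_le (hw0 : 0 ≤ w.re) (hw1 : w.re ≤ 1 / 2) (hε : 0 ≤ ε)
    (hε1 : ε ≤ 1) (hρ : 4 ≤ ρ) (hc : 0 < c) (hcρ : c ≤ ρ - √ρ) (hρd : ρ + √ρ ≤ d) :
    ‖∫ t in c..d, (t : ℂ) ^ (w - 1) * osc ε ρ t‖ ≤ 56 + 8 * ‖w‖ := by
  have hρ0 : 0 ≤ ρ := by linarith
  have hs2 : 2 ≤ √ρ := by rw [Real.le_sqrt (by norm_num) hρ0]; linarith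
  have hlow : 0 < ρ - √ρ := hc.trans_le hcρ
  have hhigh : 0 < ρ + √ρ := by linarith
  have hbefore := norm_integral_cpow_mul_osc_le_of_far hw0 hw1 hε hε1 hρ0 hc hcρ (Or.inr rfl)
    (fun t ht => by linarith [ht.2]) (fun t ht => by linarith [ht.2])
  have hafter := norm_integral_cpow_mul_osc_le_of_far hw0 hw1 hε hε1 hρ0 hhigh hρd (Or.inl rfl)
    (fun t ht => by linarith [ht.1]) (fun t ht => by linarith [ht.1])
  have hmid := norm_integral_cpow_mul_osc_stationary_le hw1 hε hρ
  have hint := @intervalIntegrable_cpow_mul_osc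
  rw [← intervalIntegral.integral_add_adjacent_intervals (hint w ε ρ hc hlow)
      (hint w ε ρ hlow (hhigh.trans_le hρd)), ← intervalIntegral.integral_add_adjacent_intervals
      (hint w ε ρ hlow hhigh) (hint w ε ρ hhigh (hhigh.trans_le hρd))]
  refine (norm_add_le _ _).trans ((add_le_add hbefore ((norm_add_le _ _).trans
    (add_le_add hmid hafter))).trans ?_)
  linarith

lemma norm_mul_integral_cpow_mul_osc_le_of_le_four (hw0 : 0 ≤ w.re) (hw1 : w.re ≤ 1 / 2)
    (hε : 0 ≤ ε) (hε1 : ε ≤ 1) (hρ0 : 0 ≤ ρ) (hρ : ρ ≤ 4) (hc : 0 < c) (hc1 : c ≤ 1) (hd : 6 ≤ d) :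
    ‖w * ∫ t in c..d, (t : ℂ) ^ (w - 1) * osc ε ρ t‖
      ≤ ‖w‖ * (60 + 4 * ‖w‖) + 60 + ‖w‖ * (26 + 4 * ‖w‖) := by
  have hs2 : √ρ ≤ 2 := by rw [Real.sqrt_le_left (by norm_num)]; linarith
  have hfar := norm_integral_cpow_mul_osc_le_of_far hw0 hw1 hε hε1 hρ0 (by norm_num) hd
    (Or.inl rfl) (fun t ht => by linarith [ht.1]) (fun t ht => by linarith [ht.1])
  rw [← intervalIntegral.integral_add_adjacent_intervals
    (intervalIntegrable_cpow_mul_osc w ε ρ hc (by norm_num : (0 : ℝ) < 6))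
    (intervalIntegrable_cpow_mul_osc w ε ρ (by norm_num) (by linarith)), mul_add]
  refine (norm_add_le _ _).trans (add_le_add (norm_mul_integral_cpow_mul_osc_le_of_le_six hw0 hw1
    hε hε1 hc (by linarith) le_rfl) ?_)
  rw [norm_mul]
  gcongr

theorem norm_mul_integral_Ioi_cpow_mul_osc_le (hw0 : 0 < w.re) (hw1 : w.re ≤ 1 / 2) (hε : 0 < ε)
    (hε1 : ε ≤ 1) (hρ : 0 ≤ ρ) :
    ‖w * ∫ t in Set.Ioi (0 : ℝ), (t : ℂ) ^ (w - 1) * osc ε ρ t‖ ≤ 200 * (1 + ‖w‖) ^ 2 := by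
  have hwn := norm_nonneg w
  rw [← integral_const_mul]
  refine norm_setIntegral_Ioi_le_of_eventually ((integrableOn_cpow_mul_osc hw0 hε ρ).const_mul w) ?_
  simp only [intervalIntegral.integral_const_mul]
  rcases le_total 4 ρ with h4 | h4
  · have hs : √ρ < ρ := (Real.sqrt_lt' (by linarith)).2 (by nlinarith)
    filter_upwards [self_mem_nhdsWithin, nhdsWithin_le_nhds (eventually_le_nhds (sub_pos.2 hs))]
      with c hc hcρ
    filter_upwards [eventually_ge_atTop (ρ + √ρ)] with d hd
    calc _ ≤ ‖w‖ * (56 + 8 * ‖w‖) := by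
          rw [norm_mul]
          gcongr
          exact norm_integral_cpow_mul_osc_le_of_four_le hw0.le hw1 hε.le hε1 h4 hc hcρ hd
      _ ≤ 200 * (1 + ‖w‖) ^ 2 := by nlinarith
  · filter_upwards [self_mem_nhdsWithin, nhdsWithin_le_nhds (eventually_le_nhds one_pos)]
      with c hc hc1
    filter_upwards [eventually_ge_atTop 6] with d hd
    exact (norm_mul_integral_cpow_mul_osc_le_of_le_four hw0.le hw1 hε.le hε1 hρ h4 hc hc1 hd).trans
      (by nlinarith)

end OscillatoryIntegral

/-! ### Integrals depending on a complex parameter -/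

section ParameterIntegral

variable {α β : Type*} [MeasurableSpace α] [MeasurableSpace β] {μ : Measure α} {ν : Measure β}

lemma aestronglyMeasurable_deriv_of_differentiableAt {F : ℂ → α → ℂ} {s₀ : ℂ}
    (hmeas : ∀ᶠ s in 𝓝 s₀, AEStronglyMeasurable (F s) μ)
    (hF : ∀ᵐ x ∂μ, DifferentiableAt ℂ (F · x) s₀) :
    AEStronglyMeasurable (fun x => deriv (F · x) s₀) μ := by
  have hne : (𝓝[≠] s₀).NeBot := inferInstance
  obtain ⟨σ, hσ⟩ := exists_seq_tendsto (𝓝[≠] s₀)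
  have hσ' : ∀ᶠ j in atTop, AEStronglyMeasurable (F (σ j)) μ :=
    hσ.eventually (hmeas.filter_mono nhdsWithin_le_nhds)
  obtain ⟨N, hN⟩ := eventually_atTop.1 hσ'
  refine aestronglyMeasurable_of_tendsto_ae atTop
    (f := fun j x => slope (F · x) s₀ (σ (j + N))) (fun j => ?_) ?_
  · simp only [slope_def_field, div_eq_mul_inv]
    exact ((hN _ (Nat.le_add_left N j)).sub hmeas.self_of_nhds).mul_const _
  · filter_upwards [hF] with x hx
    exact (hasDerivAt_iff_tendsto_slope.1 hx.hasDerivAt).comp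
      (hσ.comp (tendsto_add_atTop_nat N))

theorem differentiableAt_integral_of_dominated {F : ℂ → α → ℂ} {s₀ : ℂ} {r : ℝ} {bound : α → ℝ}
    (hr : 0 < r) (hmeas : ∀ s ∈ Metric.ball s₀ r, AEStronglyMeasurable (F s) μ)
    (hF : ∀ᵐ x ∂μ, DifferentiableOn ℂ (F · x) (Metric.ball s₀ r))
    (hbound : Integrable bound μ)
    (hFbound : ∀ᵐ x ∂μ, ∀ s ∈ Metric.ball s₀ r, ‖F s x‖ ≤ bound x) :
    DifferentiableAt ℂ (fun s => ∫ x, F s x ∂μ) s₀ := by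
  have hball : Metric.ball s₀ r ∈ 𝓝 s₀ := Metric.ball_mem_nhds _ hr
  have hmem : ∀ s ∈ Metric.ball s₀ (r / 3), Metric.closedBall s (r / 3) ⊆ Metric.ball s₀ r :=
    fun s hs => Metric.closedBall_subset_ball' (by rw [Metric.mem_ball] at hs; linarith)
  refine (hasDerivAt_integral_of_dominated_loc_of_deriv_le (F' := fun s x => deriv (F · x) s)
    (bound := fun x => bound x / (r / 3)) (Metric.ball_mem_nhds s₀ (by positivity : 0 < r / 3))
    (eventually_of_mem hball hmeas)
    (hbound.mono' (hmeas s₀ (Metric.mem_ball_self hr)) ?_)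
    (aestronglyMeasurable_deriv_of_differentiableAt (eventually_of_mem hball hmeas) ?_)
    ?_ (hbound.div_const _) ?_).2.differentiableAt
  · filter_upwards [hFbound] with x hx using hx s₀ (Metric.mem_ball_self hr)
  · filter_upwards [hF] with x hx using hx.differentiableAt hball
  · filter_upwards [hF, hFbound] with x hx hxb s hs
    refine Complex.norm_deriv_le_of_forall_mem_sphere_norm_le (by positivity) ?_ fun w hw =>
      hxb w (hmem s hs (Metric.sphere_subset_closedBall hw))
    refine DifferentiableOn.diffContOnCl (hx.mono ?_)
    rw [closure_ball _ (by positivity)]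
    exact hmem s hs
  · filter_upwards [hF] with x hx s hs
    exact (hx.differentiableAt (Metric.isOpen_ball.mem_nhds
      (Metric.ball_subset_ball (by linarith) hs))).hasDerivAt

lemma norm_cexp_neg_mul_ofReal_le_one {a : ℂ} (ha : 0 ≤ a.re) {t : ℝ} (ht : 0 ≤ t) :
    ‖Complex.exp (-(a * t))‖ ≤ 1 := by
  rw [Complex.norm_exp, Real.exp_le_one_iff, Complex.neg_re, Complex.re_mul_ofReal]
  exact neg_nonpos.2 (mul_nonneg ha ht)

lemma continuousOn_integral_mul_cexp_neg {g : α → ℂ} (hg : Integrable g μ) {φ : α → ℝ}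
    (hφ : AEStronglyMeasurable φ μ) (hφ0 : ∀ x, 0 ≤ φ x) :
    ContinuousOn (fun a : ℂ => ∫ x, g x * Complex.exp (-(a * φ x)) ∂μ) {a | 0 ≤ a.re} := by
  refine continuousOn_of_dominated (fun a _ => ?_) (fun a ha => ae_of_all _ fun x => ?_) hg.norm
    (ae_of_all _ fun x => by fun_prop)
  · exact hg.1.mul (Complex.continuous_exp.comp_aestronglyMeasurable
      ((Complex.continuous_ofReal.comp_aestronglyMeasurable hφ).const_mul a).neg)
  · rw [norm_mul]
    exact mul_le_of_le_one_right (norm_nonneg _) (norm_cexp_neg_mul_ofReal_le_one ha (hφ0 x))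

lemma re_inv_nonneg {b : ℂ} (hb : 0 ≤ b.re) : 0 ≤ b⁻¹.re := by
  rw [Complex.inv_re]
  exact div_nonneg hb (Complex.normSq_nonneg _)

lemma mem_slitPlane_of_re_nonneg {b : ℂ} (hb : 0 ≤ b.re) (hb0 : b ≠ 0) :
    b ∈ Complex.slitPlane := by
  rw [Complex.mem_slitPlane_iff]
  by_contra! h
  exact hb0 (Complex.ext (h.1.antisymm hb) h.2)

lemma integral_mul_integral_swap_of_norm_le_one [SFinite μ] [SFinite ν] {u : α → ℂ} {v : β → ℂ}
    (hu : Integrable u μ) (hv : Integrable v ν) {m : α × β → ℂ}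
    (hm : AEStronglyMeasurable m (μ.prod ν)) (hm1 : ∀ q, ‖m q‖ ≤ 1) :
    ∫ x, u x * ∫ y, v y * m (x, y) ∂ν ∂μ = ∫ y, v y * ∫ x, u x * m (x, y) ∂μ ∂ν := by
  have hswap := integral_integral_swap (f := fun x y => u x * v y * m (x, y))
    ((hu.mul_prod hv).mul_bdd hm (ae_of_all _ hm1))
  simp_rw [← integral_const_mul]
  simpa only [mul_assoc, mul_left_comm] using hswap

end ParameterIntegral

/-! ### The Gamma integral at a complex rate -/

section GammaIntegral

variable {s r : ℂ}

lemma norm_cpow_mul_exp_neg (s r : ℂ) {t : ℝ} (ht : 0 < t) :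
    ‖(t : ℂ) ^ (s - 1) * Complex.exp (-(r * t))‖ = t ^ (s.re - 1) * Real.exp (-(r.re * t)) := by
  rw [norm_mul, Complex.norm_exp, Complex.norm_cpow_eq_rpow_re_of_pos ht, Complex.neg_re,
    Complex.re_mul_ofReal, Complex.sub_re, Complex.one_re]

lemma aestronglyMeasurable_cpow_mul_exp_neg (s r : ℂ) :
    AEStronglyMeasurable (fun t : ℝ => (t : ℂ) ^ (s - 1) * Complex.exp (-(r * t)))
      (volume.restrict (Set.Ioi 0)) :=
  ((continuousOn_ofReal_cpow (s - 1)).mul (by fun_prop)).aestronglyMeasurable measurableSet_Ioi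

lemma integrableOn_rpow_mul_exp_neg {a b : ℝ} (ha : 0 < a) (hb : 0 < b) :
    IntegrableOn (fun t : ℝ => t ^ (a - 1) * Real.exp (-(b * t))) (Set.Ioi 0) := by
  simpa only [Real.rpow_one, neg_mul] using
    integrableOn_rpow_mul_exp_neg_mul_rpow (by linarith : -1 < a - 1) one_pos hb

lemma integrableOn_cpow_mul_exp_neg (hs : 0 < s.re) (hr : 0 < r.re) :
    IntegrableOn (fun t : ℝ => (t : ℂ) ^ (s - 1) * Complex.exp (-(r * t))) (Set.Ioi 0) := by
  refine Integrable.mono' (integrableOn_rpow_mul_exp_neg hs hr)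
    (aestronglyMeasurable_cpow_mul_exp_neg s r) ?_
  filter_upwards [ae_restrict_mem measurableSet_Ioi] with t ht
  exact (norm_cpow_mul_exp_neg s r ht).le

lemma differentiableOn_integral_cpow_mul_exp_neg (hs : 0 < s.re) :
    DifferentiableOn ℂ (fun r : ℂ => ∫ t in Set.Ioi (0 : ℝ), (t : ℂ) ^ (s - 1) *
      Complex.exp (-(r * t))) {r | 0 < r.re} := fun r₀ (hr₀ : 0 < r₀.re) => by
  refine (differentiableAt_integral_of_dominated (half_pos hr₀)
    (fun r _ => aestronglyMeasurable_cpow_mul_exp_neg s r) (ae_of_all _ fun t => by fun_prop)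
    (integrableOn_rpow_mul_exp_neg hs (half_pos hr₀)) ?_).differentiableWithinAt
  filter_upwards [ae_restrict_mem measurableSet_Ioi] with t ht r hr
  have hr' : r₀.re / 2 ≤ r.re := by
    have hre := Complex.abs_re_le_norm (r - r₀)
    rw [Metric.mem_ball, dist_eq_norm] at hr
    rw [Complex.sub_re] at hre
    linarith [neg_abs_le (r.re - r₀.re)]
  rw [norm_cpow_mul_exp_neg s r ht]
  have ht0 : (0 : ℝ) < t := ht
  gcongr

theorem integral_cpow_mul_exp_neg (hs : 0 < s.re) (hr : 0 < r.re) :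
    ∫ t in Set.Ioi (0 : ℝ), (t : ℂ) ^ (s - 1) * Complex.exp (-(r * t)) =
      Complex.Gamma s * r ^ (-s) := by
  have hopen : IsOpen {r : ℂ | 0 < r.re} := isOpen_lt continuous_const Complex.continuous_re
  have hpow : DifferentiableOn ℂ (fun r : ℂ => Complex.Gamma s * r ^ (-s)) {r : ℂ | 0 < r.re} :=
    fun r hr => ((differentiableAt_id.cpow_const (Or.inl hr)).const_mul _).differentiableWithinAt
  refine ((differentiableOn_integral_cpow_mul_exp_neg hs).analyticOnNhd
    hopen).eqOn_of_preconnected_of_frequently_eq (hpow.analyticOnNhd hopen)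
    (convex_halfSpace_re_gt 0).isPreconnected (z₀ := 1) (by simp) ?_ hr
  have hreal : ∃ᶠ x : ℝ in 𝓝[≠] 1, 0 < x :=
    ((eventually_gt_nhds one_pos).filter_mono nhdsWithin_le_nhds).frequently
  have hcast : Tendsto (fun x : ℝ => (x : ℂ)) (𝓝[≠] 1) (𝓝[≠] 1) := by
    refine tendsto_nhdsWithin_iff.2 ⟨?_, ?_⟩
    · exact (Complex.continuous_ofReal.tendsto' 1 1 (by simp)).mono_left nhdsWithin_le_nhds
    · filter_upwards [self_mem_nhdsWithin] with x hx
      simpa using hx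
  refine hcast.frequently (hreal.mono fun x hx => ?_)
  rw [Complex.integral_cpow_mul_exp_neg_mul_Ioi hs hx, mul_comm, one_div,
    Complex.inv_cpow _ _ (by rw [Complex.arg_ofReal_of_nonneg hx.le]; exact Real.pi_pos.ne),
    Complex.cpow_neg]

lemma norm_Gamma_le_Gamma_re (hs : 0 < s.re) : ‖Complex.Gamma s‖ ≤ Real.Gamma s.re := by
  rw [Complex.Gamma_eq_integral hs, Real.Gamma_eq_integral hs, Complex.GammaIntegral]
  refine norm_integral_le_of_norm_le (Real.GammaIntegral_convergent hs) ?_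
  filter_upwards [ae_restrict_mem measurableSet_Ioi] with x hx
  rw [norm_mul, Complex.norm_cpow_eq_rpow_re_of_pos hx, Complex.norm_real,
    Real.norm_of_nonneg (Real.exp_pos _).le, Complex.sub_re, Complex.one_re]

lemma mul_ofReal_cpow (c : ℂ) {t : ℝ} (ht : 0 < t) (s : ℂ) :
    (c * t) ^ s = c ^ s * (t : ℂ) ^ s := by
  rcases eq_or_ne c 0 with rfl | hc
  · rcases eq_or_ne s 0 with rfl | hs
    · simp
    · simp [hs]
  · have ht' : (t : ℂ) ≠ 0 := by exact_mod_cast ht.ne'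
    rw [Complex.cpow_def_of_ne_zero (mul_ne_zero hc ht'), Complex.cpow_def_of_ne_zero hc,
      Complex.cpow_def_of_ne_zero ht', ← Complex.exp_add, Complex.log_mul_ofReal t ht c hc,
      Complex.ofReal_log ht.le, add_mul, add_comm]

end GammaIntegral

/-! ### Fourier transforms of functions in `L¹ ∩ L²` -/

section Fourier

variable {V : Type*} [NormedAddCommGroup V] [InnerProductSpace ℝ V] [FiniteDimensional ℝ V]
  [MeasurableSpace V] [BorelSpace V] {f k : V → ℂ}

lemma norm_fourierInv_le (k : V → ℂ) (z : V) : ‖𝓕⁻ k z‖ ≤ ∫ x, ‖k x‖ := by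
  rw [Real.fourierInv_eq_fourier_neg]
  exact VectorFourier.norm_fourierIntegral_le_integral_norm _ _ _ _ _

lemma continuous_fourier (hf : Integrable f) : Continuous (𝓕 f) :=
  VectorFourier.fourierIntegral_continuous Real.continuous_fourierChar continuous_inner hf

lemma fourierInv_eq_fourier_comp_neg (f : V → ℂ) : 𝓕⁻ f = 𝓕 f ∘ Neg.neg :=
  funext fun z => Real.fourierInv_eq_fourier_neg f z

lemma continuous_fourierInv (hf : Integrable f) : Continuous (𝓕⁻ f) := by
  rw [fourierInv_eq_fourier_comp_neg]
  exact (continuous_fourier hf).comp continuous_neg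

lemma integral_fourier_mul_eq_flip (hf : Integrable f) (hk : Integrable k) :
    ∫ z, 𝓕 f z * k z = ∫ x, f x * 𝓕 k x := by
  simpa using! VectorFourier.integral_fourierIntegral_smul_eq_flip (L := innerₗ V)
    Real.continuous_fourierChar continuous_inner hf hk

theorem coeFn_fourier_toLp (hf : Integrable f) (hf2 : MemLp f 2) :
    (𝓕 (hf2.toLp f) : Lp ℂ 2 (volume : Measure V)) =ᵐ[volume] 𝓕 f := by
  refine ae_eq_of_integral_contDiff_smul_eq ((Lp.memLp _).locallyIntegrable (by norm_num))
    (continuous_fourier hf).locallyIntegrable fun g g_smooth g_cpt => ?_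
  have hg_cpt : HasCompactSupport (Complex.ofRealCLM ∘ g) := g_cpt.comp_left rfl
  set ψ : 𝓢(V, ℂ) := hg_cpt.toSchwartzMap (by fun_prop) with hψ
  calc ∫ x, g x • (𝓕 (hf2.toLp f) : Lp ℂ 2 (volume : Measure V)) x
      = Lp.toTemperedDistribution (𝓕 (hf2.toLp f)) ψ := by
        rw [Lp.toTemperedDistribution_apply]
        simp [hψ]
    _ = ∫ x, 𝓕 (ψ : V → ℂ) x • hf2.toLp f x := by
        rw [← Lp.fourier_toTemperedDistribution_eq, TemperedDistribution.fourier_apply,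
          Lp.toTemperedDistribution_apply, SchwartzMap.fourier_coe]
    _ = ∫ x, f x * 𝓕 (ψ : V → ℂ) x := by
        refine integral_congr_ae ?_
        filter_upwards [hf2.coeFn_toLp] with x hx
        rw [hx, smul_eq_mul, mul_comm]
    _ = ∫ x, g x • 𝓕 f x := by
        rw [← integral_fourier_mul_eq_flip hf ψ.integrable]
        simp [hψ, mul_comm]

lemma memLp_fourier (hf : Integrable f) (hf2 : MemLp f 2) : MemLp (𝓕 f) 2 :=
  (memLp_congr_ae (coeFn_fourier_toLp hf hf2)).1 (Lp.memLp _)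

theorem eLpNorm_fourier (hf : Integrable f) (hf2 : MemLp f 2) :
    eLpNorm (𝓕 f) 2 volume = eLpNorm f 2 volume := by
  rw [← eLpNorm_congr_ae (coeFn_fourier_toLp hf hf2), ← Lp.enorm_def, ← ofReal_norm,
    Lp.norm_fourier_eq, ofReal_norm, Lp.enorm_def, eLpNorm_congr_ae hf2.coeFn_toLp]

lemma memLp_fourierInv (hf : Integrable f) (hf2 : MemLp f 2) : MemLp (𝓕⁻ f) 2 := by
  rw [fourierInv_eq_fourier_comp_neg]
  exact (memLp_fourier hf hf2).comp_measurePreserving (Measure.measurePreserving_neg volume)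

lemma eLpNorm_fourierInv (hf : Integrable f) (hf2 : MemLp f 2) :
    eLpNorm (𝓕⁻ f) 2 volume = eLpNorm f 2 volume := by
  rw [fourierInv_eq_fourier_comp_neg, eLpNorm_comp_measurePreserving (memLp_fourier hf hf2).1
    (Measure.measurePreserving_neg volume), eLpNorm_fourier hf hf2]

lemma integrable_fourier_mul_fourierInv (hf : Integrable f) (hf2 : MemLp f 2)
    (hk : Integrable k) (hk2 : MemLp k 2) : Integrable fun z => 𝓕 f z * 𝓕⁻ k z :=
  (memLp_fourier hf hf2).integrable_mul (memLp_fourierInv hk hk2)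

lemma integral_norm_fourier_mul_fourierInv_le (hf : Integrable f) (hf2 : MemLp f 2)
    (hk : Integrable k) (hk2 : MemLp k 2) :
    ∫ z, ‖𝓕 f z * 𝓕⁻ k z‖ ≤ (eLpNorm f 2 volume).toReal * (eLpNorm k 2 volume).toReal := by
  have hHolder := eLpNorm_le_eLpNorm_mul_eLpNorm_of_nnnorm (p := 2) (q := 2) (r := 1)
    (memLp_fourier hf hf2).1 (memLp_fourierInv hk hk2).1 (fun a b => a * b) 1
    (ae_of_all _ fun z => by simp)
  rw [eLpNorm_fourier hf hf2, eLpNorm_fourierInv hk hk2, ENNReal.coe_one, one_mul] at hHolder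
  rw [integral_norm_eq_lintegral_enorm (integrable_fourier_mul_fourierInv hf hf2 hk hk2).1,
    ← ENNReal.toReal_mul, ← eLpNorm_one_eq_lintegral_enorm]
  exact ENNReal.toReal_mono (ENNReal.mul_ne_top hf2.2.ne hk2.2.ne) hHolder

/-! ### Gaussian multipliers, up to the Schrödinger propagator -/

lemma fourier_fourierInv_mul_gaussian {b : ℂ} (hb : 0 < b.re) (hk : Integrable k) (x : V) :
    𝓕 (fun z => 𝓕⁻ k z * Complex.exp (-(b * (‖z‖ ^ 2 : ℝ)))) x =
      ∫ y, k y * ((Real.pi / b) ^ (Module.finrank ℝ V / 2 : ℂ) *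
        Complex.exp (-(b⁻¹ * (Real.pi ^ 2 * ‖x - y‖ ^ 2 : ℝ)))) := by
  have hG : Integrable fun z : V =>
      Complex.exp (-b * ‖z‖ ^ 2 + 2 * Real.pi * Complex.I * inner ℝ x z) :=
    GaussianFourier.integrable_cexp_neg_mul_sq_norm_add hb _ x
  calc _ = ∫ z, 𝓕 k z * Complex.exp (-b * ‖z‖ ^ 2 + 2 * Real.pi * Complex.I * inner ℝ x z) := by
        rw [Real.fourier_eq', ← integral_neg_eq_self]
        refine integral_congr_ae (ae_of_all _ fun z => ?_)
        simp only [norm_neg, Real.fourierInv_eq_fourier_neg, neg_neg, inner_neg_left, smul_eq_mul]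
        rw [mul_left_comm, ← Complex.exp_add, real_inner_comm]
        congr 2
        push_cast
        ring
    _ = _ := by
        rw [integral_fourier_mul_eq_flip hk hG]
        refine integral_congr_ae (ae_of_all _ fun y => ?_)
        simp only
        rw [fourier_gaussian_innerProductSpace' hb x y]
        congr 3
        push_cast
        ring

lemma integral_fourier_mul_fourierInv_mul_gaussian_of_re_pos (hf : Integrable f)
    (hk : Integrable k) {b : ℂ} (hb : 0 < b.re) :
    ∫ z, 𝓕 f z * 𝓕⁻ k z * Complex.exp (-(b * (‖z‖ ^ 2 : ℝ))) =
      (Real.pi / b) ^ (Module.finrank ℝ V / 2 : ℂ) * ∫ q : V × V,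
        f q.1 * k q.2 * Complex.exp (-(b⁻¹ * (Real.pi ^ 2 * ‖q.1 - q.2‖ ^ 2 : ℝ))) := by
  have hGauss : Integrable fun z : V => Complex.exp (-(b * (‖z‖ ^ 2 : ℝ))) := by
    simpa using GaussianFourier.integrable_cexp_neg_mul_sq_norm_add hb 0 (0 : V)
  have hkGauss : Integrable fun z => 𝓕⁻ k z * Complex.exp (-(b * (‖z‖ ^ 2 : ℝ))) :=
    hGauss.bdd_mul (continuous_fourierInv hk).aestronglyMeasurable
      (ae_of_all _ (norm_fourierInv_le k))
  have hker : Integrable (fun q : V × V => f q.1 * k q.2 *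
      Complex.exp (-(b⁻¹ * (Real.pi ^ 2 * ‖q.1 - q.2‖ ^ 2 : ℝ)))) (volume.prod volume) :=
    (hf.mul_prod hk).mul_bdd (Continuous.aestronglyMeasurable (by fun_prop))
      (ae_of_all _ fun q => norm_cexp_neg_mul_ofReal_le_one (re_inv_nonneg hb.le) (by positivity))
  simp_rw [mul_assoc (𝓕 f _)]
  rw [integral_fourier_mul_eq_flip hf hkGauss, Measure.volume_eq_prod, integral_prod _ hker,
    ← integral_const_mul]
  refine integral_congr_ae (ae_of_all _ fun x => ?_)
  simp only
  rw [fourier_fourierInv_mul_gaussian hb hk, ← integral_const_mul, ← integral_const_mul]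
  refine integral_congr_ae (ae_of_all _ fun y => ?_)
  simp only
  ring

theorem integral_fourier_mul_fourierInv_mul_gaussian (hf : Integrable f) (hf2 : MemLp f 2)
    (hk : Integrable k) (hk2 : MemLp k 2) {b : ℂ} (hb : 0 ≤ b.re) (hb0 : b ≠ 0) :
    ∫ z, 𝓕 f z * 𝓕⁻ k z * Complex.exp (-(b * (‖z‖ ^ 2 : ℝ))) =
      (Real.pi / b) ^ (Module.finrank ℝ V / 2 : ℂ) * ∫ q : V × V,
        f q.1 * k q.2 * Complex.exp (-(b⁻¹ * (Real.pi ^ 2 * ‖q.1 - q.2‖ ^ 2 : ℝ))) := by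
  have hinv : ContinuousOn (fun b : ℂ => b⁻¹) {b | 0 ≤ b.re ∧ b ≠ 0} :=
    continuousOn_inv₀.mono fun b hb => hb.2
  have hlhs : ContinuousOn (fun b : ℂ => ∫ z, 𝓕 f z * 𝓕⁻ k z *
      Complex.exp (-(b * (‖z‖ ^ 2 : ℝ)))) {b | 0 ≤ b.re ∧ b ≠ 0} :=
    (continuousOn_integral_mul_cexp_neg (integrable_fourier_mul_fourierInv hf hf2 hk hk2)
      (Continuous.aestronglyMeasurable (by fun_prop)) fun z => by positivity).mono fun b hb => hb.1
  have hrhs : ContinuousOn (fun b : ℂ => ∫ q : V × V, f q.1 * k q.2 *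
      Complex.exp (-(b⁻¹ * (Real.pi ^ 2 * ‖q.1 - q.2‖ ^ 2 : ℝ)))) {b | 0 ≤ b.re ∧ b ≠ 0} :=
    (continuousOn_integral_mul_cexp_neg (hf.mul_prod hk)
      (Continuous.aestronglyMeasurable (by fun_prop)) fun q => by positivity).comp hinv
      fun b hb => re_inv_nonneg hb.1
  have hconst : ContinuousOn (fun b : ℂ => (Real.pi / b) ^ (Module.finrank ℝ V / 2 : ℂ))
      {b | 0 ≤ b.re ∧ b ≠ 0} := by
    refine (continuousOn_const.mul hinv).cpow_const fun b hb => ?_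
    refine mem_slitPlane_of_re_nonneg ?_ (mul_ne_zero (by simp [Real.pi_ne_zero])
      (inv_ne_zero hb.2))
    rw [Pi.mul_apply, Complex.re_ofReal_mul]
    exact mul_nonneg Real.pi_pos.le (re_inv_nonneg hb.1)
  refine Set.EqOn.of_subset_closure (s := {b : ℂ | 0 < b.re})
    (fun b hb => integral_fourier_mul_fourierInv_mul_gaussian_of_re_pos hf hk hb) hlhs
    (hconst.mul hrhs) (fun b (hb : 0 < b.re) => ⟨hb.le, ?_⟩) ?_ ⟨hb, hb0⟩
  · rintro rfl
    exact lt_irrefl _ hb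
  · rw [Complex.closure_setOfPred_lt_re]
    exact fun b hb => hb.1

end Fourier

/-! ### Complex powers of the regularised resolvent -/

section Symbol

variable {V : Type*} [NormedAddCommGroup V] {ε : ℝ} {s : ℂ}

/-- The symbol `ε + i (|ξ|² - 1)` of the regularised operator `ε + i (-Δ - 1)`, in the frequency
variable `z = ξ / 2π` of Mathlib's Fourier transform `𝓕`. -/
def symb (ε : ℝ) (z : V) : ℂ := ε + Complex.I * (4 * Real.pi ^ 2 * ‖z‖ ^ 2 - 1)

lemma symb_eq (ε : ℝ) (z : V) :
    symb ε z = ε + ((4 * Real.pi ^ 2 * ‖z‖ ^ 2 - 1 : ℝ) : ℂ) * Complex.I := by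
  simp only [symb]
  push_cast
  ring

lemma symb_re (ε : ℝ) (z : V) : (symb ε z).re = ε := by
  rw [symb_eq, Complex.add_re, Complex.ofReal_re, Complex.re_ofReal_mul, Complex.I_re, mul_zero,
    add_zero]

lemma symb_im (ε : ℝ) (z : V) : (symb ε z).im = 4 * Real.pi ^ 2 * ‖z‖ ^ 2 - 1 := by
  rw [symb_eq, Complex.add_im, Complex.ofReal_im, Complex.im_ofReal_mul, Complex.I_im, mul_one,
    zero_add]

lemma continuous_symb (ε : ℝ) : Continuous (symb (V := V) ε) := by
  unfold symb
  fun_prop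

lemma symb_mem_slitPlane (hε : 0 < ε) (z : V) : symb ε z ∈ Complex.slitPlane :=
  Or.inl (by rwa [symb_re])

lemma symb_ne_zero (hε : 0 < ε) (z : V) : symb ε z ≠ 0 :=
  Complex.slitPlane_ne_zero (symb_mem_slitPlane hε z)

lemma continuous_symb_cpow (hε : 0 < ε) (s : ℂ) : Continuous fun z : V => symb ε z ^ s :=
  (continuous_symb ε).cpow continuous_const (symb_mem_slitPlane hε)

lemma le_norm_symb (ε : ℝ) (z : V) : ε ≤ ‖symb ε z‖ := by
  simpa only [symb_re] using Complex.re_le_norm (symb ε z)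

lemma norm_symb_cpow_le (hε : 0 < ε) (hs : 0 ≤ s.re) (z : V) :
    ‖symb ε z ^ (-s)‖ ≤ ε ^ (-s.re) * Real.exp (Real.pi * |s.im|) := by
  rw [Complex.norm_cpow_of_ne_zero (symb_ne_zero hε z), div_eq_mul_inv, ← Real.exp_neg,
    Complex.neg_re, Complex.neg_im, mul_neg, neg_neg]
  have harg : (symb ε z).arg * s.im ≤ Real.pi * |s.im| := by
    refine (le_abs_self _).trans ?_
    rw [abs_mul]
    gcongr
    exact Complex.abs_arg_le_pi _
  exact mul_le_mul (Real.rpow_le_rpow_of_nonpos hε (le_norm_symb ε z) (by linarith))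
    (Real.exp_le_exp.2 harg) (Real.exp_pos _).le (Real.rpow_nonneg hε.le _)

lemma norm_symb_cpow_le_of_mem_ball (hε : 0 < ε) (hε1 : ε ≤ 1) (hs : 0 ≤ s.re) {s₀ : ℂ}
    (hs₀ : s ∈ Metric.ball s₀ 1) (z : V) :
    ‖symb ε z ^ (-s)‖ ≤ ε ^ (-(s₀.re + 1)) * Real.exp (Real.pi * (|s₀.im| + 1)) := by
  rw [Metric.mem_ball, dist_eq_norm] at hs₀
  have hre := (Complex.abs_re_le_norm (s - s₀)).trans hs₀.le
  have him := (Complex.abs_im_le_norm (s - s₀)).trans hs₀.le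
  rw [Complex.sub_re] at hre
  rw [Complex.sub_im] at him
  have him' := (abs_sub_abs_le_abs_sub s.im s₀.im).trans him
  refine (norm_symb_cpow_le hε hs z).trans ?_
  have hpow : ε ^ (-s.re) ≤ ε ^ (-(s₀.re + 1)) :=
    Real.rpow_le_rpow_of_exponent_ge hε hε1 (by linarith [le_abs_self (s.re - s₀.re)])
  gcongr
  linarith

lemma differentiable_symb_cpow_neg (hε : 0 < ε) (z : V) :
    Differentiable ℂ fun s : ℂ => symb ε z ^ (-s) := fun _ =>
  differentiableAt_id.fun_neg.const_cpow (Or.inl (symb_ne_zero hε z))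

lemma cexp_neg_symb_mul (ε : ℝ) (z : V) (t : ℝ) :
    Complex.exp (-(symb ε z * t)) = Complex.exp (-((ε - Complex.I) * t)) *
      Complex.exp (-(Complex.I * (4 * Real.pi ^ 2 * t : ℝ) * (‖z‖ ^ 2 : ℝ))) := by
  rw [← Complex.exp_add, symb]
  congr 1
  push_cast
  ring

lemma osc_eq_mul (ε ρ t : ℝ) :
    osc ε ρ t = Complex.exp (-((ε - Complex.I) * t)) * Complex.exp (Complex.I * ρ ^ 2 / t) := by
  rw [← Complex.exp_add, osc]
  congr 1
  ring

variable [MeasurableSpace V] [BorelSpace V] {μ : Measure V} {P : V → ℂ}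

lemma integrable_symb_cpow_mul (hε : 0 < ε) (hs : 0 ≤ s.re) (hP : Integrable P μ) :
    Integrable (fun z => symb ε z ^ (-s) * P z) μ :=
  hP.bdd_mul (continuous_symb_cpow hε _).aestronglyMeasurable
    (ae_of_all _ (norm_symb_cpow_le hε hs))

lemma continuousOn_integral_symb_cpow_mul (hε : 0 < ε) (hε1 : ε ≤ 1) (hP : Integrable P μ) :
    ContinuousOn (fun s : ℂ => ∫ z, symb ε z ^ (-s) * P z ∂μ) {s | 0 ≤ s.re} := by
  intro s₀ _
  refine continuousWithinAt_of_dominated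
    (bound := fun z => ε ^ (-(s₀.re + 1)) * Real.exp (Real.pi * (|s₀.im| + 1)) * ‖P z‖) ?_ ?_
    (hP.norm.const_mul _) (ae_of_all _ fun z => ?_)
  · filter_upwards [self_mem_nhdsWithin] with s hs using (integrable_symb_cpow_mul hε hs hP).1
  · filter_upwards [self_mem_nhdsWithin, mem_nhdsWithin_of_mem_nhds
      (Metric.ball_mem_nhds s₀ one_pos)] with s hs hs₁
    refine ae_of_all _ fun z => ?_
    rw [norm_mul]
    gcongr
    exact norm_symb_cpow_le_of_mem_ball hε hε1 hs hs₁ z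
  · exact (differentiable_symb_cpow_neg hε z).continuous.continuousWithinAt.mul
      continuousWithinAt_const

lemma differentiableOn_integral_symb_cpow_mul (hε : 0 < ε) (hε1 : ε ≤ 1) (hP : Integrable P μ) :
    DifferentiableOn ℂ (fun s : ℂ => ∫ z, symb ε z ^ (-s) * P z ∂μ) {s | 0 < s.re} := by
  intro s₀ (hs₀ : 0 < s₀.re)
  refine (differentiableAt_integral_of_dominated (r := min s₀.re 1)
    (F := fun s z => symb ε z ^ (-s) * P z)
    (bound := fun z => ε ^ (-(s₀.re + 1)) * Real.exp (Real.pi * (|s₀.im| + 1)) * ‖P z‖)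
    (by positivity) (fun s _ => (continuous_symb_cpow hε _).aestronglyMeasurable.mul hP.1)
    (ae_of_all _ fun z => ((differentiable_symb_cpow_neg hε z).mul_const _).differentiableOn)
    (hP.norm.const_mul _) (ae_of_all _ fun z s hs => ?_)).differentiableWithinAt
  rw [norm_mul]
  gcongr
  refine norm_symb_cpow_le_of_mem_ball hε hε1 ?_
    (Metric.ball_subset_ball (min_le_right _ _) hs) z
  rw [Metric.mem_ball, dist_eq_norm] at hs
  have hre := (Complex.abs_re_le_norm (s - s₀)).trans_lt (hs.trans_le (min_le_left _ _))
  rw [Complex.sub_re] at hre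
  linarith [neg_abs_le (s.re - s₀.re)]

lemma Gamma_mul_integral_symb_cpow_mul [SecondCountableTopology V] [SFinite μ] (hε : 0 < ε)
    (hs : 0 < s.re) (hP : Integrable P μ) :
    Complex.Gamma s * ∫ z, symb ε z ^ (-s) * P z ∂μ =
      ∫ t in Set.Ioi (0 : ℝ), (t : ℂ) ^ (s - 1) * Complex.exp (-((ε - Complex.I) * t)) *
        ∫ z, P z * Complex.exp (-(Complex.I * (4 * Real.pi ^ 2 * t : ℝ) * (‖z‖ ^ 2 : ℝ))) ∂μ := by
  have hεre : 0 < ((ε : ℂ) - Complex.I).re := by simpa using hε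
  rw [← integral_mul_integral_swap_of_norm_le_one hP (integrableOn_cpow_mul_exp_neg hs hεre)
    (m := fun q : V × ℝ =>
      Complex.exp (-(Complex.I * (4 * Real.pi ^ 2 * q.2 : ℝ) * (‖q.1‖ ^ 2 : ℝ))))
    (Continuous.aestronglyMeasurable (by fun_prop)) fun q => ?_, ← integral_const_mul]
  · refine integral_congr_ae (ae_of_all _ fun z => ?_)
    have hexp (t : ℝ) : (t : ℂ) ^ (s - 1) * Complex.exp (-((ε - Complex.I) * t)) *
        Complex.exp (-(Complex.I * (4 * Real.pi ^ 2 * t : ℝ) * (‖z‖ ^ 2 : ℝ))) =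
          (t : ℂ) ^ (s - 1) * Complex.exp (-(symb ε z * t)) := by
      rw [mul_assoc, ← cexp_neg_symb_mul]
    simp only [hexp]
    rw [integral_cpow_mul_exp_neg hs (by rwa [symb_re])]
    ring
  · rw [show -(Complex.I * (4 * Real.pi ^ 2 * q.2 : ℝ) * (‖q.1‖ ^ 2 : ℝ)) =
      ((-(4 * Real.pi ^ 2 * q.2 * ‖q.1‖ ^ 2) : ℝ) : ℂ) * Complex.I by push_cast; ring]
    exact (Complex.norm_exp_ofReal_mul_I _).le

end Symbol

section PowForm

variable {V : Type*} [NormedAddCommGroup V] [InnerProductSpace ℝ V] [FiniteDimensional ℝ V]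
  [MeasurableSpace V] [BorelSpace V] {f k : V → ℂ} {ε : ℝ} {s : ℂ}

/-- The bilinear form `∫ (ε + i (|ξ|² - 1))⁻ˢ f̂ ǩ` of a complex power of the regularised
resolvent. -/
def powForm (ε : ℝ) (s : ℂ) (f k : V → ℂ) : ℂ :=
  ∫ z, symb ε z ^ (-s) * (𝓕 f z * 𝓕⁻ k z)

lemma norm_powForm_le (hε : 0 < ε) (hs : 0 ≤ s.re) (hf : Integrable f) (hf2 : MemLp f 2)
    (hk : Integrable k) (hk2 : MemLp k 2) :
    ‖powForm ε s f k‖ ≤ ε ^ (-s.re) * Real.exp (Real.pi * |s.im|) *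
      ((eLpNorm f 2 volume).toReal * (eLpNorm k 2 volume).toReal) := by
  have hP := integrable_fourier_mul_fourierInv hf hf2 hk hk2
  calc ‖powForm ε s f k‖
      ≤ ∫ z, ε ^ (-s.re) * Real.exp (Real.pi * |s.im|) * ‖𝓕 f z * 𝓕⁻ k z‖ := by
        refine norm_integral_le_of_norm_le (hP.norm.const_mul _) (ae_of_all _ fun z => ?_)
        rw [norm_mul]
        gcongr
        exact norm_symb_cpow_le hε hs z
    _ ≤ _ := by
        rw [integral_const_mul]
        gcongr
        exact integral_norm_fourier_mul_fourierInv_le hf hf2 hk hk2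

lemma integral_fourier_mul_fourierInv_mul_propagator (hf : Integrable f) (hf2 : MemLp f 2)
    (hk : Integrable k) (hk2 : MemLp k 2) {t : ℝ} (ht : 0 < t) :
    ∫ z, 𝓕 f z * 𝓕⁻ k z *
        Complex.exp (-(Complex.I * (4 * Real.pi ^ 2 * t : ℝ) * (‖z‖ ^ 2 : ℝ))) =
      (1 / (4 * Real.pi * Complex.I)) ^ (Module.finrank ℝ V / 2 : ℂ) *
        (t : ℂ) ^ (-(Module.finrank ℝ V / 2 : ℂ)) *
        ∫ q : V × V, f q.1 * k q.2 *
          Complex.exp (Complex.I * (‖q.1 - q.2‖ / 2 : ℝ) ^ 2 / t) := by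
  have hπ : (Real.pi : ℂ) ≠ 0 := by exact_mod_cast Real.pi_ne_zero
  have ht' : (t : ℂ) ≠ 0 := by exact_mod_cast ht.ne'
  have hb0 : Complex.I * (4 * Real.pi ^ 2 * t : ℝ) ≠ 0 :=
    mul_ne_zero Complex.I_ne_zero (by exact_mod_cast by positivity)
  rw [integral_fourier_mul_fourierInv_mul_gaussian hf hf2 hk hk2
    (by rw [Complex.re_mul_ofReal, Complex.I_re, zero_mul]) hb0]
  congr 1
  · have hsplit : (Real.pi : ℂ) / (Complex.I * (4 * Real.pi ^ 2 * t : ℝ)) =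
        1 / (4 * Real.pi * Complex.I) * (t⁻¹ : ℝ) := by
      push_cast
      field_simp
    rw [hsplit, mul_ofReal_cpow _ (inv_pos.2 ht), Complex.ofReal_inv, Complex.inv_cpow _ _
      (by rw [Complex.arg_ofReal_of_nonneg ht.le]; exact Real.pi_pos.ne), Complex.cpow_neg]
  · refine integral_congr_ae (ae_of_all _ fun q => ?_)
    simp only
    congr 2
    push_cast
    field_simp
    rw [Complex.I_sq]
    ring

theorem Gamma_mul_powForm_eq (hf : Integrable f) (hf2 : MemLp f 2) (hk : Integrable k)
    (hk2 : MemLp k 2) (hε : 0 < ε) (hs : (Module.finrank ℝ V : ℝ) / 2 < s.re) :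
    Complex.Gamma s * powForm ε s f k =
      (1 / (4 * Real.pi * Complex.I)) ^ (Module.finrank ℝ V / 2 : ℂ) *
        ∫ q : V × V, f q.1 * k q.2 * ∫ t in Set.Ioi (0 : ℝ),
          (t : ℂ) ^ (s - Module.finrank ℝ V / 2 - 1) * osc ε (‖q.1 - q.2‖ / 2) t := by
  have hs0 : 0 < s.re := lt_of_le_of_lt (by positivity) hs
  have hw : 0 < (s - Module.finrank ℝ V / 2).re := by simpa using hs
  have hεre : 0 < ((ε : ℂ) - Complex.I).re := by simpa using hε
  calc Complex.Gamma s * powForm ε s f k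
      = (1 / (4 * Real.pi * Complex.I)) ^ (Module.finrank ℝ V / 2 : ℂ) *
          ∫ t in Set.Ioi (0 : ℝ), (t : ℂ) ^ (s - Module.finrank ℝ V / 2 - 1) *
            Complex.exp (-((ε - Complex.I) * t)) * ∫ q : V × V, f q.1 * k q.2 *
              Complex.exp (Complex.I * (‖q.1 - q.2‖ / 2 : ℝ) ^ 2 / t) := by
        rw [powForm, Gamma_mul_integral_symb_cpow_mul hε hs0
          (integrable_fourier_mul_fourierInv hf hf2 hk hk2), ← integral_const_mul]
        refine setIntegral_congr_fun measurableSet_Ioi fun t (ht : 0 < t) => ?_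
        rw [integral_fourier_mul_fourierInv_mul_propagator hf hf2 hk hk2 ht,
          show s - Module.finrank ℝ V / 2 - 1 = s - 1 + -(Module.finrank ℝ V / 2 : ℂ) by ring,
          Complex.cpow_add _ _ (by exact_mod_cast ht.ne')]
        ring
    _ = _ := by
        simp_rw [osc_eq_mul, ← mul_assoc]
        congr 1
        refine (integral_mul_integral_swap_of_norm_le_one (hf.mul_prod hk)
          (integrableOn_cpow_mul_exp_neg hw hεre) (m := fun q : (V × V) × ℝ =>
            Complex.exp (Complex.I * (‖q.1.1 - q.1.2‖ / 2 : ℝ) ^ 2 / q.2))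
          (Measurable.aestronglyMeasurable (by fun_prop)) fun q => ?_).symm
        rw [show Complex.I * (‖q.1.1 - q.1.2‖ / 2 : ℝ) ^ 2 / q.2 =
          (((‖q.1.1 - q.1.2‖ / 2) ^ 2 / q.2 : ℝ) : ℂ) * Complex.I by push_cast; ring]
        exact (Complex.norm_exp_ofReal_mul_I _).le

lemma norm_one_div_four_pi_I_cpow_le (d : ℕ) :
    ‖(1 / (4 * Real.pi * Complex.I)) ^ (d / 2 : ℂ)‖ ≤ 1 := by
  have hπ := Real.pi_gt_three
  have hbase : (1 / (4 * Real.pi * Complex.I) : ℂ) ≠ 0 := by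
    simp [Real.pi_ne_zero]
  rw [show (d / 2 : ℂ) = ((d / 2 : ℝ) : ℂ) by push_cast; rfl, Complex.norm_cpow_of_ne_zero hbase]
  simp only [Complex.ofReal_re, Complex.ofReal_im, mul_zero, Real.exp_zero, div_one]
  refine Real.rpow_le_one (norm_nonneg _) ?_ (by positivity)
  simp only [norm_div, norm_one, norm_mul, Complex.norm_I, Complex.norm_real, Complex.norm_ofNat,
    Real.norm_of_nonneg Real.pi_pos.le, mul_one]
  rw [div_le_one (by positivity)]
  linarith

lemma norm_mul_Gamma_mul_powForm_le_of_lt (hf : Integrable f) (hf2 : MemLp f 2)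
    (hk : Integrable k) (hk2 : MemLp k 2) (hε : 0 < ε) (hε1 : ε ≤ 1)
    (hs : (Module.finrank ℝ V : ℝ) / 2 < s.re) (hs' : s.re ≤ (Module.finrank ℝ V + 1 : ℝ) / 2) :
    ‖(s - Module.finrank ℝ V / 2) * (Complex.Gamma s * powForm ε s f k)‖ ≤
      200 * (1 + ‖s - Module.finrank ℝ V / 2‖) ^ 2 * ((∫ x, ‖f x‖) * ∫ x, ‖k x‖) := by
  set w : ℂ := s - Module.finrank ℝ V / 2 with hw
  have hwre : w.re = s.re - Module.finrank ℝ V / 2 := by simp [hw]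
  have hprod : ∫ q : V × V, ‖f q.1 * k q.2‖ = (∫ x, ‖f x‖) * ∫ x, ‖k x‖ := by
    simp_rw [norm_mul]
    exact integral_prod_mul (fun x => ‖f x‖) (fun x => ‖k x‖)
  rw [Gamma_mul_powForm_eq hf hf2 hk hk2 hε hs, mul_left_comm, norm_mul, ← integral_const_mul]
  refine (mul_le_of_le_one_left (norm_nonneg _) (norm_one_div_four_pi_I_cpow_le _)).trans ?_
  rw [← hprod, ← integral_const_mul]
  refine norm_integral_le_of_norm_le ((hf.mul_prod hk).norm.const_mul _) (ae_of_all _ fun q => ?_)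
  rw [mul_left_comm, norm_mul, mul_comm]
  gcongr
  exact norm_mul_integral_Ioi_cpow_mul_osc_le (by rw [hwre]; linarith) (by rw [hwre]; linarith) hε
    hε1 (by positivity)

theorem norm_mul_Gamma_mul_powForm_le (hf : Integrable f) (hf2 : MemLp f 2)
    (hk : Integrable k) (hk2 : MemLp k 2) (hε : 0 < ε) (hε1 : ε ≤ 1) (hs0 : 0 < s.re)
    (hs : (Module.finrank ℝ V : ℝ) / 2 ≤ s.re) (hs' : s.re ≤ (Module.finrank ℝ V + 1 : ℝ) / 2) :
    ‖(s - Module.finrank ℝ V / 2) * (Complex.Gamma s * powForm ε s f k)‖ ≤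
      200 * (1 + ‖s - Module.finrank ℝ V / 2‖) ^ 2 * ((∫ x, ‖f x‖) * ∫ x, ‖k x‖) := by
  have hΓ : ContinuousAt Complex.Gamma s := by
    refine (Complex.differentiableAt_Gamma s fun m hm => ?_).continuousAt
    rw [hm, Complex.neg_re, Complex.natCast_re] at hs0
    linarith [(Nat.cast_nonneg m : (0 : ℝ) ≤ m)]
  have hform : ContinuousAt (fun s => powForm ε s f k) s :=
    ((differentiableOn_integral_symb_cpow_mul hε hε1
      (integrable_fourier_mul_fourierInv hf hf2 hk hk2)).differentiableAt
      ((isOpen_lt continuous_const Complex.continuous_re).mem_nhds hs0)).continuousAt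
  have hmem : s ∈ closure (Complex.re ⁻¹'
      Set.Ioc ((Module.finrank ℝ V : ℝ) / 2) ((Module.finrank ℝ V + 1 : ℝ) / 2)) := by
    rw [← Complex.isOpenMap_re.preimage_closure_eq_closure_preimage Complex.continuous_re,
      closure_Ioc (by linarith)]
    exact ⟨hs, hs'⟩
  refine ContinuousWithinAt.closure_le hmem ?_ ?_ fun w hw =>
    norm_mul_Gamma_mul_powForm_le_of_lt hf hf2 hk hk2 hε hε1 hw.1 hw.2
  · exact ((continuousAt_id.sub continuousAt_const).mul (hΓ.mul hform)).norm.continuousWithinAt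
  · fun_prop

end PowForm

/-! ### A three lines lemma for families of exponential growth -/

section StripGauge

open Complex.HadamardThreeLines

lemma one_add_pow_mul_exp_le {x : ℝ} (hx : 0 ≤ x) {j : ℕ} (hj : j ≤ 4) :
    (1 + x) ^ j * Real.exp (Real.pi * x - x ^ 2) ≤ Real.exp 16 := by
  have hpow : (1 + x) ^ j ≤ Real.exp (4 * x) := by
    calc (1 + x) ^ j ≤ (1 + x) ^ 4 := pow_le_pow_right₀ (by linarith) hj
      _ ≤ (Real.exp x) ^ 4 := by gcongr; linarith [Real.add_one_le_exp x]
      _ = Real.exp (4 * x) := by rw [← Real.exp_nat_mul]; norm_num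
  calc (1 + x) ^ j * Real.exp (Real.pi * x - x ^ 2)
      ≤ Real.exp (4 * x) * Real.exp (Real.pi * x - x ^ 2) := by gcongr
    _ = Real.exp (4 * x + (Real.pi * x - x ^ 2)) := (Real.exp_add _ _).symm
    _ ≤ Real.exp 16 := by
      apply Real.exp_le_exp.2
      nlinarith [sq_nonneg (x - 4), mul_le_mul_of_nonneg_right Real.pi_le_four hx]

/-- The weight used in Stein interpolation on the strip `0 ≤ Re s ≤ b`. The Gaussian factor absorbs
growth of order `exp (π |Im s|)`, the Gamma factor is the one coming with the kernel of a complex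
power, and the zero at `s = b` cancels the pole that this kernel may have there. -/
def stripGauge (b : ℝ) (s : ℂ) : ℂ := Complex.Gamma (s + 1) * (s - b) * Complex.exp (s ^ 2)

variable {b d σ : ℝ} {s : ℂ}

lemma norm_cexp_sq (s : ℂ) : ‖Complex.exp (s ^ 2)‖ = Real.exp (s.re ^ 2 - s.im ^ 2) := by
  rw [Complex.norm_exp, pow_two, Complex.mul_re, pow_two, pow_two]

lemma norm_sub_ofReal_le (h0 : 0 ≤ s.re) (hb : s.re ≤ b) (hd0 : 0 ≤ d) (hdb : d ≤ b) :
    1 + ‖s - d‖ ≤ (1 + b) * (1 + |s.im|) := by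
  have hnorm := Complex.norm_le_abs_re_add_abs_im (s - d)
  rw [Complex.sub_re, Complex.sub_im, Complex.ofReal_re, Complex.ofReal_im, sub_zero] at hnorm
  have hre : |s.re - d| ≤ b := abs_le.2 ⟨by linarith, by linarith⟩
  nlinarith [abs_nonneg s.im]

lemma differentiableAt_stripGauge (b : ℝ) (hs : 0 ≤ s.re) :
    DifferentiableAt ℂ (stripGauge b) s := by
  have hΓ : DifferentiableAt ℂ Complex.Gamma (s + 1) :=
    Complex.differentiableAt_Gamma _ fun m hm => by
      have hre : s.re + 1 = -m := by simpa using congrArg Complex.re hm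
      linarith [(Nat.cast_nonneg m : (0 : ℝ) ≤ m)]
  have hΓ' : DifferentiableAt ℂ (fun s => Complex.Gamma (s + 1)) s :=
    hΓ.comp s (differentiableAt_id.add_const 1)
  exact (hΓ'.mul (by fun_prop)).mul (by fun_prop)

lemma stripGauge_ne_zero (hσ : 0 < σ) (hσb : σ < b) : stripGauge b σ ≠ 0 := by
  refine mul_ne_zero (mul_ne_zero ?_ ?_) (Complex.exp_ne_zero _)
  · refine Complex.Gamma_ne_zero_of_re_pos ?_
    rw [Complex.add_re, Complex.ofReal_re, Complex.one_re]
    linarith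
  · rw [sub_ne_zero]
    exact_mod_cast hσb.ne

lemma exists_Gamma_add_one_le (b : ℝ) :
    ∃ G : ℝ, ∀ x : ℝ, 0 ≤ x → x ≤ b → Real.Gamma (x + 1) ≤ G := by
  have hcont : ContinuousOn (fun x => Real.Gamma (x + 1)) (Set.Icc 0 b) := fun x hx => by
    have hΓ : ContinuousAt Real.Gamma (x + 1) :=
      (Real.differentiableAt_Gamma fun m hm => by
        linarith [(Nat.cast_nonneg m : (0 : ℝ) ≤ m), hx.1]).continuousAt
    exact (hΓ.comp (f := fun x : ℝ => x + 1) (by fun_prop)).continuousWithinAt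
  obtain ⟨G, hG⟩ := isCompact_Icc.exists_bound_of_continuousOn hcont
  exact ⟨G, fun x h0 hb => (le_abs_self _).trans (hG x ⟨h0, hb⟩)⟩

lemma exp_sq_sub_sq_le (h0 : 0 ≤ s.re) (hb : s.re ≤ b) :
    Real.exp (s.re ^ 2 - s.im ^ 2) ≤ Real.exp (b ^ 2) * Real.exp (-|s.im| ^ 2) := by
  rw [← Real.exp_add, Real.exp_le_exp, sq_abs]
  nlinarith

lemma exists_norm_stripGauge_mul_exp_le (hb0 : 0 ≤ b) :
    ∃ K : ℝ, 0 ≤ K ∧ ∀ s : ℂ, 0 ≤ s.re → s.re ≤ b →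
      ‖stripGauge b s‖ * Real.exp (Real.pi * |s.im|) ≤ K := by
  obtain ⟨G, hG⟩ := exists_Gamma_add_one_le b
  have hG0 : 0 ≤ G := (Real.Gamma_nonneg_of_nonneg (by norm_num)).trans (hG 0 le_rfl hb0)
  refine ⟨G * (1 + b) * Real.exp (b ^ 2) * Real.exp 16, by positivity, fun s h0 hb => ?_⟩
  have hΓ : ‖Complex.Gamma (s + 1)‖ ≤ G := by
    have hre : (s + 1).re = s.re + 1 := by rw [Complex.add_re, Complex.one_re]
    refine (norm_Gamma_le_Gamma_re (by rw [hre]; linarith)).trans ?_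
    rw [hre]
    exact hG _ h0 hb
  have hpoly := one_add_pow_mul_exp_le (abs_nonneg s.im) (j := 1) (by norm_num)
  rw [pow_one, sub_eq_add_neg, Real.exp_add] at hpoly
  have hsub := norm_sub_ofReal_le h0 hb hb0 le_rfl
  simp only [stripGauge, norm_mul, norm_cexp_sq]
  calc ‖Complex.Gamma (s + 1)‖ * ‖s - b‖ * Real.exp (s.re ^ 2 - s.im ^ 2) *
        Real.exp (Real.pi * |s.im|)
      ≤ G * ((1 + b) * (1 + |s.im|)) * (Real.exp (b ^ 2) * Real.exp (-|s.im| ^ 2)) *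
        Real.exp (Real.pi * |s.im|) := by
        gcongr
        · linarith
        · exact exp_sq_sub_sq_le h0 hb
    _ = G * (1 + b) * Real.exp (b ^ 2) *
        ((1 + |s.im|) * (Real.exp (Real.pi * |s.im|) * Real.exp (-|s.im| ^ 2))) := by ring
    _ ≤ G * (1 + b) * Real.exp (b ^ 2) * Real.exp 16 := by gcongr

lemma norm_stripGauge_mul_le (hb0 : 0 < b) (hd0 : 0 ≤ d) (hdb : d ≤ b) (hs : s.re = b) {z : ℂ}
    {B : ℝ} (hz : ‖(s - d) * (Complex.Gamma s * z)‖ ≤ (1 + ‖s - d‖) ^ 2 * B) :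
    ‖stripGauge b s * z‖ ≤ (1 + b) ^ 3 * Real.exp (b ^ 2) * Real.exp 16 * B := by
  have hs0 : s ≠ 0 := by
    rintro rfl
    exact hb0.ne hs
  have hB : 0 ≤ B := by
    by_contra! hneg
    have : (1 + ‖s - d‖) ^ 2 * B < 0 := mul_neg_of_pos_of_neg (by positivity) hneg
    linarith [norm_nonneg ((s - d) * (Complex.Gamma s * z))]
  have hsub : ‖s - b‖ ≤ ‖s - d‖ := by
    have him : s - b = (s.im : ℂ) * Complex.I := by
      apply Complex.ext <;> simp [hs]
    rw [him, norm_mul, Complex.norm_I, mul_one, Complex.norm_real, Real.norm_eq_abs]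
    simpa using Complex.abs_im_le_norm (s - d)
  have hsd := norm_sub_ofReal_le (hs ▸ hb0.le) hs.le hd0 hdb
  have hs1 := norm_sub_ofReal_le (hs ▸ hb0.le) hs.le le_rfl hb0.le
  rw [Complex.ofReal_zero, sub_zero] at hs1
  have hpoly := one_add_pow_mul_exp_le (abs_nonneg s.im) (j := 3) (by norm_num)
  rw [norm_mul] at hz
  calc ‖stripGauge b s * z‖
      = ‖s‖ * Real.exp (s.re ^ 2 - s.im ^ 2) * (‖s - b‖ * ‖Complex.Gamma s * z‖) := by
        simp only [stripGauge, Complex.Gamma_add_one s hs0, norm_mul, norm_cexp_sq]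
        ring
    _ ≤ (1 + b) * (1 + |s.im|) * (Real.exp (b ^ 2) * Real.exp (-|s.im| ^ 2)) *
          (((1 + b) * (1 + |s.im|)) ^ 2 * B) := by
        refine mul_le_mul (mul_le_mul (by linarith) (exp_sq_sub_sq_le (hs ▸ hb0.le) hs.le)
          (Real.exp_pos _).le (by positivity)) ?_ (by positivity) (by positivity)
        exact (mul_le_mul_of_nonneg_right hsub (norm_nonneg _)).trans (hz.trans (by gcongr))
    _ = (1 + b) ^ 3 * Real.exp (b ^ 2) * ((1 + |s.im|) ^ 3 * Real.exp (-|s.im| ^ 2)) * B := by ring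
    _ ≤ (1 + b) ^ 3 * Real.exp (b ^ 2) * Real.exp 16 * B := by
        gcongr
        refine le_trans ?_ hpoly
        gcongr
        linarith [mul_nonneg Real.pi_pos.le (abs_nonneg s.im)]

lemma diffContOnCl_stripGauge_mul {Φ : ℂ → ℂ} (hdiff : DifferentiableOn ℂ Φ {s | 0 < s.re})
    (hcont : ContinuousOn Φ {s | 0 ≤ s.re}) (b : ℝ) :
    DiffContOnCl ℂ (fun s => stripGauge b s * Φ s) (verticalStrip 0 b) := by
  have hdiff' : DifferentiableOn ℂ (fun s => stripGauge b s * Φ s) {s | 0 < s.re} :=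
    fun s (hs : 0 < s.re) =>
      (differentiableAt_stripGauge b hs.le).differentiableWithinAt.mul (hdiff s hs)
  have hcont' : ContinuousOn (fun s => stripGauge b s * Φ s) {s : ℂ | 0 ≤ s.re} :=
    fun s (hs : 0 ≤ s.re) =>
      (differentiableAt_stripGauge b hs).continuousAt.continuousWithinAt.mul (hcont s hs)
  have hsub : closure (verticalStrip 0 b) ⊆ {s : ℂ | 0 ≤ s.re} :=
    closure_minimal (fun s hs => hs.1.le) (isClosed_le continuous_const Complex.continuous_re)
  exact ⟨hdiff'.mono fun s hs => hs.1, hcont'.mono hsub⟩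

theorem exists_norm_le_of_strip_bounds (hσ : 0 < σ) (hσb : σ < b) (hd0 : 0 ≤ d) (hdb : d ≤ b) :
    ∃ C : ℝ, 0 ≤ C ∧ ∀ (Φ : ℂ → ℂ) (A B M : ℝ), 0 ≤ A → 0 ≤ B →
      DifferentiableOn ℂ Φ {s | 0 < s.re} → ContinuousOn Φ {s | 0 ≤ s.re} →
      (∀ s : ℂ, 0 ≤ s.re → s.re ≤ b → ‖Φ s‖ ≤ Real.exp (Real.pi * |s.im|) * M) →
      (∀ s : ℂ, s.re = 0 → ‖Φ s‖ ≤ Real.exp (Real.pi * |s.im|) * A) →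
      (∀ s : ℂ, s.re = b →
        ‖(s - d) * (Complex.Gamma s * Φ s)‖ ≤ (1 + ‖s - d‖) ^ 2 * B) →
      ‖Φ σ‖ ≤ C * (A ^ (1 - σ / b) * B ^ (σ / b)) := by
  have hb0 : 0 < b := hσ.trans hσb
  obtain ⟨K, hK0, hK⟩ := exists_norm_stripGauge_mul_exp_le hb0.le
  set L : ℝ := (1 + b) ^ 3 * Real.exp (b ^ 2) * Real.exp 16
  have hL0 : 0 ≤ L := by positivity
  refine ⟨K ^ (1 - σ / b) * L ^ (σ / b) / ‖stripGauge b σ‖, by positivity,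
    fun Φ A B M hA hB hdiff hcont hgrowth hleft hright => ?_⟩
  have hbound : ∀ {s : ℂ} {Q : ℝ}, 0 ≤ s.re → s.re ≤ b →
      ‖Φ s‖ ≤ Real.exp (Real.pi * |s.im|) * Q → ‖stripGauge b s * Φ s‖ ≤ K * |Q| :=
    fun {s Q} h0 h1 hQ => by
      rw [norm_mul]
      calc ‖stripGauge b s‖ * ‖Φ s‖
          ≤ ‖stripGauge b s‖ * (Real.exp (Real.pi * |s.im|) * |Q|) := by
            gcongr; exact hQ.trans (by gcongr; exact le_abs_self Q)
        _ ≤ K * |Q| := by rw [← mul_assoc]; gcongr; exact hK s h0 h1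
  have hthree := norm_le_interp_of_mem_verticalClosedStrip' hb0
    (show (σ : ℂ) ∈ verticalClosedStrip 0 b from ⟨hσ.le, hσb.le⟩)
    (diffContOnCl_stripGauge_mul hdiff hcont b)
    ⟨K * |M|, by rintro _ ⟨s, hs, rfl⟩; exact hbound hs.1 hs.2 (hgrowth s hs.1 hs.2)⟩
    (fun s (hs : s.re = 0) => hbound hs.ge (hs ▸ hb0.le) (hleft s hs))
    (fun s (hs : s.re = b) => norm_stripGauge_mul_le hb0 hd0 hdb hs (hright s hs))
  rw [abs_of_nonneg hA, Complex.ofReal_re, sub_zero, sub_zero, Real.mul_rpow hK0 hA,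
    Real.mul_rpow hL0 hB, mul_mul_mul_comm, norm_mul] at hthree
  rwa [div_mul_eq_mul_div, le_div_iff₀ (norm_pos_iff.2 (stripGauge_ne_zero hσ hσb)), mul_comm]

end StripGauge

/-! ### Stein interpolation for complex powers -/

section PowMap

/-- The analytic family `c ↦ |c|^α sgn c`. -/
def powMap (α c : ℂ) : ℂ := c * (‖c‖ : ℂ) ^ (α - 1)

lemma powMap_zero (α : ℂ) : powMap α 0 = 0 := by
  rw [powMap, zero_mul]

lemma powMap_one (c : ℂ) : powMap 1 c = c := by
  rw [powMap, sub_self, Complex.cpow_zero, mul_one]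

lemma norm_powMap {α : ℂ} (hα : 0 < α.re) (c : ℂ) : ‖powMap α c‖ = ‖c‖ ^ α.re := by
  rcases eq_or_ne c 0 with rfl | hc
  · rw [powMap_zero, norm_zero, Real.zero_rpow hα.ne']
  · have hc' := norm_pos_iff.2 hc
    rw [powMap, norm_mul, Complex.norm_cpow_eq_rpow_re_of_pos hc', Complex.sub_re, Complex.one_re,
      Real.rpow_sub_one hc'.ne', mul_div_cancel₀ _ hc'.ne']

lemma differentiable_powMap (c : ℂ) : Differentiable ℂ fun α => powMap α c := by
  rcases eq_or_ne c 0 with rfl | hc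
  · simp only [powMap_zero]
    exact differentiable_const _
  · have hc' : (‖c‖ : ℂ) ≠ 0 := by exact_mod_cast (norm_pos_iff.2 hc).ne'
    exact ((differentiable_id.sub_const 1).const_cpow (Or.inl hc')).const_mul c

lemma rpow_le_rpow_add_rpow {x a p q : ℝ} (hx : 0 ≤ x) (hp : 0 < p) (hpa : p ≤ a) (haq : a ≤ q) :
    x ^ a ≤ x ^ p + x ^ q := by
  rcases le_total x 1 with h | h
  · linarith [Real.rpow_le_rpow_of_exponent_ge' hx h hp.le hpa, Real.rpow_nonneg hx q]
  · linarith [Real.rpow_le_rpow_of_exponent_le h haq, Real.rpow_nonneg hx p]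

end PowMap

section SimpleFunc

variable {X : Type*} [MeasurableSpace X] {μ : Measure X} {f : SimpleFunc X ℂ}

lemma memLp_comp_of_finMeasSupp {E : Type*} [NormedAddCommGroup E] (hf : f.FinMeasSupp μ)
    {g : ℂ → E} (hg : g 0 = 0) (q : ℝ≥0∞) : MemLp (fun x => g (f x)) q μ :=
  SimpleFunc.memLp_of_finite_measure_preimage q
    (SimpleFunc.finMeasSupp_iff.1 (hf.map hg))

lemma integrable_comp_of_finMeasSupp {E : Type*} [NormedAddCommGroup E]
    (hf : f.FinMeasSupp μ) {g : ℂ → E} (hg : g 0 = 0) : Integrable (fun x => g (f x)) μ :=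
  memLp_one_iff_integrable.1 (memLp_comp_of_finMeasSupp hf hg 1)

lemma comp_eq_sum_single (f : SimpleFunc X ℂ) {g : ℂ → ℂ} (hg : g 0 = 0) :
    (fun x => g (f x)) =
      fun x => ∑ c ∈ f.range.filter (· ≠ 0), g c * (Pi.single c 1 : ℂ → ℂ) (f x) := by
  funext x
  rcases eq_or_ne (f x) 0 with h | h
  · rw [h, hg, Finset.sum_eq_zero]
    intro c hc
    rw [Pi.single_eq_of_ne (Finset.mem_filter.1 hc).2.symm, mul_zero]
  · rw [Finset.sum_eq_single_of_mem (f x) (Finset.mem_filter.2 ⟨f.mem_range_self x, h⟩)]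
    · rw [Pi.single_eq_same, mul_one]
    · intro c _ hc
      rw [Pi.single_eq_of_ne hc.symm, mul_zero]

end SimpleFunc

section SteinFamily

variable {V : Type*} [NormedAddCommGroup V] [InnerProductSpace ℝ V] [FiniteDimensional ℝ V]
  [MeasurableSpace V] [BorelSpace V] {f k : SimpleFunc V ℂ} {ε p b : ℝ} {s : ℂ}

lemma fourier_sum_mul {ι : Type*} (J : Finset ι) (a : ι → ℂ) {e : ι → V → ℂ}
    (he : ∀ c ∈ J, Integrable (e c)) (z : V) :
    𝓕 (fun x => ∑ c ∈ J, a c * e c x) z = ∑ c ∈ J, a c * 𝓕 (e c) z := by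
  simp only [Real.fourier_eq, Finset.smul_sum]
  rw [integral_finsetSum]
  · refine Finset.sum_congr rfl fun c _ => ?_
    rw [← integral_const_mul]
    simp only [Circle.smul_def, smul_eq_mul, mul_left_comm]
  · exact fun c hc => (Real.fourierIntegral_convergent_iff z).2 ((he c hc).const_mul _)

lemma powForm_sum_mul (hε : 0 < ε) (hs : 0 ≤ s.re) {ι κ : Type*} (J : Finset ι) (K : Finset κ)
    (a : ι → ℂ) (a' : κ → ℂ) {e : ι → V → ℂ} {e' : κ → V → ℂ} (he : ∀ c ∈ J, Integrable (e c))
    (he2 : ∀ c ∈ J, MemLp (e c) 2) (he' : ∀ d ∈ K, Integrable (e' d))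
    (he2' : ∀ d ∈ K, MemLp (e' d) 2) :
    powForm ε s (fun x => ∑ c ∈ J, a c * e c x) (fun x => ∑ d ∈ K, a' d * e' d x) =
      ∑ c ∈ J, ∑ d ∈ K, a c * a' d * powForm ε s (e c) (e' d) := by
  have hint : ∀ c ∈ J, ∀ d ∈ K, Integrable fun z =>
      a c * a' d * (symb ε z ^ (-s) * (𝓕 (e c) z * 𝓕⁻ (e' d) z)) := fun c hc d hd =>
    (integrable_symb_cpow_mul hε hs (integrable_fourier_mul_fourierInv (he c hc) (he2 c hc)
      (he' d hd) (he2' d hd))).const_mul _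
  have hpoint : ∀ z : V, symb ε z ^ (-s) * (𝓕 (fun x => ∑ c ∈ J, a c * e c x) z *
      𝓕⁻ (fun x => ∑ d ∈ K, a' d * e' d x) z) =
      ∑ c ∈ J, ∑ d ∈ K, a c * a' d * (symb ε z ^ (-s) * (𝓕 (e c) z * 𝓕⁻ (e' d) z)) := fun z => by
    simp only [Real.fourierInv_eq_fourier_neg]
    rw [fourier_sum_mul J a he, fourier_sum_mul K a' he', Finset.sum_mul_sum, Finset.mul_sum]
    refine Finset.sum_congr rfl fun c _ => ?_
    rw [Finset.mul_sum]
    exact Finset.sum_congr rfl fun d _ => by ring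
  simp only [powForm, hpoint]
  rw [integral_finsetSum _ fun c hc => integrable_finsetSum _ fun d hd => hint c hc d hd]
  refine Finset.sum_congr rfl fun c hc => ?_
  rw [integral_finsetSum _ fun d hd => hint c hc d hd]
  exact Finset.sum_congr rfl fun d _ => integral_const_mul _ _

/-- The affine exponent with value `p / 2` on `Re s = 0` and real part `p` on `Re s = b`. -/
def steinExponent (p b : ℝ) (s : ℂ) : ℂ := (p / 2 : ℝ) * (1 + s / b)

/-- The analytic family to which the three lines theorem is applied: both the complex power and the
two functions it is tested against vary with `s`. -/
def steinFamily (ε p b : ℝ) (f k : SimpleFunc V ℂ) (s : ℂ) : ℂ :=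
  powForm ε s (fun x => powMap (steinExponent p b s) (f x))
    (fun x => powMap (steinExponent p b s) (k x))

lemma steinExponent_re (p b : ℝ) (s : ℂ) : (steinExponent p b s).re = p / 2 * (1 + s.re / b) := by
  rw [steinExponent, Complex.re_ofReal_mul, Complex.add_re, Complex.one_re, Complex.div_ofReal_re]

lemma differentiable_steinExponent (p b : ℝ) : Differentiable ℂ (steinExponent p b) := by
  unfold steinExponent
  fun_prop

lemma steinFamily_eq_sum (hε : 0 < ε) (hs : 0 ≤ s.re) (hf : f.FinMeasSupp volume)
    (hk : k.FinMeasSupp volume) (p b : ℝ) :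
    steinFamily ε p b f k s =
      ∑ c ∈ f.range.filter (· ≠ 0), ∑ d ∈ k.range.filter (· ≠ 0),
        powMap (steinExponent p b s) c * powMap (steinExponent p b s) d *
          powForm ε s (fun x => (Pi.single c 1 : ℂ → ℂ) (f x))
            (fun x => (Pi.single d 1 : ℂ → ℂ) (k x)) := by
  have hsingle : ∀ {h : SimpleFunc V ℂ}, ∀ c ∈ h.range.filter (· ≠ 0),
      (Pi.single c 1 : ℂ → ℂ) 0 = 0 :=
    fun c hc => Pi.single_eq_of_ne (Finset.mem_filter.1 hc).2.symm _
  rw [steinFamily, comp_eq_sum_single f (powMap_zero _), comp_eq_sum_single k (powMap_zero _),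
    powForm_sum_mul hε hs _ _ _ _
      (fun c hc => integrable_comp_of_finMeasSupp hf (hsingle c hc))
      (fun c hc => memLp_comp_of_finMeasSupp hf (hsingle c hc) 2)
      (fun d hd => integrable_comp_of_finMeasSupp hk (hsingle d hd))
      (fun d hd => memLp_comp_of_finMeasSupp hk (hsingle d hd) 2)]

lemma integrable_fourier_single_mul (hf : f.FinMeasSupp volume) (hk : k.FinMeasSupp volume)
    {c d : ℂ} (hc : c ≠ 0) (hd : d ≠ 0) :
    Integrable fun z => 𝓕 (fun x => (Pi.single c 1 : ℂ → ℂ) (f x)) z *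
      𝓕⁻ (fun x => (Pi.single d 1 : ℂ → ℂ) (k x)) z := by
  have hc0 : (Pi.single c 1 : ℂ → ℂ) 0 = 0 := Pi.single_eq_of_ne hc.symm _
  have hd0 : (Pi.single d 1 : ℂ → ℂ) 0 = 0 := Pi.single_eq_of_ne hd.symm _
  exact integrable_fourier_mul_fourierInv (integrable_comp_of_finMeasSupp hf hc0)
    (memLp_comp_of_finMeasSupp hf hc0 2) (integrable_comp_of_finMeasSupp hk hd0)
    (memLp_comp_of_finMeasSupp hk hd0 2)

lemma differentiableOn_steinFamily (hε : 0 < ε) (hε1 : ε ≤ 1) (hf : f.FinMeasSupp volume)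
    (hk : k.FinMeasSupp volume) (p b : ℝ) :
    DifferentiableOn ℂ (steinFamily ε p b f k) {s | 0 < s.re} := by
  refine DifferentiableOn.congr ?_ fun s (hs : 0 < s.re) => steinFamily_eq_sum hε hs.le hf hk p b
  have hpow : ∀ c : ℂ, Differentiable ℂ fun s => powMap (steinExponent p b s) c := fun c =>
    (differentiable_powMap c).comp (differentiable_steinExponent p b)
  refine DifferentiableOn.fun_sum fun c hc => DifferentiableOn.fun_sum fun d hd => ?_
  exact ((hpow c).mul (hpow d)).differentiableOn.mul (differentiableOn_integral_symb_cpow_mul hε hε1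
    (integrable_fourier_single_mul hf hk (Finset.mem_filter.1 hc).2 (Finset.mem_filter.1 hd).2))

lemma continuousOn_steinFamily (hε : 0 < ε) (hε1 : ε ≤ 1) (hf : f.FinMeasSupp volume)
    (hk : k.FinMeasSupp volume) (p b : ℝ) :
    ContinuousOn (steinFamily ε p b f k) {s | 0 ≤ s.re} := by
  refine ContinuousOn.congr ?_ fun s (hs : 0 ≤ s.re) => steinFamily_eq_sum hε hs hf hk p b
  have hpow : ∀ c : ℂ, Continuous fun s => powMap (steinExponent p b s) c := fun c =>
    ((differentiable_powMap c).comp (differentiable_steinExponent p b)).continuous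
  refine continuousOn_finsetSum _ fun c hc => continuousOn_finsetSum _ fun d hd => ?_
  exact ((hpow c).mul (hpow d)).continuousOn.mul (continuousOn_integral_symb_cpow_mul hε hε1
    (integrable_fourier_single_mul hf hk (Finset.mem_filter.1 hc).2 (Finset.mem_filter.1 hd).2))

lemma norm_steinFamily_le_mul_eLpNorm (hε : 0 < ε) (hs : 0 ≤ s.re) (hf : f.FinMeasSupp volume)
    (hk : k.FinMeasSupp volume) (p b : ℝ) :
    ‖steinFamily ε p b f k s‖ ≤ ε ^ (-s.re) * Real.exp (Real.pi * |s.im|) *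
      ((eLpNorm (fun x => powMap (steinExponent p b s) (f x)) 2 volume).toReal *
        (eLpNorm (fun x => powMap (steinExponent p b s) (k x)) 2 volume).toReal) :=
  norm_powForm_le hε hs (integrable_comp_of_finMeasSupp hf (powMap_zero _))
    (memLp_comp_of_finMeasSupp hf (powMap_zero _) 2)
    (integrable_comp_of_finMeasSupp hk (powMap_zero _))
    (memLp_comp_of_finMeasSupp hk (powMap_zero _) 2)

lemma toReal_eLpNorm_powMap_le (hp : 0 < p) (hf : f.FinMeasSupp volume) {α : ℂ}
    (hα : p / 2 ≤ α.re) (hα' : α.re ≤ p) :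
    (eLpNorm (fun x => powMap α (f x)) 2 volume).toReal ≤
      (eLpNorm (fun x => ‖f x‖ ^ (p / 2) + ‖f x‖ ^ p) 2 volume).toReal := by
  have hdom : MemLp (fun x => ‖f x‖ ^ (p / 2) + ‖f x‖ ^ p) 2 :=
    memLp_comp_of_finMeasSupp hf (g := fun c => ‖c‖ ^ (p / 2) + ‖c‖ ^ p)
      (by simp [Real.zero_rpow hp.ne', Real.zero_rpow (half_pos hp).ne']) 2
  refine ENNReal.toReal_mono hdom.eLpNorm_ne_top (eLpNorm_mono_real fun x => ?_)
  rw [norm_powMap ((half_pos hp).trans_le hα)]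
  exact rpow_le_rpow_add_rpow (norm_nonneg _) (half_pos hp) hα hα'

lemma exists_norm_steinFamily_le (hp : 0 < p) (hb : 0 < b) (hε : 0 < ε) (hε1 : ε ≤ 1)
    (hf : f.FinMeasSupp volume) (hk : k.FinMeasSupp volume) :
    ∃ M : ℝ, ∀ s : ℂ, 0 ≤ s.re → s.re ≤ b →
      ‖steinFamily ε p b f k s‖ ≤ Real.exp (Real.pi * |s.im|) * M := by
  refine ⟨ε ^ (-b) * ((eLpNorm (fun x => ‖f x‖ ^ (p / 2) + ‖f x‖ ^ p) 2 volume).toReal *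
    (eLpNorm (fun x => ‖k x‖ ^ (p / 2) + ‖k x‖ ^ p) 2 volume).toReal), fun s h0 h1 => ?_⟩
  have hlow : p / 2 ≤ (steinExponent p b s).re := by
    rw [steinExponent_re]
    nlinarith [div_nonneg h0 hb.le]
  have hup : (steinExponent p b s).re ≤ p := by
    rw [steinExponent_re]
    nlinarith [(div_le_one hb).2 h1]
  have hpow : ε ^ (-s.re) ≤ ε ^ (-b) := Real.rpow_le_rpow_of_exponent_ge hε hε1 (by linarith)
  refine (norm_steinFamily_le_mul_eLpNorm hε h0 hf hk p b).trans ?_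
  rw [← mul_assoc (Real.exp _), mul_comm (Real.exp _)]
  exact mul_le_mul (mul_le_mul_of_nonneg_right hpow (Real.exp_pos _).le)
    (mul_le_mul (toReal_eLpNorm_powMap_le hp hf hlow hup) (toReal_eLpNorm_powMap_le hp hk hlow hup)
      ENNReal.toReal_nonneg ENNReal.toReal_nonneg) (by positivity) (by positivity)

lemma toReal_eLpNorm_two_powMap (hp : 0 < p) (hf : f.FinMeasSupp volume) {α : ℂ}
    (hα : α.re = p / 2) :
    (eLpNorm (fun x => powMap α (f x)) 2 volume).toReal = (∫ x, ‖f x‖ ^ p) ^ (1 / 2 : ℝ) := by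
  have hsq : ∀ c : ℂ, ‖powMap α c‖ ^ (2 : ℝ) = ‖c‖ ^ p := fun c => by
    rw [norm_powMap (hα ▸ half_pos hp), hα, ← Real.rpow_mul (norm_nonneg _),
      div_mul_cancel₀ _ two_ne_zero]
  rw [(memLp_comp_of_finMeasSupp hf (powMap_zero α) 2).eLpNorm_eq_integral_rpow_norm two_ne_zero
    ENNReal.ofNat_ne_top, ENNReal.toReal_ofReal (by positivity), ENNReal.toReal_ofNat, one_div]
  simp only [hsq]

lemma norm_steinFamily_le_of_re_eq_zero (hp : 0 < p) (hε : 0 < ε) (hf : f.FinMeasSupp volume)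
    (hk : k.FinMeasSupp volume) (hs : s.re = 0) (b : ℝ) :
    ‖steinFamily ε p b f k s‖ ≤ Real.exp (Real.pi * |s.im|) *
      ((∫ x, ‖f x‖ ^ p) * ∫ x, ‖k x‖ ^ p) ^ (1 / 2 : ℝ) := by
  have hre : (steinExponent p b s).re = p / 2 := by
    rw [steinExponent_re, hs, zero_div, add_zero, mul_one]
  have hmain := norm_steinFamily_le_mul_eLpNorm hε hs.ge hf hk p b
  rwa [toReal_eLpNorm_two_powMap hp hf hre, toReal_eLpNorm_two_powMap hp hk hre, hs, neg_zero,
    Real.rpow_zero, one_mul, ← Real.mul_rpow (by positivity) (by positivity)] at hmain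

lemma norm_mul_Gamma_mul_steinFamily_le (hp : 0 < p) (hb : 0 < b) (hε : 0 < ε) (hε1 : ε ≤ 1)
    (hdb : (Module.finrank ℝ V : ℝ) / 2 ≤ b) (hbd : b ≤ (Module.finrank ℝ V + 1 : ℝ) / 2)
    (hf : f.FinMeasSupp volume) (hk : k.FinMeasSupp volume) (hs : s.re = b) :
    ‖(s - Module.finrank ℝ V / 2) * (Complex.Gamma s * steinFamily ε p b f k s)‖ ≤
      200 * (1 + ‖s - Module.finrank ℝ V / 2‖) ^ 2 *
        ((∫ x, ‖f x‖ ^ p) * ∫ x, ‖k x‖ ^ p) := by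
  have hre : (steinExponent p b s).re = p := by
    rw [steinExponent_re, hs, div_self hb.ne']
    ring
  have hnorm : ∀ c : ℂ, ‖powMap (steinExponent p b s) c‖ = ‖c‖ ^ p := fun c => by
    rw [norm_powMap (hp.trans_eq hre.symm), hre]
  have hmain := norm_mul_Gamma_mul_powForm_le
    (integrable_comp_of_finMeasSupp hf (powMap_zero (steinExponent p b s)))
    (memLp_comp_of_finMeasSupp hf (powMap_zero _) 2)
    (integrable_comp_of_finMeasSupp hk (powMap_zero (steinExponent p b s)))
    (memLp_comp_of_finMeasSupp hk (powMap_zero _) 2) hε hε1 (s := s) (hs ▸ hb) (hs ▸ hdb) (hs ▸ hbd)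
  simpa only [hnorm, steinFamily] using hmain

theorem exists_norm_powForm_simpleFunc_le {σ : ℝ} (hσ : 0 < σ) (hσb : σ < b)
    (hp : p * (1 + σ / b) = 2) (hdb : (Module.finrank ℝ V : ℝ) / 2 ≤ b)
    (hbd : b ≤ (Module.finrank ℝ V + 1 : ℝ) / 2) :
    ∃ C : ℝ, 0 ≤ C ∧ ∀ ε : ℝ, 0 < ε → ε ≤ 1 → ∀ f k : SimpleFunc V ℂ, f.FinMeasSupp volume →
      k.FinMeasSupp volume →
      ‖powForm ε σ f k‖ ≤ C * ((∫ x, ‖f x‖ ^ p) * ∫ x, ‖k x‖ ^ p) ^ (1 / p) := by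
  have hb : 0 < b := hσ.trans hσb
  have hp0 : 0 < p := pos_of_mul_pos_left (hp ▸ two_pos) (by positivity)
  obtain ⟨C, hC, hstrip⟩ := exists_norm_le_of_strip_bounds hσ hσb (by positivity) hdb
  refine ⟨C * 200 ^ (σ / b), by positivity, fun ε hε hε1 f k hf hk => ?_⟩
  set N : ℝ := (∫ x, ‖f x‖ ^ p) * ∫ x, ‖k x‖ ^ p
  have hN : 0 ≤ N := by positivity
  obtain ⟨M, hM⟩ := exists_norm_steinFamily_le hp0 hb hε hε1 hf hk
  have hmain := hstrip (steinFamily ε p b f k) (N ^ (1 / 2 : ℝ)) (200 * N) M (by positivity)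
    (by positivity) (differentiableOn_steinFamily hε hε1 hf hk p b)
    (continuousOn_steinFamily hε hε1 hf hk p b) hM
    (fun s hs => norm_steinFamily_le_of_re_eq_zero hp0 hε hf hk hs b) fun s hs => by
      have hright := norm_mul_Gamma_mul_steinFamily_le hp0 hb hε hε1 hdb hbd hf hk hs
      push_cast
      linarith
  have hσ1 : steinExponent p b σ = 1 := by
    rw [steinExponent]
    exact_mod_cast (by linarith : p / 2 * (1 + σ / b) = 1)
  have hpow : (N ^ (1 / 2 : ℝ)) ^ (1 - σ / b) * (200 * N) ^ (σ / b) =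
      200 ^ (σ / b) * N ^ (1 / p) := by
    have hexp : 1 / 2 * (1 - σ / b) + σ / b = 1 / p := by
      rw [eq_div_iff hp0.ne']
      linarith
    rw [Real.mul_rpow (by norm_num) hN, ← Real.rpow_mul hN, mul_left_comm,
      ← Real.rpow_add' hN (by rw [hexp]; positivity), hexp]
  simp only [steinFamily, hσ1, powMap_one] at hmain
  rwa [hpow, ← mul_assoc] at hmain

end SteinFamily

section Density

lemma integral_norm_rpow_eq_toReal_eLpNorm_rpow {α E : Type*} [MeasurableSpace α]
    [NormedAddCommGroup E] {μ : Measure α} {f : α → E} {p : ℝ} (hp : 0 < p)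
    (hf : MemLp f (ENNReal.ofReal p) μ) :
    ∫ x, ‖f x‖ ^ p ∂μ = (eLpNorm f (ENNReal.ofReal p) μ).toReal ^ p := by
  rw [hf.eLpNorm_eq_integral_rpow_norm (by simpa using hp) ENNReal.ofReal_ne_top,
    ENNReal.toReal_ofReal hp.le, ENNReal.toReal_ofReal (by positivity),
    Real.rpow_inv_rpow (by positivity) hp.ne']

variable {V : Type*} [NormedAddCommGroup V] [InnerProductSpace ℝ V] [FiniteDimensional ℝ V]
  [MeasurableSpace V] [BorelSpace V] {f g k h : V → ℂ} {ε p : ℝ} {s : ℂ}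

lemma fourier_sub_apply (hf : Integrable f) (hg : Integrable g) (z : V) :
    𝓕 (f - g) z = 𝓕 f z - 𝓕 g z := by
  simp only [Real.fourier_eq, Pi.sub_apply, smul_sub]
  exact integral_sub ((Real.fourierIntegral_convergent_iff z).2 hf)
    ((Real.fourierIntegral_convergent_iff z).2 hg)

lemma powForm_sub_left (hε : 0 < ε) (hs : 0 ≤ s.re) (hf : Integrable f) (hf2 : MemLp f 2)
    (hg : Integrable g) (hg2 : MemLp g 2) (hk : Integrable k) (hk2 : MemLp k 2) :
    powForm ε s (f - g) k = powForm ε s f k - powForm ε s g k := by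
  simp only [powForm, fourier_sub_apply hf hg, sub_mul, mul_sub]
  exact integral_sub
    (integrable_symb_cpow_mul hε hs (integrable_fourier_mul_fourierInv hf hf2 hk hk2))
    (integrable_symb_cpow_mul hε hs (integrable_fourier_mul_fourierInv hg hg2 hk hk2))

lemma powForm_sub_right (hε : 0 < ε) (hs : 0 ≤ s.re) (hf : Integrable f) (hf2 : MemLp f 2)
    (hk : Integrable k) (hk2 : MemLp k 2) (hh : Integrable h) (hh2 : MemLp h 2) :
    powForm ε s f (k - h) = powForm ε s f k - powForm ε s f h := by
  have hinv : ∀ z, 𝓕⁻ (k - h) z = 𝓕⁻ k z - 𝓕⁻ h z := fun z => by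
    simp only [Real.fourierInv_eq_fourier_neg]
    exact fourier_sub_apply hk hh (-z)
  simp only [powForm, hinv, mul_sub]
  exact integral_sub
    (integrable_symb_cpow_mul hε hs (integrable_fourier_mul_fourierInv hf hf2 hk hk2))
    (integrable_symb_cpow_mul hε hs (integrable_fourier_mul_fourierInv hf hf2 hh hh2))

lemma tendsto_powForm {F K : ℕ → V → ℂ} (hε : 0 < ε) (hs : 0 ≤ s.re)
    (hF : ∀ j, Integrable (F j)) (hF2 : ∀ j, MemLp (F j) 2)
    (hK : ∀ j, Integrable (K j)) (hK2 : ∀ j, MemLp (K j) 2)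
    (hf : Integrable f) (hf2 : MemLp f 2) (hk : Integrable k) (hk2 : MemLp k 2)
    (hFf : Tendsto (fun j => (hF2 j).toLp (F j)) atTop (𝓝 (hf2.toLp f)))
    (hKk : Tendsto (fun j => (hK2 j).toLp (K j)) atTop (𝓝 (hk2.toLp k))) :
    Tendsto (fun j => powForm ε s (F j) (K j)) atTop (𝓝 (powForm ε s f k)) := by
  rw [tendsto_iff_norm_sub_tendsto_zero]
  set Q : ℝ := ε ^ (-s.re) * Real.exp (Real.pi * |s.im|)
  have hbound : ∀ j, ‖powForm ε s (F j) (K j) - powForm ε s f k‖ ≤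
      Q * (‖(hF2 j).toLp (F j) - hf2.toLp f‖ * ‖(hK2 j).toLp (K j)‖) +
        Q * (‖hf2.toLp f‖ * ‖(hK2 j).toLp (K j) - hk2.toLp k‖) := fun j => by
    have hsplit : powForm ε s (F j) (K j) - powForm ε s f k =
        powForm ε s (F j - f) (K j) + powForm ε s f (K j - k) := by
      rw [powForm_sub_left hε hs (hF j) (hF2 j) hf hf2 (hK j) (hK2 j),
        powForm_sub_right hε hs hf hf2 (hK j) (hK2 j) hk hk2]
      ring
    have hleft := norm_powForm_le hε hs ((hF j).sub hf) ((hF2 j).sub hf2) (hK j) (hK2 j)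
    have hright := norm_powForm_le hε hs hf hf2 ((hK j).sub hk) ((hK2 j).sub hk2)
    rw [hsplit, ← MemLp.toLp_sub, ← MemLp.toLp_sub]
    simp only [Lp.norm_toLp]
    exact (norm_add_le _ _).trans (add_le_add hleft hright)
  have hlim := (((tendsto_iff_norm_sub_tendsto_zero.1 hFf).mul hKk.norm).const_mul Q).add
    (((tendsto_iff_norm_sub_tendsto_zero.1 hKk).const_mul ‖hf2.toLp f‖).const_mul Q)
  rw [zero_mul, mul_zero, mul_zero, mul_zero, add_zero] at hlim
  exact squeeze_zero (fun j => norm_nonneg _) hbound hlim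

theorem exists_norm_powForm_le {σ b : ℝ} (hσ : 0 < σ) (hσb : σ < b)
    (hp : p * (1 + σ / b) = 2) (hdb : (Module.finrank ℝ V : ℝ) / 2 ≤ b)
    (hbd : b ≤ (Module.finrank ℝ V + 1 : ℝ) / 2) :
    ∃ C : ℝ, 0 ≤ C ∧ ∀ ε : ℝ, 0 < ε → ε ≤ 1 → ∀ f k : V → ℂ, Measurable f → Measurable k →
      (∀ q, MemLp f q volume) → (∀ q, MemLp k q volume) →
      ‖powForm ε σ f k‖ ≤ C * ((eLpNorm f (ENNReal.ofReal p) volume).toReal *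
        (eLpNorm k (ENNReal.ofReal p) volume).toReal) := by
  have hb : 0 < b := hσ.trans hσb
  have hθ1 : σ / b < 1 := (div_lt_one hb).2 hσb
  have hp1 : 1 ≤ p := by nlinarith [div_pos hσ hb]
  have hp0 : 0 < p := one_pos.trans_le hp1
  obtain ⟨C, hC, hsimple⟩ := exists_norm_powForm_simpleFunc_le hσ hσb hp hdb hbd
  refine ⟨C, hC, fun ε hε hε1 f k hf hk hfm hkm => ?_⟩
  set P := ENNReal.ofReal p
  have : Fact (1 ≤ P) := ⟨ENNReal.one_le_ofReal.2 hp1⟩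
  set F : ℕ → SimpleFunc V ℂ := SimpleFunc.approxOn f hf (Set.range f ∪ {0}) 0 (by simp)
  set K : ℕ → SimpleFunc V ℂ := SimpleFunc.approxOn k hk (Set.range k ∪ {0}) 0 (by simp)
  have hF : ∀ q j, MemLp (F j) q (volume : Measure V) := fun q j =>
    SimpleFunc.memLp_approxOn_range hf (hfm q) j
  have hK : ∀ q j, MemLp (K j) q (volume : Measure V) := fun q j =>
    SimpleFunc.memLp_approxOn_range hk (hkm q) j
  have hform := tendsto_powForm (s := σ) hε hσ.le (fun j => memLp_one_iff_integrable.1 (hF 1 j))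
    (hF 2) (fun j => memLp_one_iff_integrable.1 (hK 1 j)) (hK 2)
    (memLp_one_iff_integrable.1 (hfm 1)) (hfm 2) (memLp_one_iff_integrable.1 (hkm 1)) (hkm 2)
    (SimpleFunc.tendsto_approxOn_range_Lp ENNReal.ofNat_ne_top hf (hfm 2))
    (SimpleFunc.tendsto_approxOn_range_Lp ENNReal.ofNat_ne_top hk (hkm 2))
  have hnorm := (((SimpleFunc.tendsto_approxOn_range_Lp ENNReal.ofReal_ne_top hf (hfm P)).norm.mul
    (SimpleFunc.tendsto_approxOn_range_Lp ENNReal.ofReal_ne_top hk (hkm P)).norm).const_mul C)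
  simp only [Lp.norm_toLp] at hnorm
  refine le_of_tendsto_of_tendsto' hform.norm hnorm fun j => ?_
  have hj := hsimple ε hε hε1 (F j) (K j)
    (SimpleFunc.integrable_iff_finMeasSupp.1 (memLp_one_iff_integrable.1 (hF 1 j)))
    (SimpleFunc.integrable_iff_finMeasSupp.1 (memLp_one_iff_integrable.1 (hK 1 j)))
  rwa [integral_norm_rpow_eq_toReal_eLpNorm_rpow hp0 (hF P j),
    integral_norm_rpow_eq_toReal_eLpNorm_rpow hp0 (hK P j),
    ← Real.mul_rpow ENNReal.toReal_nonneg ENNReal.toReal_nonneg, one_div,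
    Real.rpow_rpow_inv (by positivity) hp0.ne'] at hj

end Density

section SquaredResolvent

variable {V : Type*} [NormedAddCommGroup V] [InnerProductSpace ℝ V] [FiniteDimensional ℝ V]
  [MeasurableSpace V] [BorelSpace V] {ε p : ℝ}

lemma fourierInv_conj (f : V → ℂ) (z : V) :
    𝓕⁻ (fun x => starRingEnd ℂ (f x)) z = starRingEnd ℂ (𝓕 f z) := by
  rw [Real.fourierInv_eq', Real.fourier_eq', ← integral_conj]
  congr 1 with x
  simp only [smul_eq_mul, map_mul, ← Complex.exp_conj, Complex.conj_ofReal, Complex.conj_I]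
  congr 2
  push_cast
  ring

lemma eLpNorm_conj (f : V → ℂ) (q : ℝ≥0∞) :
    eLpNorm (fun x => starRingEnd ℂ (f x)) q volume = eLpNorm f q volume :=
  eLpNorm_congr_norm_ae (ae_of_all _ fun _ => RCLike.norm_conj _)

lemma powForm_two_conj (ε : ℝ) (φ : 𝓢(V, ℂ)) :
    powForm ε 2 φ (fun x => starRingEnd ℂ (φ x)) =
      ∫ z, (symb ε z ^ 2)⁻¹ * ((‖𝓕 φ z‖ ^ 2 : ℝ) : ℂ) := by
  refine integral_congr_ae (ae_of_all _ fun z => ?_)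
  simp only [fourierInv_conj, Complex.mul_conj, Complex.normSq_eq_norm_sq, Complex.cpow_neg,
    SchwartzMap.fourier_coe, Complex.cpow_ofNat]

lemma norm_powForm_two_le_of_finrank_eq_three (hd : Module.finrank ℝ V = 3) (hε : 0 < ε)
    (hε1 : ε ≤ 1) {f k : V → ℂ} (hf : Integrable f) (hf2 : MemLp f 2) (hk : Integrable k)
    (hk2 : MemLp k 2) : ‖powForm ε 2 f k‖ ≤ 900 * ((∫ x, ‖f x‖) * ∫ x, ‖k x‖) := by
  have h := norm_mul_Gamma_mul_powForm_le hf hf2 hk hk2 hε hε1 (s := 2) (by norm_num)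
    (by rw [hd]; norm_num) (by rw [hd]; norm_num)
  have hdist : ‖(2 : ℂ) - (3 : ℕ) / 2‖ = 1 / 2 := by norm_num
  rw [hd, norm_mul, hdist, Complex.Gamma_ofNat_eq_factorial, Nat.factorial_one, Nat.cast_one,
    one_mul] at h
  linarith

theorem exists_norm_powForm_two_le (hp : 1 ≤ p)
    (hpl : 2 * (Module.finrank ℝ V : ℝ) / (Module.finrank ℝ V + 4) ≤ p)
    (hpu : p ≤ (2 * Module.finrank ℝ V + 2) / (Module.finrank ℝ V + 5))
    (hdp : ¬ (Module.finrank ℝ V = 4 ∧ p = 1)) :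
    ∃ C : ℝ, 0 ≤ C ∧ ∀ ε : ℝ, 0 < ε → ε ≤ 1 → ∀ φ : 𝓢(V, ℂ),
      ‖powForm ε 2 φ (fun x => starRingEnd ℂ (φ x))‖ ≤
        C * (eLpNorm φ (ENNReal.ofReal p) volume).toReal ^ 2 := by
  have hd0 : (0 : ℝ) ≤ Module.finrank ℝ V := Nat.cast_nonneg _
  rw [div_le_iff₀ (by linarith)] at hpl
  rw [le_div_iff₀ (by linarith)] at hpu
  have hconj (φ : 𝓢(V, ℂ)) (q : ℝ≥0∞) : MemLp (fun x => starRingEnd ℂ (φ x)) q :=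
    (φ.memLp q volume).star
  rcases hp.lt_or_eq with h1 | rfl
  · have hp2 : 0 < 2 - p := by nlinarith
    obtain ⟨C, hC, H⟩ := exists_norm_powForm_le (V := V) (σ := 2) (b := 2 * p / (2 - p)) (p := p)
      two_pos (by rw [lt_div_iff₀ hp2]; linarith) (by field_simp; ring)
      (by rw [le_div_iff₀ hp2]; nlinarith) (by rw [div_le_iff₀ hp2]; nlinarith)
    refine ⟨C, hC, fun ε hε hε1 φ => ?_⟩
    have hφ := H ε hε hε1 φ (fun x => starRingEnd ℂ (φ x)) φ.continuous.measurable
      (Complex.continuous_conj.comp φ.continuous).measurable (φ.memLp · volume) (hconj φ)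
    rwa [eLpNorm_conj, ← sq, Complex.ofReal_ofNat] at hφ
  · have hd : Module.finrank ℝ V = 3 := by
      have h3 : 3 ≤ Module.finrank ℝ V := by
        exact_mod_cast (by linarith : (3 : ℝ) ≤ Module.finrank ℝ V)
      have h4 : Module.finrank ℝ V ≤ 4 := by
        exact_mod_cast (by linarith : (Module.finrank ℝ V : ℝ) ≤ 4)
      have hne : Module.finrank ℝ V ≠ 4 := fun h => hdp ⟨h, rfl⟩
      omega
    refine ⟨900, by norm_num, fun ε hε hε1 φ => ?_⟩
    have hφ := norm_powForm_two_le_of_finrank_eq_three hd hε hε1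
      (memLp_one_iff_integrable.1 (φ.memLp 1 volume)) (φ.memLp 2 volume)
      (memLp_one_iff_integrable.1 (hconj φ 1)) (hconj φ 2)
    simp only [RCLike.norm_conj, ← sq] at hφ
    rwa [ENNReal.ofReal_one, eLpNorm_one_eq_lintegral_enorm,
      ← integral_norm_eq_lintegral_enorm φ.continuous.aestronglyMeasurable]

end SquaredResolvent

/-! ### Limiting absorption on the unit sphere -/

section PolarCoordinates

lemma integral_volumeIoiPow {E : Type*} [NormedAddCommGroup E] [NormedSpace ℝ E] (m : ℕ)
    (G : ℝ → E) :
    ∫ r, G r ∂(Measure.volumeIoiPow m) = ∫ r in Set.Ioi (0 : ℝ), r ^ m • G r := by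
  simp only [Measure.volumeIoiPow, ENNReal.ofReal]
  rw [integral_withDensity_eq_integral_smul (by fun_prop),
    integral_subtype_comap measurableSet_Ioi fun r : ℝ => Real.toNNReal (r ^ m) • G r]
  refine setIntegral_congr_fun measurableSet_Ioi fun r (hr : 0 < r) => ?_
  simp only [NNReal.smul_def, Real.coe_toNNReal _ (pow_nonneg hr.le _)]

variable {E F : Type*} [NormedAddCommGroup E] [NormedAddCommGroup F] [NormedSpace ℝ F]

lemma smul_homeomorphUnitSphereProd (x : ({0}ᶜ : Set F)) :
    ((homeomorphUnitSphereProd F x).2 : ℝ) • ((homeomorphUnitSphereProd F x).1 : F) = x := by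
  rw [← homeomorphUnitSphereProd_symm_apply_coe, Homeomorph.symm_apply_apply]

variable [FiniteDimensional ℝ F] [MeasurableSpace F] [BorelSpace F] {μ : Measure F}
  [μ.IsAddHaarMeasure] {f : F → E}

lemma integrable_comp_polar (hf : Integrable f μ) :
    Integrable (fun q : Metric.sphere (0 : F) 1 × Set.Ioi (0 : ℝ) => f ((q.2 : ℝ) • (q.1 : F)))
      (μ.toSphere.prod (.volumeIoiPow (Module.finrank ℝ F - 1))) := by
  rw [← μ.measurePreserving_homeomorphUnitSphereProd.integrable_comp_emb
    (homeomorphUnitSphereProd F).measurableEmbedding]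
  exact ((integrableOn_iff_comap_subtypeVal (measurableSet_singleton _).compl).1
    hf.integrableOn).congr (ae_of_all _ fun x => congrArg f (smul_homeomorphUnitSphereProd x).symm)

variable [NormedSpace ℝ E]

theorem integrable_integral_polar (hf : Integrable f μ) :
    Integrable (fun ω : Metric.sphere (0 : F) 1 =>
      ∫ r in Set.Ioi (0 : ℝ), r ^ (Module.finrank ℝ F - 1) • f (r • (ω : F))) μ.toSphere := by
  simp only [← integral_volumeIoiPow]
  exact (integrable_comp_polar hf).integral_prod_left

theorem integral_eq_integral_polar [Nontrivial F] (hf : Integrable f μ) :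
    ∫ z, f z ∂μ = ∫ ω : Metric.sphere (0 : F) 1,
      (∫ r in Set.Ioi (0 : ℝ), r ^ (Module.finrank ℝ F - 1) • f (r • (ω : F))) ∂μ.toSphere := by
  simp only [← integral_volumeIoiPow]
  rw [← integral_prod _ (integrable_comp_polar hf),
    ← μ.measurePreserving_homeomorphUnitSphereProd.integral_comp
      (homeomorphUnitSphereProd F).measurableEmbedding]
  simp only [smul_homeomorphUnitSphereProd]
  rw [integral_subtype_comap (measurableSet_singleton _).compl, restrict_compl_singleton]

end PolarCoordinates

section PoissonKernel

variable {ε M : ℝ} {q : ℝ → ℝ}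

/-- The Poisson kernel `ε / (λ² + ε²)` of the half-plane at `λ = r² - 1`, an approximation of
`π δ(r² - 1)`. -/
def poissonKernel (ε r : ℝ) : ℝ := ε / ((r ^ 2 - 1) ^ 2 + ε ^ 2)

lemma poissonKernel_nonneg (hε : 0 < ε) (r : ℝ) : 0 ≤ poissonKernel ε r := by
  unfold poissonKernel
  positivity

lemma poissonKernel_le (hε : 0 < ε) (r : ℝ) : poissonKernel ε r ≤ ε⁻¹ := by
  rw [poissonKernel, ← one_div, div_le_div_iff₀ (by positivity) hε]
  nlinarith [sq_nonneg (r ^ 2 - 1)]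

lemma continuous_poissonKernel (hε : 0 < ε) : Continuous (poissonKernel ε) :=
  continuous_const.div (by fun_prop) fun r => by positivity

lemma mul_poissonKernel_one_add_mul (hε : 0 < ε) (t : ℝ) :
    ε * poissonKernel ε (1 + ε * t) = (1 + t ^ 2 * (2 + ε * t) ^ 2)⁻¹ := by
  have hden : ((1 + ε * t) ^ 2 - 1) ^ 2 + ε ^ 2 = ε ^ 2 * (1 + t ^ 2 * (2 + ε * t) ^ 2) := by ring
  rw [poissonKernel, hden]
  field_simp

lemma integral_Ioi_mul_poissonKernel (hε : 0 < ε) (q : ℝ → ℝ) :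
    ∫ r in Set.Ioi (0 : ℝ), q r * poissonKernel ε r =
      ∫ t, (1 + t ^ 2 * (2 + ε * t) ^ 2)⁻¹ * (Set.Ioi (0 : ℝ)).indicator q (1 + ε * t) := by
  have hscale := Measure.integral_comp_mul_left
    (fun r => (Set.Ioi (0 : ℝ)).indicator q (1 + r) * poissonKernel ε (1 + r)) ε
  rw [integral_add_left_eq_self fun r => (Set.Ioi (0 : ℝ)).indicator q r * poissonKernel ε r,
    abs_of_pos (inv_pos.2 hε), smul_eq_mul, eq_inv_mul_iff_mul_eq₀ hε.ne',
    ← integral_const_mul] at hscale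
  simp only [← mul_poissonKernel_one_add_mul hε]
  rw [← integral_indicator measurableSet_Ioi]
  simp only [Set.indicator_mul_left]
  rw [← hscale]
  congr 1 with t
  ring

lemma norm_inv_mul_indicator_le (hM : ∀ r, 0 < r → |q r| ≤ M) (ε t : ℝ) :
    ‖(1 + t ^ 2 * (2 + ε * t) ^ 2)⁻¹ * (Set.Ioi (0 : ℝ)).indicator q (1 + ε * t)‖ ≤
      M * (1 + t ^ 2)⁻¹ := by
  by_cases h : 0 < 1 + ε * t
  · have hden : 1 + t ^ 2 ≤ 1 + t ^ 2 * (2 + ε * t) ^ 2 := by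
      nlinarith [mul_nonneg (sq_nonneg t) (by nlinarith : 0 ≤ (2 + ε * t) ^ 2 - 1)]
    rw [Set.indicator_of_mem (Set.mem_Ioi.2 h), norm_mul, Real.norm_of_nonneg (by positivity),
      mul_comm]
    exact mul_le_mul (hM _ h) (inv_anti₀ (by positivity) hden) (by positivity)
      ((abs_nonneg _).trans (hM _ h))
  · rw [Set.indicator_of_notMem (mt Set.mem_Ioi.1 h), mul_zero, norm_zero]
    exact mul_nonneg ((abs_nonneg _).trans (hM 1 one_pos)) (by positivity)

theorem abs_integral_Ioi_mul_poissonKernel_le (hε : 0 < ε) (hM : ∀ r, 0 < r → |q r| ≤ M) :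
    |∫ r in Set.Ioi (0 : ℝ), q r * poissonKernel ε r| ≤ M * Real.pi := by
  rw [integral_Ioi_mul_poissonKernel hε, ← integral_univ_inv_one_add_sq, ← integral_const_mul,
    ← Real.norm_eq_abs]
  exact norm_integral_le_of_norm_le (integrable_inv_one_add_sq.const_mul M)
    (ae_of_all _ (norm_inv_mul_indicator_le hM ε))

lemma tendsto_inv_mul_indicator (hq : ContinuousAt q 1) (t : ℝ) :
    Tendsto (fun ε : ℝ => (1 + t ^ 2 * (2 + ε * t) ^ 2)⁻¹ *
      (Set.Ioi (0 : ℝ)).indicator q (1 + ε * t)) (𝓝 0) (𝓝 ((1 + (2 * t) ^ 2)⁻¹ * q 1)) := by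
  have harg : Tendsto (fun ε : ℝ => 1 + ε * t) (𝓝 0) (𝓝 1) :=
    Continuous.tendsto' (by fun_prop) _ _ (by ring)
  have hkernel : Tendsto (fun ε : ℝ => (1 + t ^ 2 * (2 + ε * t) ^ 2)⁻¹) (𝓝 0)
      (𝓝 (1 + (2 * t) ^ 2)⁻¹) :=
    Continuous.tendsto' (Continuous.inv₀ (by fun_prop) fun ε => by positivity) _ _
      (by simp only [Pi.inv_apply]; ring)
  refine (hkernel.mul (hq.tendsto.comp harg)).congr' ?_
  filter_upwards [harg.eventually (lt_mem_nhds one_pos)] with ε hε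
  rw [Set.indicator_of_mem (Set.mem_Ioi.2 hε), Function.comp_apply]

lemma integral_inv_one_add_two_mul_sq : ∫ t : ℝ, (1 + (2 * t) ^ 2)⁻¹ = Real.pi / 2 := by
  rw [Measure.integral_comp_mul_left fun t : ℝ => (1 + t ^ 2)⁻¹, integral_univ_inv_one_add_sq,
    abs_of_pos (by norm_num), smul_eq_mul]
  ring

theorem tendsto_integral_Ioi_mul_poissonKernel (hq : Continuous q)
    (hM : ∀ r, 0 < r → |q r| ≤ M) :
    Tendsto (fun ε => ∫ r in Set.Ioi (0 : ℝ), q r * poissonKernel ε r) (𝓝[>] 0)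
      (𝓝 (Real.pi / 2 * q 1)) := by
  rw [← integral_inv_one_add_two_mul_sq, ← integral_mul_const]
  refine Tendsto.congr' ?_ (tendsto_integral_filter_of_dominated_convergence
    (fun t => M * (1 + t ^ 2)⁻¹) (Eventually.of_forall fun ε => ?_)
    (Eventually.of_forall fun ε => ae_of_all _ (norm_inv_mul_indicator_le hM ε))
    (integrable_inv_one_add_sq.const_mul M) (ae_of_all _ fun t =>
      (tendsto_inv_mul_indicator hq.continuousAt t).mono_left nhdsWithin_le_nhds))
  · filter_upwards [self_mem_nhdsWithin] with ε hε
    exact (integral_Ioi_mul_poissonKernel hε q).symm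
  · exact (Measurable.mul (by fun_prop) ((hq.measurable.indicator measurableSet_Ioi).comp
      (by fun_prop))).aestronglyMeasurable

variable {V : Type*} [NormedAddCommGroup V] [MeasurableSpace V] [BorelSpace V] {μ : Measure V}
  {g : V → ℝ}

lemma integrable_mul_poissonKernel_norm (hε : 0 < ε) (hgi : Integrable g μ) :
    Integrable (fun z => g z * poissonKernel ε ‖z‖) μ := by
  refine hgi.mul_bdd (c := ε⁻¹)
    ((continuous_poissonKernel hε).measurable.comp measurable_norm).aestronglyMeasurable
    (ae_of_all _ fun z => ?_)
  rw [Real.norm_of_nonneg (poissonKernel_nonneg hε _)]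
  exact poissonKernel_le hε _

variable [NormedSpace ℝ V] [FiniteDimensional ℝ V] [Nontrivial V] [μ.IsAddHaarMeasure]

theorem tendsto_integral_mul_poissonKernel_norm (hg : Continuous g) (hgi : Integrable g μ)
    (hM : ∀ z, ‖z‖ ^ (Module.finrank ℝ V - 1) * |g z| ≤ M) :
    Tendsto (fun ε => ∫ z, g z * poissonKernel ε ‖z‖ ∂μ) (𝓝[>] 0)
      (𝓝 (Real.pi / 2 * ∫ ω : Metric.sphere (0 : V) 1, g ω ∂μ.toSphere)) := by
  set q : Metric.sphere (0 : V) 1 → ℝ → ℝ :=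
    fun ω r => r ^ (Module.finrank ℝ V - 1) * g (r • (ω : V)) with hq
  have hqM (ω : Metric.sphere (0 : V) 1) (r : ℝ) (hr : 0 < r) : |q ω r| ≤ M := by
    simpa only [hq, norm_smul, norm_eq_of_mem_sphere, mul_one, Real.norm_of_nonneg hr.le, abs_mul,
      abs_of_pos (pow_pos hr (Module.finrank ℝ V - 1))] using hM (r • (ω : V))
  have hradial (ε : ℝ) (ω : Metric.sphere (0 : V) 1) :
      ∫ r in Set.Ioi (0 : ℝ), r ^ (Module.finrank ℝ V - 1) •
        (g (r • (ω : V)) * poissonKernel ε ‖r • (ω : V)‖) =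
      ∫ r in Set.Ioi (0 : ℝ), q ω r * poissonKernel ε r := by
    refine setIntegral_congr_fun measurableSet_Ioi fun r (hr : 0 < r) => ?_
    simp only [hq, norm_smul, norm_eq_of_mem_sphere, mul_one, Real.norm_of_nonneg hr.le, mul_assoc,
      smul_eq_mul]
  have hlim (ω : Metric.sphere (0 : V) 1) : Tendsto (fun ε => ∫ r in Set.Ioi (0 : ℝ),
      q ω r * poissonKernel ε r) (𝓝[>] 0) (𝓝 (Real.pi / 2 * g ω)) := by
    simpa only [hq, one_pow, one_mul, one_smul] using
      tendsto_integral_Ioi_mul_poissonKernel (q := q ω) (by fun_prop) (hqM ω)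
  rw [← integral_const_mul]
  refine Tendsto.congr' ?_ (tendsto_integral_filter_of_dominated_convergence
    (fun _ => M * Real.pi) ?_ ?_ (integrable_const _) (ae_of_all _ hlim))
  · filter_upwards [self_mem_nhdsWithin] with ε hε
    simp only [integral_eq_integral_polar (integrable_mul_poissonKernel_norm hε hgi), hradial]
  · filter_upwards [self_mem_nhdsWithin] with ε hε
    simpa only [hradial] using
      (integrable_integral_polar (integrable_mul_poissonKernel_norm hε hgi)).1
  · filter_upwards [self_mem_nhdsWithin] with ε hε
    exact ae_of_all _ fun ω => abs_integral_Ioi_mul_poissonKernel_le hε (hqM ω)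

end PoissonKernel

section ResolventForm

variable {V : Type*} [NormedAddCommGroup V] {ε : ℝ}

lemma norm_symb_sq (ε : ℝ) (z : V) :
    ‖symb ε z‖ ^ 2 = ((2 * Real.pi * ‖z‖) ^ 2 - 1) ^ 2 + ε ^ 2 := by
  rw [← Complex.normSq_eq_norm_sq, Complex.normSq_apply, symb_re, symb_im]
  ring

lemma poissonKernel_eq_div_norm_symb_sq (ε : ℝ) (z : V) :
    poissonKernel ε (2 * Real.pi * ‖z‖) = ε / ‖symb ε z‖ ^ 2 := by
  rw [norm_symb_sq, poissonKernel]

lemma inv_symb_re (ε : ℝ) (z : V) :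
    ((symb ε z)⁻¹).re = poissonKernel ε (2 * Real.pi * ‖z‖) := by
  rw [Complex.inv_re, symb_re, Complex.normSq_eq_norm_sq, poissonKernel_eq_div_norm_symb_sq]

lemma hasDerivAt_inv_symb (hε : 0 < ε) (z : V) :
    HasDerivAt (fun x : ℝ => (symb x z)⁻¹) (-(symb ε z ^ 2)⁻¹) ε := by
  have h : HasDerivAt (fun x : ℝ => symb x z) 1 ε :=
    (HasDerivAt.ofReal_comp (hasDerivAt_id ε)).add_const _
  simpa only [neg_div, one_div] using h.fun_inv (symb_ne_zero hε z)

variable [InnerProductSpace ℝ V]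

lemma exists_norm_pow_mul_norm_sq_le (φ : 𝓢(V, ℂ)) (m : ℕ) :
    ∃ M, ∀ z, ‖z‖ ^ m * ‖φ z‖ ^ 2 ≤ M := by
  refine ⟨SchwartzMap.seminorm ℝ m 0 φ * SchwartzMap.seminorm ℝ 0 0 φ, fun z => ?_⟩
  rw [pow_two, ← mul_assoc]
  exact mul_le_mul (SchwartzMap.norm_pow_mul_le_seminorm ℝ φ m z)
    (SchwartzMap.norm_le_seminorm ℝ φ z) (norm_nonneg _) (apply_nonneg _ _)

variable [FiniteDimensional ℝ V] [MeasurableSpace V] [BorelSpace V]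

lemma integrable_norm_sq_schwartz (φ : 𝓢(V, ℂ)) : Integrable fun z => ‖φ z‖ ^ 2 :=
  (φ.memLp 2 volume).integrable_norm_pow two_ne_zero

/-- The quadratic form `∫ |𝓕 φ|² / (ε + i (|ξ|² - 1))` of the regularised resolvent. -/
def resolventForm (φ : 𝓢(V, ℂ)) (ε : ℝ) : ℂ := ∫ z, (symb ε z)⁻¹ * ((‖𝓕 φ z‖ ^ 2 : ℝ) : ℂ)

lemma integrable_inv_symb_mul (φ : 𝓢(V, ℂ)) (hε : 0 < ε) :
    Integrable fun z => (symb ε z)⁻¹ * ((‖𝓕 φ z‖ ^ 2 : ℝ) : ℂ) := by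
  refine (integrable_norm_sq_schwartz (𝓕 φ)).ofReal.bdd_mul (c := ε⁻¹)
    ((continuous_symb ε).inv₀ (symb_ne_zero hε)).aestronglyMeasurable (ae_of_all _ fun z => ?_)
  rw [norm_inv]
  exact inv_anti₀ hε (le_norm_symb ε z)

lemma re_resolventForm (φ : 𝓢(V, ℂ)) (hε : 0 < ε) :
    (resolventForm φ ε).re = ∫ z, ‖𝓕 φ z‖ ^ 2 * poissonKernel ε (2 * Real.pi * ‖z‖) := by
  rw [resolventForm, ← RCLike.re_to_complex, ← integral_re (integrable_inv_symb_mul φ hε)]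
  simp only [RCLike.re_to_complex, Complex.re_mul_ofReal, inv_symb_re, mul_comm]

lemma re_resolventForm_eq_mul_integral (φ : 𝓢(V, ℂ)) (hε : 0 < ε) :
    (resolventForm φ ε).re = ε * ∫ z, ‖𝓕 φ z‖ ^ 2 / ‖symb ε z‖ ^ 2 := by
  rw [re_resolventForm φ hε, ← integral_const_mul]
  congr 1 with z
  rw [poissonKernel_eq_div_norm_symb_sq, mul_div_left_comm]

theorem hasDerivAt_resolventForm (φ : 𝓢(V, ℂ)) (hε : 0 < ε) :
    HasDerivAt (resolventForm φ) (-powForm ε 2 φ (fun x => starRingEnd ℂ (φ x))) ε := by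
  have hball {x : ℝ} (hx : x ∈ Metric.ball ε (ε / 2)) : ε / 2 < x := by
    rw [Metric.mem_ball, Real.dist_eq, abs_lt] at hx
    linarith [hx.1]
  rw [powForm_two_conj, ← integral_neg]
  refine (hasDerivAt_integral_of_dominated_loc_of_deriv_le (μ := volume)
    (F' := fun (x : ℝ) z => -((symb x z ^ 2)⁻¹ * ((‖𝓕 φ z‖ ^ 2 : ℝ) : ℂ)))
    (bound := fun z => ((ε / 2) ^ 2)⁻¹ * ‖𝓕 φ z‖ ^ 2) (Metric.ball_mem_nhds ε (half_pos hε))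
    ?_ (integrable_inv_symb_mul φ hε) ?_ (ae_of_all _ fun z x hx => ?_)
    ((integrable_norm_sq_schwartz (𝓕 φ)).const_mul _) (ae_of_all _ fun z x hx => ?_)).2
  · filter_upwards [lt_mem_nhds hε] with x hx
    exact (integrable_inv_symb_mul φ hx).aestronglyMeasurable
  · exact ((((continuous_symb ε).pow 2).inv₀ fun z => pow_ne_zero 2 (symb_ne_zero hε z)).mul
      (by fun_prop)).neg.aestronglyMeasurable
  · have hle := (hball hx).le.trans (le_norm_symb x z)
    rw [norm_neg, norm_mul, norm_inv, norm_pow, Complex.norm_real,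
      Real.norm_of_nonneg (by positivity)]
    gcongr
  · rw [← neg_mul]
    exact (hasDerivAt_inv_symb ((half_pos hε).trans (hball hx)) z).mul_const _

/-- The quantity `π / (2 (2π)ᵈ) ∫_{𝕊} |φ̂|²`, which is the limit of `re (resolventForm φ ε)` as
`ε → 0`. The trace of `φ̂` on the unit sphere is that of `𝓕 φ` on the sphere of radius `1 / 2π`. -/
def traceEnergy (φ : 𝓢(V, ℂ)) : ℝ :=
  ((2 * Real.pi) ^ Module.finrank ℝ V)⁻¹ * (Real.pi / 2 *
    ∫ ω : Metric.sphere (0 : V) 1, ‖𝓕 φ ((2 * Real.pi)⁻¹ • (ω : V))‖ ^ 2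
      ∂(volume : Measure V).toSphere)

theorem tendsto_re_resolventForm [Nontrivial V] (φ : 𝓢(V, ℂ)) :
    Tendsto (fun ε => (resolventForm φ ε).re) (𝓝[>] 0) (𝓝 (traceEnergy φ)) := by
  have hπ : 0 < 2 * Real.pi := Real.two_pi_pos
  obtain ⟨M, hM⟩ := exists_norm_pow_mul_norm_sq_le (𝓕 φ) (Module.finrank ℝ V - 1)
  have hlim := (tendsto_integral_mul_poissonKernel_norm (μ := (volume : Measure V))
    (g := fun ξ => ‖𝓕 φ ((2 * Real.pi)⁻¹ • ξ)‖ ^ 2)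
    (M := (2 * Real.pi) ^ (Module.finrank ℝ V - 1) * M) (by fun_prop)
    ((integrable_norm_sq_schwartz (𝓕 φ)).comp_smul (inv_ne_zero hπ.ne')) fun ξ => ?_).const_mul
      ((2 * Real.pi) ^ Module.finrank ℝ V)⁻¹
  · refine hlim.congr' ?_
    filter_upwards [self_mem_nhdsWithin] with ε hε
    rw [re_resolventForm φ hε, ← smul_eq_mul,
      ← Measure.integral_comp_smul_of_nonneg volume _ _ (hR := hπ.le)]
    simp only [inv_smul_smul₀ hπ.ne', norm_smul, Real.norm_of_nonneg hπ.le]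
  · refine le_of_eq_of_le ?_ (mul_le_mul_of_nonneg_left (hM ((2 * Real.pi)⁻¹ • ξ))
      (pow_nonneg hπ.le (Module.finrank ℝ V - 1)))
    rw [abs_of_nonneg (by positivity), ← mul_assoc, ← mul_pow, norm_smul, norm_inv,
      Real.norm_of_nonneg hπ.le, mul_inv_cancel_left₀ hπ.ne']

theorem integral_norm_fourier_sq_div_le [Nontrivial V] {A : ℝ} (φ : 𝓢(V, ℂ))
    (hA : ∀ ε : ℝ, 0 < ε → ε ≤ 1 → ‖powForm ε 2 φ (fun x => starRingEnd ℂ (φ x))‖ ≤ A)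
    (hε : 0 < ε) (hε1 : ε ≤ 1) :
    ∫ z, ‖𝓕 φ z‖ ^ 2 / ‖symb ε z‖ ^ 2 ≤ ε⁻¹ * traceEnergy φ + A := by
  have hlip (η : ℝ) (hη : 0 < η) (hηε : η ≤ ε) :
      (resolventForm φ ε).re ≤ (resolventForm φ η).re + ε * A := by
    have hnorm := (convex_Icc η ε).norm_image_sub_le_of_norm_hasDerivWithin_le
      (fun x hx => (hasDerivAt_resolventForm φ (hη.trans_le hx.1)).hasDerivWithinAt)
      (fun x hx => by rw [norm_neg]; exact hA x (hη.trans_le hx.1) (hx.2.trans hε1))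
      (Set.left_mem_Icc.2 hηε) (Set.right_mem_Icc.2 hηε)
    have hre := (Complex.re_le_norm _).trans hnorm
    rw [Complex.sub_re, Real.norm_of_nonneg (by linarith)] at hre
    nlinarith [(norm_nonneg _).trans (hA ε hε hε1)]
  have hlim : (resolventForm φ ε).re ≤ traceEnergy φ + ε * A := by
    refine ge_of_tendsto ((tendsto_re_resolventForm φ).add_const (ε * A)) ?_
    filter_upwards [Ioc_mem_nhdsGT hε] with η hη using hlip η hη.1 hη.2
  rw [re_resolventForm_eq_mul_integral φ hε] at hlim
  rw [← mul_le_mul_iff_right₀ hε, mul_add, mul_inv_cancel_left₀ hε.ne']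
  exact hlim

end ResolventForm

section SphereTrace

variable {n : ℕ}

lemma fourier_eq_fourierTransform_smul (φ : 𝓢(Space n, ℂ)) (ξ : Space n) :
    fourier φ ξ = 𝓕 φ ((2 * Real.pi)⁻¹ • ξ) := by
  have hπ : (Real.pi : ℂ) ≠ 0 := Complex.ofReal_ne_zero.2 Real.pi_ne_zero
  rw [SchwartzMap.fourier_coe, Real.fourier_eq', fourier]
  congr 1 with x
  rw [smul_eq_mul, inner_smul_right, real_inner_comm ξ x]
  congr 2
  push_cast
  field_simp

lemma traceEnergy_eq (φ : 𝓢(Space n, ℂ)) :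
    traceEnergy φ = ((2 * Real.pi) ^ n)⁻¹ * (Real.pi / 2 *
      (eLpNorm (fun ω : UnitSphere n => fourier φ ω) 2 (surfaceMeasure n)).toReal ^ 2) := by
  have hcont : Continuous fun ω : UnitSphere n => fourier φ ω := by
    simp only [fourier_eq_fourierTransform_smul]
    fun_prop
  have hsq := integral_norm_rpow_eq_toReal_eLpNorm_rpow (μ := surfaceMeasure n) two_pos
    (hcont.memLp_of_hasCompactSupport (HasCompactSupport.of_compactSpace _))
  simp only [Real.rpow_two, ENNReal.ofReal_ofNat] at hsq
  rw [traceEnergy, finrank_euclideanSpace_fin, ← hsq]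
  simp only [fourier_eq_fourierTransform_smul]

end SphereTrace

/-! ### A priori estimate for the Helmholtz operator -/

section HelmholtzOperator

lemma sq_integral_mul_le_of_nonneg {α : Type*} [MeasurableSpace α] {μ : Measure α} {f g : α → ℝ}
    (hf0 : 0 ≤ f) (hg0 : 0 ≤ g) (hf : MemLp f 2 μ) (hg : MemLp g 2 μ) :
    (∫ x, f x * g x ∂μ) ^ 2 ≤ (∫ x, f x ^ 2 ∂μ) * ∫ x, g x ^ 2 ∂μ := by
  have hcs := integral_mul_le_Lp_mul_Lq_of_nonneg Real.HolderConjugate.two_two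
    (ae_of_all μ hf0) (ae_of_all μ hg0) (by rwa [ENNReal.ofReal_ofNat])
    (by rwa [ENNReal.ofReal_ofNat])
  simp only [Real.rpow_two, ← Real.sqrt_eq_rpow] at hcs
  refine (pow_le_pow_left₀ (integral_nonneg fun x => mul_nonneg (hf0 x) (hg0 x)) hcs 2).trans_eq ?_
  rw [mul_pow, Real.sq_sqrt (integral_nonneg fun x => sq_nonneg _),
    Real.sq_sqrt (integral_nonneg fun x => sq_nonneg _)]

variable {V : Type*} [NormedAddCommGroup V] [InnerProductSpace ℝ V] [FiniteDimensional ℝ V]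

/-- The Helmholtz operator `-Δ - 1` on Schwartz functions. -/
def helmholtz : 𝓢(V, ℂ) →ₗ[ℂ] 𝓢(V, ℂ) :=
  -(LineDeriv.laplacianCLM ℂ V 𝓢(V, ℂ)).toLinearMap - LinearMap.id

lemma helmholtz_apply (ψ : 𝓢(V, ℂ)) : helmholtz ψ = -(Δ ψ) - ψ := by
  simp [helmholtz, SchwartzMap.laplacianCLM_eq]

variable [MeasurableSpace V] [BorelSpace V] {ε : ℝ}

lemma fourier_helmholtz (ψ : 𝓢(V, ℂ)) (z : V) :
    𝓕 (helmholtz ψ) z = (((2 * Real.pi * ‖z‖) ^ 2 - 1 : ℝ) : ℂ) * 𝓕 ψ z := by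
  have hgrowth : Function.HasTemperateGrowth fun x : V => ‖x‖ ^ 2 := by fun_prop
  have hfourier : 𝓕 (helmholtz ψ) = (((2 * Real.pi) ^ 2 : ℝ) : ℂ) •
      SchwartzMap.smulLeftCLM ℂ (fun x : V => ‖x‖ ^ 2) (𝓕 ψ) - 𝓕 ψ := by
    rw [helmholtz_apply, SchwartzMap.laplacian_eq_fourierMultiplierCLM,
      SchwartzMap.fourierMultiplierCLM_apply, neg_smul, neg_neg, ← Complex.coe_smul,
      ← fourierCLM_apply (R := ℂ), map_sub, map_smul, fourierCLM_apply, fourierCLM_apply,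
      fourier_fourierInv_eq]
  rw [hfourier, sub_apply, smul_apply, SchwartzMap.smulLeftCLM_apply_apply hgrowth, smul_eq_mul,
    Complex.real_smul]
  push_cast
  ring

lemma fourierInv_helmholtz (ψ : 𝓢(V, ℂ)) (z : V) :
    𝓕⁻ (helmholtz ψ) z = (((2 * Real.pi * ‖z‖) ^ 2 - 1 : ℝ) : ℂ) * 𝓕⁻ ψ z := by
  have hneg (χ : 𝓢(V, ℂ)) : 𝓕⁻ χ z = 𝓕 χ (-z) := by
    rw [SchwartzMap.fourierInv_coe, SchwartzMap.fourier_coe, Real.fourierInv_eq_fourier_neg]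
  rw [hneg, hneg, fourier_helmholtz, norm_neg]

lemma sq_norm_symb_mul_norm_fourierInv (ε : ℝ) (ψ : 𝓢(V, ℂ)) (z : V) :
    (‖symb ε z‖ * ‖𝓕⁻ ψ z‖) ^ 2 = ‖𝓕⁻ (helmholtz ψ) z‖ ^ 2 + ε ^ 2 * ‖𝓕⁻ ψ z‖ ^ 2 := by
  rw [fourierInv_helmholtz, norm_mul, mul_pow, mul_pow, norm_symb_sq, Complex.norm_real,
    Real.norm_eq_abs, sq_abs, add_mul]

lemma integral_norm_sq_fourierInv (ψ : 𝓢(V, ℂ)) : ∫ z, ‖𝓕⁻ ψ z‖ ^ 2 = ‖ψ.toLp 2‖ ^ 2 := by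
  have hsq := integral_norm_rpow_eq_toReal_eLpNorm_rpow two_pos (ψ.memLp (ENNReal.ofReal 2) volume)
  simp only [Real.rpow_two, ENNReal.ofReal_ofNat] at hsq
  rw [SchwartzMap.norm_toLp, ← hsq, ← SchwartzMap.integral_norm_sq_fourier (𝓕⁻ ψ),
    fourier_fourierInv_eq]

lemma integral_sq_norm_symb_mul_norm_fourierInv (ε : ℝ) (ψ : 𝓢(V, ℂ)) :
    ∫ z, (‖symb ε z‖ * ‖𝓕⁻ ψ z‖) ^ 2 = ‖(helmholtz ψ).toLp 2‖ ^ 2 + ε ^ 2 * ‖ψ.toLp 2‖ ^ 2 := by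
  simp only [sq_norm_symb_mul_norm_fourierInv]
  rw [integral_add (integrable_norm_sq_schwartz _) ((integrable_norm_sq_schwartz _).const_mul _),
    integral_const_mul, integral_norm_sq_fourierInv, integral_norm_sq_fourierInv]

lemma memLp_norm_symb_mul_norm_fourierInv (ε : ℝ) (ψ : 𝓢(V, ℂ)) :
    MemLp (fun z => ‖symb ε z‖ * ‖𝓕⁻ ψ z‖) 2 := by
  have hcont : Continuous fun z => ‖symb ε z‖ * ‖𝓕⁻ ψ z‖ :=
    (continuous_symb ε).norm.mul (𝓕⁻ ψ).continuous.norm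
  rw [memLp_two_iff_integrable_sq hcont.aestronglyMeasurable]
  simp only [sq_norm_symb_mul_norm_fourierInv]
  exact (integrable_norm_sq_schwartz _).add ((integrable_norm_sq_schwartz _).const_mul _)

lemma memLp_norm_fourier_div_norm_symb (hε : 0 < ε) (φ : 𝓢(V, ℂ)) :
    MemLp (fun z => ‖𝓕 φ z‖ / ‖symb ε z‖) 2 := by
  refine (((𝓕 φ).memLp 2 volume).norm.const_mul ε⁻¹).mono'
    ((𝓕 φ).continuous.norm.div (continuous_symb ε).norm fun z =>
      norm_ne_zero_iff.2 (symb_ne_zero hε z)).aestronglyMeasurable (ae_of_all _ fun z => ?_)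
  rw [Real.norm_of_nonneg (by positivity), inv_mul_eq_div]
  exact div_le_div_of_nonneg_left (norm_nonneg _) hε (le_norm_symb ε z)

lemma norm_integral_mul_le (hε : 0 < ε) (φ ψ : 𝓢(V, ℂ)) :
    ‖∫ x, ψ x * φ x‖ ≤ ∫ z, ‖𝓕 φ z‖ / ‖symb ε z‖ * (‖symb ε z‖ * ‖𝓕⁻ ψ z‖) := by
  have hplancherel : ∫ x, ψ x * φ x = ∫ z, 𝓕 φ z * 𝓕⁻ ψ z := by
    simp only [SchwartzMap.integral_fourier_mul_eq, fourier_fourierInv_eq, mul_comm]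
  rw [hplancherel]
  refine (norm_integral_le_integral_norm _).trans_eq ?_
  congr 1 with z
  rw [norm_mul, ← mul_assoc, div_mul_cancel₀ _ (norm_ne_zero_iff.2 (symb_ne_zero hε z))]

theorem norm_integral_mul_sq_le (hε : 0 < ε) (φ ψ : 𝓢(V, ℂ)) :
    ‖∫ x, ψ x * φ x‖ ^ 2 ≤ (∫ z, ‖𝓕 φ z‖ ^ 2 / ‖symb ε z‖ ^ 2) *
      (‖(helmholtz ψ).toLp 2‖ ^ 2 + ε ^ 2 * ‖ψ.toLp 2‖ ^ 2) := by
  refine (pow_le_pow_left₀ (norm_nonneg _) (norm_integral_mul_le hε φ ψ) 2).trans ?_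
  refine (sq_integral_mul_le_of_nonneg (fun z => by positivity) (fun z => by positivity)
    (memLp_norm_fourier_div_norm_symb hε φ) (memLp_norm_symb_mul_norm_fourierInv ε ψ)).trans_eq ?_
  simp only [integral_sq_norm_symb_mul_norm_fourierInv, div_pow]

end HelmholtzOperator

section VanishingTrace

variable {V : Type*} [NormedAddCommGroup V] [InnerProductSpace ℝ V] [FiniteDimensional ℝ V]
  [MeasurableSpace V] [BorelSpace V] {p : ℝ≥0∞} [Fact (1 ≤ p)]

lemma tendsto_integral_mul_of_tendsto_toLp {φ : ℕ → 𝓢(V, ℂ)} {f : Lp ℂ p (volume : Measure V)}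
    (hφ : Tendsto (fun k => (φ k).toLp p volume) atTop (𝓝 f)) (ψ : 𝓢(V, ℂ)) :
    Tendsto (fun k => ∫ x, ψ x * φ k x) atTop (𝓝 (Lp.toTemperedDistribution f ψ)) := by
  have hcont : Continuous fun g : Lp ℂ p (volume : Measure V) => Lp.toTemperedDistribution g ψ :=
    (PointwiseConvergenceCLM.evalCLM (RingHom.id ℂ) ℂ ψ).continuous.comp
      (Lp.toTemperedDistributionCLM ℂ volume p).continuous
  refine ((hcont.tendsto f).comp hφ).congr fun k => ?_
  rw [Function.comp_apply, Lp.toTemperedDistribution_toLp_eq]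
  exact SchwartzMap.toTemperedDistributionCLM_apply_apply volume (φ k) ψ

variable [Nontrivial V] {A : ℝ} {φ : ℕ → 𝓢(V, ℂ)} {f : Lp ℂ p (volume : Measure V)}

lemma norm_toTemperedDistribution_sq_le {ε : ℝ}
    (hA : ∀ ε : ℝ, 0 < ε → ε ≤ 1 → ∀ φ : 𝓢(V, ℂ),
      ‖powForm ε 2 φ (fun x => starRingEnd ℂ (φ x))‖ ≤ A * ‖φ.toLp p volume‖ ^ 2)
    (hφ : Tendsto (fun k => (φ k).toLp p volume) atTop (𝓝 f))
    (htrace : Tendsto (fun k => traceEnergy (φ k)) atTop (𝓝 0)) (ψ : 𝓢(V, ℂ))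
    (hε : 0 < ε) (hε1 : ε ≤ 1) :
    ‖Lp.toTemperedDistribution f ψ‖ ^ 2 ≤
      A * ‖f‖ ^ 2 * (‖(helmholtz ψ).toLp 2‖ ^ 2 + ε ^ 2 * ‖ψ.toLp 2‖ ^ 2) := by
  have hbound := ((htrace.const_mul ε⁻¹).add ((hφ.norm.pow 2).const_mul A)).mul_const
    (‖(helmholtz ψ).toLp 2‖ ^ 2 + ε ^ 2 * ‖ψ.toLp 2‖ ^ 2)
  rw [mul_zero, zero_add] at hbound
  refine le_of_tendsto_of_tendsto' ((tendsto_integral_mul_of_tendsto_toLp hφ ψ).norm.pow 2) hbound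
    fun k => (norm_integral_mul_sq_le hε (φ k) ψ).trans ?_
  gcongr
  exact integral_norm_fourier_sq_div_le (φ k) (fun η hη hη1 => hA η hη hη1 (φ k)) hε hε1

theorem norm_toTemperedDistribution_le
    (hA : ∀ ε : ℝ, 0 < ε → ε ≤ 1 → ∀ φ : 𝓢(V, ℂ),
      ‖powForm ε 2 φ (fun x => starRingEnd ℂ (φ x))‖ ≤ A * ‖φ.toLp p volume‖ ^ 2)
    (hφ : Tendsto (fun k => (φ k).toLp p volume) atTop (𝓝 f))
    (htrace : Tendsto (fun k => traceEnergy (φ k)) atTop (𝓝 0)) (ψ : 𝓢(V, ℂ)) :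
    ‖Lp.toTemperedDistribution f ψ‖ ≤ √A * ‖f‖ * ‖(helmholtz ψ).toLp 2‖ := by
  have hlim : Tendsto (fun ε : ℝ => A * ‖f‖ ^ 2 *
      (‖(helmholtz ψ).toLp 2‖ ^ 2 + ε ^ 2 * ‖ψ.toLp 2‖ ^ 2)) (𝓝[>] 0)
      (𝓝 (A * (‖f‖ * ‖(helmholtz ψ).toLp 2‖) ^ 2)) := by
    refine (Continuous.tendsto' (by fun_prop) 0 _ ?_).mono_left nhdsWithin_le_nhds
    ring
  have hsq : ‖Lp.toTemperedDistribution f ψ‖ ^ 2 ≤ A * (‖f‖ * ‖(helmholtz ψ).toLp 2‖) ^ 2 := by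
    refine ge_of_tendsto hlim ?_
    filter_upwards [Ioc_mem_nhdsGT (zero_lt_one' ℝ)] with ε hε
    exact norm_toTemperedDistribution_sq_le hA hφ htrace ψ hε.1 hε.2
  refine (Real.le_sqrt_of_sq_le hsq).trans_eq ?_
  rw [Real.sqrt_mul' _ (sq_nonneg _), Real.sqrt_sq (mul_nonneg (norm_nonneg _) (norm_nonneg _)),
    mul_assoc]

end VanishingTrace

section SphereTraceLimit

variable {n : ℕ} {p : ℝ≥0∞} [Fact (1 ≤ p)]

lemma exists_tendsto_traceEnergy_zero {f : Lp ℂ p (volume : Measure (Space n))}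
    (hf : FourierVanishesOnSphere f) :
    ∃ φ : ℕ → 𝓢(Space n, ℂ), Tendsto (fun k => (φ k).toLp p volume) atTop (𝓝 f) ∧
      Tendsto (fun k => traceEnergy (φ k)) atTop (𝓝 0) := by
  obtain ⟨-, φ, hφ, htrace⟩ := hf
  refine ⟨φ, hφ, ?_⟩
  simp only [sub_zero] at htrace
  have hzero := (((((ENNReal.tendsto_toReal ENNReal.zero_ne_top).comp htrace).pow 2).const_mul
    (Real.pi / 2)).const_mul ((2 * Real.pi) ^ n)⁻¹)
  simpa [traceEnergy_eq] using hzero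

end SphereTraceLimit

/-! ### Duality -/

section Duality

variable {V : Type*} [NormedAddCommGroup V] [InnerProductSpace ℝ V] [FiniteDimensional ℝ V]
  [MeasurableSpace V] [BorelSpace V]

/-- The Helmholtz operator on Schwartz functions, with values in `L²`. -/
def helmholtzL2 : 𝓢(V, ℂ) →ₗ[ℂ] Lp ℂ 2 (volume : Measure V) :=
  (SchwartzMap.toLpCLM ℂ ℂ 2 volume).toLinearMap ∘ₗ helmholtz

lemma helmholtzL2_apply (ψ : 𝓢(V, ℂ)) : helmholtzL2 ψ = (helmholtz ψ).toLp 2 := rfl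

variable (V) in
lemma ae_sq_two_pi_mul_norm_sub_one_ne_zero [Nontrivial V] :
    ∀ᵐ z : V, (2 * Real.pi * ‖z‖) ^ 2 - 1 ≠ 0 := by
  refine measure_mono_null (fun z hz => ?_)
    (Measure.addHaar_sphere (volume : Measure V) 0 (2 * Real.pi)⁻¹)
  have hsq : (2 * Real.pi * ‖z‖) ^ 2 = 1 := sub_eq_zero.1 (not_not.1 hz)
  rw [mem_sphere_zero_iff_norm]
  exact eq_inv_of_mul_eq_one_right
    ((pow_eq_one_iff_of_nonneg (by positivity) two_ne_zero).1 hsq)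

lemma ae_smul_fourier_eq_zero_of_inner_helmholtzL2 {v : Lp ℂ 2 (volume : Measure V)}
    (hv : ∀ ψ, inner ℂ (helmholtzL2 ψ) v = 0) :
    ∀ᵐ z, ((2 * Real.pi * ‖z‖) ^ 2 - 1) • 𝓕 v z = 0 := by
  refine ae_eq_zero_of_integral_contDiff_smul_eq_zero
    (((Lp.memLp (𝓕 v)).locallyIntegrable one_le_two).continuous_smul (by fun_prop))
    fun g hg hgc => ?_
  have hcompact : HasCompactSupport (Complex.ofRealCLM ∘ g) := hgc.comp_left rfl
  have hsmooth : ContDiff ℝ (⊤ : ℕ∞) (Complex.ofRealCLM ∘ g) := by fun_prop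
  let G : 𝓢(V, ℂ) := hcompact.toSchwartzMap hsmooth
  have hG (z : V) : G z = (g z : ℂ) := rfl
  have horth := hv (𝓕⁻ G)
  rw [← Lp.inner_fourier_eq, helmholtzL2_apply, SchwartzMap.toLp_fourier_eq, L2.inner_def] at horth
  rw [← horth]
  refine integral_congr_ae ?_
  filter_upwards [(𝓕 (helmholtz (𝓕⁻ G))).coeFn_toLp 2 volume] with z hz
  rw [hz, fourier_helmholtz, fourier_fourierInv_eq, hG, ← Complex.ofReal_mul, RCLike.inner_apply,
    Complex.conj_ofReal, smul_smul, Complex.real_smul, mul_comm (g z), mul_comm]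

theorem eq_zero_of_inner_helmholtzL2 [Nontrivial V] {v : Lp ℂ 2 (volume : Measure V)}
    (hv : ∀ ψ, inner ℂ (helmholtzL2 ψ) v = 0) : v = 0 := by
  have hzero : 𝓕 v = 0 := by
    rw [Lp.eq_zero_iff_ae_eq_zero]
    filter_upwards [ae_smul_fourier_eq_zero_of_inner_helmholtzL2 hv,
      ae_sq_two_pi_mul_norm_sub_one_ne_zero V] with z hmul hne
    exact (smul_eq_zero.1 hmul).resolve_left hne
  rw [← norm_eq_zero, ← Lp.norm_fourier_eq, hzero, norm_zero]

theorem denseRange_helmholtzL2 [Nontrivial V] : DenseRange (helmholtzL2 (V := V)) := by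
  rw [DenseRange, ← LinearMap.coe_range, Submodule.dense_iff_topologicalClosure_eq_top,
    Submodule.topologicalClosure_eq_top_iff, Submodule.eq_bot_iff]
  exact fun v hv => eq_zero_of_inner_helmholtzL2 fun ψ => hv _ (LinearMap.mem_range_self _ ψ)

lemma toTemperedDistribution_eq_inner_star (u : Lp ℂ 2 (volume : Measure V)) (χ : 𝓢(V, ℂ)) :
    Lp.toTemperedDistribution u χ = inner ℂ (star u) (χ.toLp 2) := by
  rw [Lp.toTemperedDistribution_apply, L2.inner_def]
  refine integral_congr_ae ?_
  filter_upwards [χ.coeFn_toLp 2 volume, Lp.coeFn_star u] with x hχ hu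
  rw [hχ, hu, Pi.star_apply, RCLike.inner_apply, RCLike.star_def, RCLike.conj_conj, smul_eq_mul]

lemma norm_star_Lp_two (v : Lp ℂ 2 (volume : Measure V)) : ‖star v‖ = ‖v‖ := by
  rw [Lp.norm_def, Lp.norm_def, eLpNorm_congr_ae (Lp.coeFn_star v), eLpNorm_star]

end Duality

section Solution

variable {n : ℕ} {p : ℝ≥0∞} [Fact (1 ≤ p)] {f : Lp ℂ p (volume : Measure (Space n))}

lemma isSolution_iff {u : Lp ℂ 2 (volume : Measure (Space n))} :
    IsSolution u f ↔
      ∀ ψ, inner ℂ (star u) (helmholtzL2 ψ) = Lp.toTemperedDistribution f ψ := by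
  have hweak (ψ : 𝓢(Space n, ℂ)) : (-(Δ (Lp.toTemperedDistribution u)) -
      Lp.toTemperedDistribution u) ψ = inner ℂ (star u) (helmholtzL2 ψ) := by
    rw [helmholtzL2_apply, ← toTemperedDistribution_eq_inner_star, helmholtz_apply, map_sub,
      map_neg, ← TemperedDistribution.laplacian_apply_apply]
    rfl
  simp only [IsSolution, ← hweak]
  exact DFunLike.ext_iff

theorem existsUnique_isSolution_of_norm_le [Nontrivial (Space n)] {C : ℝ} (hC : 0 ≤ C)
    (hf : ∀ ψ, ‖Lp.toTemperedDistribution f ψ‖ ≤ C * ‖helmholtzL2 ψ‖) :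
    (∃! u : Lp ℂ 2 (volume : Measure (Space n)), IsSolution u f) ∧
      ∀ u : Lp ℂ 2 (volume : Measure (Space n)), IsSolution u f → ‖u‖ ≤ C := by
  let F : 𝓢(Space n, ℂ) →ₗ[ℂ] ℂ := (Lp.toTemperedDistribution f).toLinearMap
  have hdense := denseRange_helmholtzL2 (V := Space n)
  let Λ := F.extendOfNorm helmholtzL2
  let v := (InnerProductSpace.toDual ℂ (Lp ℂ 2 (volume : Measure (Space n)))).symm Λ
  have hv (ψ : 𝓢(Space n, ℂ)) : inner ℂ v (helmholtzL2 ψ) = Lp.toTemperedDistribution f ψ := by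
    rw [InnerProductSpace.toDual_symm_apply]
    exact LinearMap.extendOfNorm_eq hdense ⟨C, hf⟩ ψ
  have hvC : ‖v‖ ≤ C := by
    rw [LinearIsometryEquiv.norm_map]
    exact LinearMap.opNorm_extendOfNorm_le hdense hC hf
  have hsol : IsSolution (star v) f := isSolution_iff.2 fun ψ => by rw [star_star, hv]
  have huniq (u : Lp ℂ 2 (volume : Measure (Space n))) (hu : IsSolution u f) : u = star v := by
    rw [← star_inj, star_star]
    exact hdense.eq_of_inner_left ℂ fun ψ => (isSolution_iff.1 hu ψ).trans (hv ψ).symm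
  refine ⟨⟨star v, hsol, huniq⟩, fun u hu => ?_⟩
  rwa [huniq u hu, norm_star_Lp_two]

end Solution

section Exponent

variable {n : ℕ} {p : ℝ≥0∞}

lemma ne_top_of_le_div (hp : p ≤ (2 * n + 2 : ℝ≥0∞) / (n + 5)) : p ≠ ∞ :=
  ne_top_of_le_ne_top (ENNReal.div_ne_top (by finiteness) (by positivity)) hp

lemma div_le_toReal (hp : p ≠ ∞) (hle : (2 * n : ℝ≥0∞) / (n + 4) ≤ p) :
    2 * (n : ℝ) / (n + 4) ≤ p.toReal := by
  have hreal := ENNReal.toReal_mono hp hle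
  rwa [ENNReal.toReal_div, ENNReal.toReal_mul, ENNReal.toReal_add (by finiteness) (by finiteness),
    ENNReal.toReal_natCast, ENNReal.toReal_ofNat, ENNReal.toReal_ofNat] at hreal

lemma toReal_le_div (hp : p ≤ (2 * n + 2 : ℝ≥0∞) / (n + 5)) :
    p.toReal ≤ (2 * (n : ℝ) + 2) / (n + 5) := by
  have hreal := ENNReal.toReal_mono
    (ENNReal.div_ne_top (by finiteness) (by positivity)) hp
  rwa [ENNReal.toReal_div, ENNReal.toReal_add (by finiteness) (by finiteness), ENNReal.toReal_mul,
    ENNReal.toReal_add (by finiteness) (by finiteness), ENNReal.toReal_natCast,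
    ENNReal.toReal_ofNat, ENNReal.toReal_ofNat] at hreal

end Exponent

theorem exists_norm_powForm_two_le_norm_toLp {n : ℕ} {p : ℝ≥0∞} [Fact (1 ≤ p)]
    (hp_lower : (2 * n : ℝ≥0∞) / (n + 4) ≤ p) (hp_upper : p ≤ (2 * n + 2 : ℝ≥0∞) / (n + 5))
    (hnp : (n, p) ≠ (4, 1)) :
    ∃ A : ℝ, ∀ ε : ℝ, 0 < ε → ε ≤ 1 → ∀ φ : 𝓢(Space n, ℂ),
      ‖powForm ε 2 φ (fun x => starRingEnd ℂ (φ x))‖ ≤ A * ‖φ.toLp p volume‖ ^ 2 := by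
  have hp_top := ne_top_of_le_div hp_upper
  have hofReal : ENNReal.ofReal p.toReal = p := ENNReal.ofReal_toReal hp_top
  have hp_one : 1 ≤ p.toReal := by simpa using ENNReal.toReal_mono hp_top (Fact.out : 1 ≤ p)
  have hnp' : ¬(Module.finrank ℝ (Space n) = 4 ∧ p.toReal = 1) := by
    rintro ⟨hn, h⟩
    rw [finrank_euclideanSpace_fin] at hn
    exact hnp (by rw [hn, ← hofReal, h, ENNReal.ofReal_one])
  obtain ⟨A, -, hA⟩ := exists_norm_powForm_two_le (V := Space n) hp_one
    (by simpa using div_le_toReal hp_top hp_lower) (by simpa using toReal_le_div hp_upper) hnp'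
  simp only [hofReal, ← SchwartzMap.norm_toLp] at hA
  exact ⟨A, hA⟩

end Helmholtz

end

theorem mainTheorem1 (n : ℕ) (hn : 3 ≤ n) (p : ℝ≥0∞) [Fact (1 ≤ p)]
    (hp_lower : max 1 ((2 * n : ℝ≥0∞) / (n + 4)) ≤ p)
    (hp_upper : p ≤ (2 * n + 2 : ℝ≥0∞) / (n + 5))
    (hnp : (n, p) ≠ (4, 1)) :
    ∃ C : ℝ, ∀ f : Lp ℂ p (volume : Measure (Helmholtz.Space n)),
      Helmholtz.FourierVanishesOnSphere f →
        (∃! u : Lp ℂ 2 (volume : Measure (Helmholtz.Space n)), Helmholtz.IsSolution u f) ∧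
        ∀ u : Lp ℂ 2 (volume : Measure (Helmholtz.Space n)),
          Helmholtz.IsSolution u f → ‖u‖ ≤ C * ‖f‖ := by
  have : NeZero n := ⟨by omega⟩
  obtain ⟨A, hA⟩ := Helmholtz.exists_norm_powForm_two_le_norm_toLp
    ((le_max_right _ _).trans hp_lower) hp_upper hnp
  refine ⟨√A, fun f hf => ?_⟩
  obtain ⟨φ, hφ, htrace⟩ := Helmholtz.exists_tendsto_traceEnergy_zero hf
  exact Helmholtz.existsUnique_isSolution_of_norm_le (by positivity) fun ψ =>
    Helmholtz.norm_toTemperedDistribution_le hA hφ htrace ψ
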